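/- **Setting.** Let $X$ be a real $n\times p$ matrix of rank $p$ whose columns $x_1,\dots,x_p$ are pairwise orthogonal and centered ($\mathbf 1_n^Tx_j=0$). Let $\{1,\dots,p\}=\mathcal I_1\sqcup\mathcal I_2$ with both parts nonempty, let $X_1,X_2$ be the corresponding column submatrices, and consider the models $$\mathcal M_{\gamma_0}:\ y=\mathbf 1_n\beta_0+X_1\beta_1+\epsilon,\qquad \mathcal M_{\gamma_a}:\ y=\mathbf 1_n\beta_0+X_1\beta_1+X_2\beta_2+\epsilon,\qquad \epsilon\sim N_n(0,\sigma^2I_n).$$ **Prior.** In a model with $n\times c$ design matrix $X_\gamma$, $(\beta_0,\sigma^2)$ has the reference prior $1/\sigma^2$, and, given $\sigma^2$, $\beta_\gamma$ has the Dirichlet process mixture of block $g$ priors with hyper-$g/n$ base measure: $\beta_\gamma\sim N\big(0,\sigma^2G^{1/2}(X_\gamma^TX_\gamma)^{-1}G^{1/2}\big)$ with $G=\mathrm{diag}(g_1,\dots,g_c)$; coefficients in the same block of a random partition $\rho=\{S_1,\dots,S_K\}$ of the index set share one value of $g$; the values of different blocks are i.i.d. with density $f(g)=\frac{a+1}{n}\left(1+\frac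 gn\right)^{-a-2}$, $g>0$, where $-\frac12\le a\le 0$; and $$f(\rho\mid\alpha)=\frac{\Gamma(\alpha)}{\Gamma(\alpha+c)}\,\alpha^K\prod_{k=1}^K\Gamma(|S_k|),\qquad f(\alpha)\propto\sqrt{\frac1\alpha\sum_{j=1}^{c-1}\frac{j}{(\alpha+j)^2}}\quad(\alpha>0),$$ the density of $\alpha$ being normalized to integrate to one (if $c=1$ there is only one partition, it has probability one, and no prior on $\alpha$ is needed). Let $f(y\mid\gamma)\in[0,\infty]$ be the resulting marginal likelihood, i.e. the integral of the Gaussian likelihood times the prior over $(\beta_0,\beta_\gamma,\sigma^2)$, and $BF_{\gamma_a,\gamma_0}(y)=f(y\mid\gamma_a)/f(y\mid\gamma_0)$. **Data.** Fix $\beta_0$, $\beta_2$ and $\epsilon\in\mathbb R^n$, let $\beta_1(N)$ be vectors such that $\beta_j(N)^2$ is of exact order $N$ as $N\to\infty$ (that is, $\beta_j(N)^2=\Theta(N)$) for each $j\in\mathcal I_1$, and let $y(N)=\mathbf 1_n\beta_0+X_1\beta_1(N)+X_2\beta_2+\epsilon$. Assume that the small model does not fit the data perfectly, i.e. $X_2\beta_2+\epsilon$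 is not a linear combination of $\mathbf 1_n$ and the columns of $X_1$. **Theorem.** Then $0<f(y(N)\mid\gamma_0)<\infty$ for all $N$, and $$\liminf_{N\to\infty}BF_{\gamma_a,\gamma_0}(y(N))>0 .$$ Suppose moreover that one of the following holds: 1. $\epsilon$ is not a linear combination of $\mathbf 1_n$ and the columns of $X$ (this forces $n\ge p+2$, and then holds for Lebesgue-almost every $\epsilon$); 2. $n=p+1$, $x_j^T(X_2\beta_2+\epsilon)\ne0$ for all $j\in\mathcal I_2$, and $\beta_j(N)^2/N$ converges for each $j\in\mathcal I_1$. Then $f(y(N)\mid\gamma_a)<\infty$ for all large $N$, and the limit $\lim_{N\to\infty}BF_{\gamma_a,\gamma_0}(y(N))$ exists and is positive and finite. So the conditional Lindley paradox is avoided. -/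

import Mathlib

open MeasureTheory Filter Topology Asymptotics
open scoped ENNReal Matrix

noncomputable section

namespace BlockG

/-- Density at `x` of the multivariate normal law `N(m, S)` with mean `m` and (nonsingular)
covariance matrix `S`. -/
def normalPDF {κ : Type*} [Fintype κ] [DecidableEq κ]
    (m : κ → ℝ) (S : Matrix κ κ ℝ) (x : κ → ℝ) : ℝ :=
  (2 * Real.pi) ^ (-(Fintype.card κ : ℝ) / 2) * S.det ^ (-(1 : ℝ) / 2) *
    Real.exp (-(1 / 2) * ((x - m) ⬝ᵥ (S⁻¹ *ᵥ (x - m))))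

/-- The density `f(g ∣ τ², a, b)` on `(0, ∞)`; it is proper for `a, b > -1` and `τ² > 0`. -/
def shrinkagePDF (τ2 a b g : ℝ) : ℝ :=
  if 0 < g then
    Real.Gamma (a + b + 2) / (τ2 * Real.Gamma (a + 1) * Real.Gamma (b + 1)) *
      g ^ b * (1 + g / τ2) ^ (-a - b - 2)
  else 0

/-- The probability `f(ρ ∣ α)` of the partition `ρ` of `ι` that is induced by the ties in a
sample, indexed by `ι`, from a Dirichlet process with concentration parameter `α`. -/
def partitionProb {ι : Type*} [Fintype ι] [DecidableEq ι]
    (α : ℝ) (ρ : Finpartition (Finset.univ : Finset ι)) : ℝ :=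
  Real.Gamma α / Real.Gamma (α + Fintype.card ι) * α ^ ρ.parts.card *
    ∏ S ∈ ρ.parts, Real.Gamma (S.card : ℝ)

/-- The default (Jeffreys-type) prior density of the concentration parameter for `c`
coefficients, up to its normalizing constant. -/
def concentrationKernel (c : ℕ) (α : ℝ) : ℝ :=
  Real.sqrt (1 / α * ∑ j ∈ Finset.Icc 1 (c - 1), (j : ℝ) / (α + j) ^ 2)

/-- The default prior law of the concentration parameter, normalized to total mass one.
With `c ≤ 1` coefficients the kernel vanishes identically, while the law of the partition does
not depend on `α` at all; `α` is then set to `1`. -/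
def concentrationPrior (c : ℕ) : Measure ℝ :=
  if c ≤ 1 then Measure.dirac 1
  else
    (∫⁻ α in Set.Ioi (0 : ℝ), ENNReal.ofReal (concentrationKernel c α))⁻¹ •
      (volume.restrict (Set.Ioi (0 : ℝ))).withDensity
        (fun α => ENNReal.ofReal (concentrationKernel c α))

/-- The block of the partition `ρ` that contains `j`. -/
def blockOf {ι : Type*} [Fintype ι] [DecidableEq ι]
    (ρ : Finpartition (Finset.univ : Finset ι)) (j : ι) : ρ.parts :=
  ⟨ρ.part j, ρ.part_mem.2 (Finset.mem_univ j)⟩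

/-- The prior covariance matrix `σ² G^{1/2} (XᵀX)⁻¹ G^{1/2}`, where `G = diag(g)`. -/
def priorCov {n : ℕ} {ι : Type*} [Fintype ι] [DecidableEq ι]
    (X : Matrix (Fin n) ι ℝ) (σ2 : ℝ) (g : ι → ℝ) : Matrix ι ι ℝ :=
  σ2 • (Matrix.diagonal (fun j => Real.sqrt (g j)) * (Xᵀ * X)⁻¹ *
    Matrix.diagonal (fun j => Real.sqrt (g j)))

/-- The Dirichlet process mixture of block `g` priors: the density at `β` of the vector of
coefficients of the design matrix `X`, given the variance `σ²`.  Coefficients in the same block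
`S` of the random partition `ρ` share the shrinkage factor `gt S`, and the shrinkage factors
of different blocks are independent with density `shrinkagePDF τ2 a b`. -/
def dpBlockGPrior {n : ℕ} {ι : Type*} [Fintype ι] [DecidableEq ι]
    (τ2 a b : ℝ) (X : Matrix (Fin n) ι ℝ) (σ2 : ℝ) (β : ι → ℝ) : ℝ≥0∞ :=
  ∫⁻ α, (∑ ρ : Finpartition (Finset.univ : Finset ι),
    ENNReal.ofReal (partitionProb α ρ) *
      ∫⁻ gt : ρ.parts → ℝ,
        ENNReal.ofReal (∏ S, shrinkagePDF τ2 a b (gt S)) *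
          ENNReal.ofReal (normalPDF 0 (priorCov X σ2 (fun j => gt (blockOf ρ j))) β))
    ∂(concentrationPrior (Fintype.card ι))

/-- The marginal likelihood `f(y)` of the linear model `y = 1 β₀ + X β + ε`,
`ε ∼ N(0, σ² I)`, under the reference prior `1 / σ²` for `(β₀, σ²)` and the Dirichlet process
mixture of block `g` priors for `β` given `σ²`. -/
def marginalLikelihood {n : ℕ} {ι : Type*} [Fintype ι] [DecidableEq ι]
    (τ2 a b : ℝ) (X : Matrix (Fin n) ι ℝ) (y : Fin n → ℝ) : ℝ≥0∞ :=
  ∫⁻ σ2 in Set.Ioi (0 : ℝ), ∫⁻ β₀ : ℝ, ∫⁻ β : ι → ℝ,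
    ENNReal.ofReal (normalPDF ((fun _ => β₀) + X *ᵥ β) (σ2 • (1 : Matrix (Fin n) (Fin n) ℝ)) y) *
      (ENNReal.ofReal (1 / σ2) * dpBlockGPrior τ2 a b X σ2 β)

/-- The columns of the design matrix `X` with index in `γ`. -/
def cols {n p : ℕ} (X : Matrix (Fin n) (Fin p) ℝ) (γ : Finset (Fin p)) :
    Matrix (Fin n) {j // j ∈ γ} ℝ :=
  X.submatrix id Subtype.val

/-- The Bayes factor of the model with columns `γ` against the model with columns `γ'`. -/
def bayesFactor {n p : ℕ} (τ2 a b : ℝ) (X : Matrix (Fin n) (Fin p) ℝ)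
    (γ γ' : Finset (Fin p)) (y : Fin n → ℝ) : ℝ≥0∞ :=
  marginalLikelihood τ2 a b (cols X γ) y / marginalLikelihood τ2 a b (cols X γ') y

/-- `v` is a linear combination of the vector of ones and the columns of `X`. -/
def FitsExactly {n : ℕ} {ι : Type*} [Fintype ι]
    (X : Matrix (Fin n) ι ℝ) (v : Fin n → ℝ) : Prop :=
  ∃ (c : ℝ) (β : ι → ℝ), v = (fun _ => c) + X *ᵥ β

end BlockG

end

/-! ### Lebesgue integrals over finite products -/

namespace BlockG

/-! Orthogonality makes the Gaussian integrals explicit. `IsOrthoDesign.marginalLikelihood_eq` and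
`exists_ridge_eq` turn the marginal likelihood into a finite sum over partitions of positive weights
times ∫ ∏ f(g_S)(1+g_S)^(-|S|/2) · (R + ∑ T_S/(1+g_S))^(-r) dg, with r = (n-1)/2, where R is the
residual sum of squares and T_S the sum of squares explained by block S. Along the data R and the
contributions of the columns outside I₁ are constant, while those of the columns in I₁ grow like N.

Lower bound: extend each partition of I₁ by the block I₂. Shrinking T_{I₂} by 1/(1+g) leaves at most
T_{I₂}, and R_a + T_{I₂} = R₀, so the large model's integral is at least a fixed multiple of the
small model's (`exists_sum_blockIntegral_le`). This holds for every N.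

Limit: in u = 1+g a block of size κ has density tail u^(-q-1) with capacity q = a+1+κ/2. One block
with T → ∞ contributes order T^(-q) if q < r and T^(-r) log T if q = r (`isScale_of_lt`,
`isScale_of_eq`). Take q to be the capacity of I₁. If q ≤ r, the partitions having I₁ as a block
have exactly this order. In any other partition the blocks meeting I₁ have strictly larger total
capacity (`cap_lt_sum_meeting`), and distributing the exponent r over the blocks and R shows it to
be negligible (`powerIntegral_le`, `exists_exponents`). The small model is the same situation with
I₁ the whole index set, so one normalization, a function of the total growing sum of squares, serves
both models. If q > r, every partition has order N^(-r) by homogeneity, and the limit depends on the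
limits of β_j²/N (`tendsto_partition_of_lt`); this occurs only in the second case.

With n = p+1 the bound R_a > 0 is not available. Integrability near a vanishing shrunken sum of
squares then comes from r = p/2 being below the total capacity of every partition
(`half_card_lt_sum_cap`). -/

theorem lintegral_pi_equiv {ι κ : Type*} [Fintype ι] [Fintype κ] (e : ι ≃ κ)
    (f : (κ → ℝ) → ℝ≥0∞) :
    ∫⁻ x : κ → ℝ, f x = ∫⁻ x : ι → ℝ, f (fun k => x (e.symm k)) := by
  have h := (volume_measurePreserving_piCongrLeft (fun _ : κ => ℝ) e).lintegral_map_equiv f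
  rw [h]
  refine lintegral_congr fun x => ?_
  congr 1
  funext k
  obtain ⟨i, rfl⟩ := e.surjective k
  simp [MeasurableEquiv.coe_piCongrLeft, Equiv.piCongrLeft_apply_apply]

theorem lintegral_pi_option {ι : Type*} [Fintype ι]
    {f : (Option ι → ℝ) → ℝ≥0∞} (hf : Measurable f) :
    ∫⁻ x : Option ι → ℝ, f x =
      ∫⁻ x : ι → ℝ, ∫⁻ t : ℝ, f (fun o => o.elim t x) := by
  have h := Measure.pi_map_piOptionEquivProd (β := fun _ : Option ι => ℝ) (fun _ => volume)
  rw [show (volume : Measure (Option ι → ℝ)) = Measure.pi fun _ => volume from rfl, ← h,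
    lintegral_map_equiv, lintegral_prod _ (by fun_prop)]
  refine lintegral_congr fun x => lintegral_congr fun t => ?_
  congr 1
  funext o
  cases o <;> rfl

theorem lintegral_pi_prod {ι : Type*} [Fintype ι] (f : ι → ℝ → ℝ≥0∞)
    (hf : ∀ i, Measurable (f i)) :
    ∫⁻ x : ι → ℝ, ∏ i, f i (x i) = ∏ i, ∫⁻ t, f i t := by
  refine Fintype.induction_empty_option
    (P := fun κ _ => ∀ f : κ → ℝ → ℝ≥0∞, (∀ i, Measurable (f i)) →
      ∫⁻ x : κ → ℝ, ∏ i, f i (x i) = ∏ i, ∫⁻ t, f i t) ?_ ?_ ?_ ι f hf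
  · intro α β _ e ih f hf
    let := Fintype.ofEquiv β e.symm
    rw [lintegral_pi_equiv e]
    have h := ih (fun i => f (e i)) (fun i => hf _)
    rw [← Equiv.prod_comp e, ← h]
    refine lintegral_congr fun x => ?_
    rw [← Equiv.prod_comp e]
    simp
  · intro f _
    simp [lintegral_unique, volume_pi]
  · intro α _ ih f hf
    rw [lintegral_pi_option (by fun_prop)]
    simp only [Fintype.prod_option, Option.elim_none, Option.elim_some]
    rw [← ih (fun i => f (some i)) (fun i => hf _)]
    have h1 : ∀ x : α → ℝ, ∫⁻ t, f none t * ∏ i, f (some i) (x i) =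
        (∫⁻ t, f none t) * ∏ i, f (some i) (x i) := fun x =>
      lintegral_mul_const _ (hf none)
    simp_rw [h1]
    rw [lintegral_const_mul _ (by fun_prop)]

end BlockG

/-! ### Least squares for orthogonal centered designs -/

noncomputable section
namespace BlockG

/-- The squared Euclidean norm of the column `j` of `X`. -/
def colSq {n : ℕ} {ι : Type*} (X : Matrix (Fin n) ι ℝ) (j : ι) : ℝ := ∑ i, X i j ^ 2

/-- The least squares coefficient of `y` on the column `j` alone. -/
def lsCoef {n : ℕ} {ι : Type*} (X : Matrix (Fin n) ι ℝ) (y : Fin n → ℝ) (j : ι) : ℝ :=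
  (∑ i, X i j * y i) / colSq X j

/-- The sum of squares explained by the column `j`. -/
def fitSq {n : ℕ} {ι : Type*} (X : Matrix (Fin n) ι ℝ) (y : Fin n → ℝ) (j : ι) : ℝ :=
  colSq X j * lsCoef X y j ^ 2

/-- The mean of the entries of `y`. -/
def mean {n : ℕ} (y : Fin n → ℝ) : ℝ := (∑ i, y i) / n

/-- The residual sum of squares of `y` after regression on the vector of ones and the
(orthogonal, centered) columns of `X`. -/
def rss {n : ℕ} {ι : Type*} [Fintype ι] (X : Matrix (Fin n) ι ℝ) (y : Fin n → ℝ) : ℝ :=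
  ∑ i, (y i - mean y) ^ 2 - ∑ j, fitSq X y j

/-- The columns of `X` are nonzero, centered and pairwise orthogonal. -/
structure IsOrthoDesign {n : ℕ} {ι : Type*} (X : Matrix (Fin n) ι ℝ) : Prop where
  centered : ∀ j, ∑ i, X i j = 0
  orth : ∀ j k, j ≠ k → ∑ i, X i j * X i k = 0
  colSq_pos : ∀ j, 0 < colSq X j
  size_pos : 0 < n

theorem fitSq_nonneg {n : ℕ} {ι : Type*} (X : Matrix (Fin n) ι ℝ) (y : Fin n → ℝ) (j : ι) :
    0 ≤ fitSq X y j :=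
  mul_nonneg (Finset.sum_nonneg fun _ _ => sq_nonneg _) (sq_nonneg _)

theorem sum_sub_mean {n : ℕ} (hn : 0 < n) (y : Fin n → ℝ) : ∑ i, (y i - mean y) = 0 := by
  have : (n : ℝ) ≠ 0 := by positivity
  simp [Finset.sum_sub_distrib, mean]
  field_simp
  simp

theorem IsOrthoDesign.sum_mul_sub_mean {n : ℕ} {ι : Type*} {X : Matrix (Fin n) ι ℝ}
    (hX : IsOrthoDesign X) (y : Fin n → ℝ) (j : ι) :
    ∑ i, X i j * (y i - mean y) = colSq X j * lsCoef X y j := by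
  have h := (hX.colSq_pos j).ne'
  simp only [mul_sub, Finset.sum_sub_distrib, ← Finset.sum_mul, hX.centered j, zero_mul, sub_zero,
    lsCoef]
  field_simp

variable {n : ℕ} {ι : Type*} [Fintype ι] {X : Matrix (Fin n) ι ℝ}

theorem IsOrthoDesign.sum_mulVec (hX : IsOrthoDesign X) (β : ι → ℝ) :
    ∑ i, (X *ᵥ β) i = 0 := by
  simp only [Matrix.mulVec, dotProduct]
  rw [Finset.sum_comm]
  refine Finset.sum_eq_zero fun j _ => ?_
  rw [← Finset.sum_mul, hX.centered, zero_mul]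

theorem IsOrthoDesign.sum_mul_mulVec (hX : IsOrthoDesign X) (β : ι → ℝ) (j : ι) :
    ∑ i, X i j * (X *ᵥ β) i = colSq X j * β j := by
  simp only [Matrix.mulVec, dotProduct, Finset.mul_sum]
  rw [Finset.sum_comm, Finset.sum_eq_single j]
  · rw [colSq, Finset.sum_mul]
    exact Finset.sum_congr rfl fun i _ => by ring
  · intro k _ hk
    have h := hX.orth j k hk.symm
    calc ∑ i, X i j * (X i k * β k) = (∑ i, X i j * X i k) * β k := by
          rw [Finset.sum_mul]; exact Finset.sum_congr rfl fun i _ => by ring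
      _ = 0 := by rw [h, zero_mul]
  · simp

theorem sum_mul_mulVec_eq (X : Matrix (Fin n) ι ℝ) (z : Fin n → ℝ) (β : ι → ℝ) :
    ∑ i, z i * (X *ᵥ β) i = ∑ j, β j * ∑ i, X i j * z i := by
  simp only [Matrix.mulVec, dotProduct, Finset.mul_sum]
  rw [Finset.sum_comm]
  exact Finset.sum_congr rfl fun j _ => Finset.sum_congr rfl fun i _ => by ring

/-- The residual decomposition of the sum of squares. -/
theorem IsOrthoDesign.sum_sq_eq (hX : IsOrthoDesign X) (y : Fin n → ℝ) (c : ℝ) (β : ι → ℝ) :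
    ∑ i, (y i - (c + (X *ᵥ β) i)) ^ 2 =
      rss X y + n * (c - mean y) ^ 2 + ∑ j, colSq X j * (β j - lsCoef X y j) ^ 2 := by
  have e1 : ∀ i, (y i - (c + (X *ᵥ β) i)) ^ 2 = (y i - mean y) ^ 2 + (c - mean y) ^ 2
      + (X *ᵥ β) i * (X *ᵥ β) i - 2 * (c - mean y) * (y i - mean y)
      + 2 * (c - mean y) * (X *ᵥ β) i - 2 * ((y i - mean y) * (X *ᵥ β) i) := fun i => by ring
  have e2 : ∑ i, (X *ᵥ β) i * (X *ᵥ β) i = ∑ j, colSq X j * β j ^ 2 := by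
    rw [sum_mul_mulVec_eq]
    exact Finset.sum_congr rfl fun j _ => by rw [hX.sum_mul_mulVec]; ring
  have e3 : ∑ i, (y i - mean y) * (X *ᵥ β) i = ∑ j, β j * (colSq X j * lsCoef X y j) := by
    rw [sum_mul_mulVec_eq]
    exact Finset.sum_congr rfl fun j _ => by rw [hX.sum_mul_sub_mean]
  have e4 : ∑ j, colSq X j * (β j - lsCoef X y j) ^ 2 =
      ∑ j, colSq X j * β j ^ 2 - 2 * ∑ j, β j * (colSq X j * lsCoef X y j)
        + ∑ j, fitSq X y j := by
    rw [Finset.mul_sum, ← Finset.sum_sub_distrib, ← Finset.sum_add_distrib]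
    exact Finset.sum_congr rfl fun j _ => by rw [fitSq]; ring
  simp only [e1, Finset.sum_sub_distrib, Finset.sum_add_distrib, ← Finset.mul_sum]
  rw [e2, e3, e4, ← Finset.sum_sub_distrib, sum_sub_mean hX.size_pos, hX.sum_mulVec, rss]
  simp
  ring

theorem IsOrthoDesign.rss_eq (hX : IsOrthoDesign X) (y : Fin n → ℝ) :
    rss X y = ∑ i, (y i - (mean y + (X *ᵥ lsCoef X y) i)) ^ 2 := by
  rw [hX.sum_sq_eq]; simp

theorem IsOrthoDesign.rss_nonneg (hX : IsOrthoDesign X) (y : Fin n → ℝ) : 0 ≤ rss X y := by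
  rw [hX.rss_eq]; exact Finset.sum_nonneg fun _ _ => sq_nonneg _

theorem IsOrthoDesign.rss_pos (hX : IsOrthoDesign X) {y : Fin n → ℝ}
    (hy : ¬ FitsExactly X y) : 0 < rss X y := by
  refine lt_of_le_of_ne (hX.rss_nonneg y) fun h => hy ⟨mean y, lsCoef X y, ?_⟩
  rw [hX.rss_eq, eq_comm, Finset.sum_eq_zero_iff_of_nonneg fun _ _ => sq_nonneg _] at h
  funext i
  have := h i (Finset.mem_univ i)
  rw [sq_eq_zero_iff, sub_eq_zero] at this
  simpa using this

theorem IsOrthoDesign.lsCoef_add (hX : IsOrthoDesign X) (c : ℝ) (β : ι → ℝ) (u : Fin n → ℝ)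
    (j : ι) : lsCoef X ((fun _ => c) + X *ᵥ β + u) j = β j + lsCoef X u j := by
  have h := (hX.colSq_pos j).ne'
  simp only [lsCoef, Pi.add_apply, mul_add, Finset.sum_add_distrib, ← Finset.sum_mul,
    hX.centered, hX.sum_mul_mulVec]
  field_simp
  ring

theorem IsOrthoDesign.mean_add (hX : IsOrthoDesign X) (c : ℝ) (β : ι → ℝ) (u : Fin n → ℝ) :
    mean ((fun _ => c) + X *ᵥ β + u) = c + mean u := by
  have : (n : ℝ) ≠ 0 := by have := hX.size_pos; positivity
  simp only [mean, Pi.add_apply, Finset.sum_add_distrib, hX.sum_mulVec]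
  simp
  field_simp

/-- The data move with N only inside the span of the small design, so this makes the residual sum of
squares constant in N. -/
theorem IsOrthoDesign.rss_add (hX : IsOrthoDesign X) (c : ℝ) (β : ι → ℝ) (u : Fin n → ℝ) :
    rss X ((fun _ => c) + X *ᵥ β + u) = rss X u := by
  rw [hX.rss_eq, hX.rss_eq, hX.mean_add]
  refine Finset.sum_congr rfl fun i _ => ?_
  have : lsCoef X ((fun _ => c) + X *ᵥ β + u) = β + lsCoef X u := by
    funext j; exact hX.lsCoef_add c β u j
  rw [this, Matrix.mulVec_add]
  simp only [Pi.add_apply]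
  congr 1
  ring

/-! ### Gaussian densities and integrals -/

theorem normalPDF_diagonal {κ : Type*} [Fintype κ] [DecidableEq κ] (m x v : κ → ℝ)
    (hv : ∀ i, 0 < v i) :
    normalPDF m (Matrix.diagonal v) x =
      ∏ i, ((2 * Real.pi * v i) ^ (-(1 : ℝ) / 2) * Real.exp (-(x i - m i) ^ 2 / (2 * v i))) := by
  have hinv : (Matrix.diagonal v)⁻¹ = Matrix.diagonal fun i => (v i)⁻¹ := by
    refine Matrix.inv_eq_right_inv ?_
    rw [Matrix.diagonal_mul_diagonal, ← Matrix.diagonal_one]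
    congr 1
    funext i
    exact mul_inv_cancel₀ (hv i).ne'
  rw [normalPDF, hinv, Matrix.det_diagonal, Finset.prod_mul_distrib, ← Real.exp_sum]
  congr 1
  · rw [Finset.prod_congr rfl fun i _ => Real.mul_rpow (by positivity) (hv i).le,
      Finset.prod_mul_distrib, Real.finsetProd_rpow _ _ fun i _ => (hv i).le]
    congr 1
    rw [Finset.prod_const, ← Real.rpow_natCast, ← Real.rpow_mul (by positivity)]
    congr 1
    rw [Finset.card_univ]
    ring
  · congr 1
    simp only [dotProduct, Matrix.mulVec_diagonal, Finset.mul_sum, Pi.sub_apply]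
    refine Finset.sum_congr rfl fun i _ => ?_
    have := (hv i).ne'
    field_simp

theorem normalPDF_smul_one {s : ℝ} (hs : 0 < s) (m x : Fin n → ℝ) :
    normalPDF m (s • (1 : Matrix (Fin n) (Fin n) ℝ)) x =
      (2 * Real.pi * s) ^ (-(n : ℝ) / 2) * Real.exp (-(∑ i, (x i - m i) ^ 2) / (2 * s)) := by
  have h : s • (1 : Matrix (Fin n) (Fin n) ℝ) = Matrix.diagonal fun _ => s := by
    rw [← Matrix.diagonal_one, ← Matrix.diagonal_smul]
    congr 1
    funext
    simp
  rw [h, normalPDF_diagonal _ _ _ fun _ => hs, Finset.prod_mul_distrib, ← Real.exp_sum]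
  congr 1
  · rw [Finset.prod_const, ← Real.rpow_natCast, ← Real.rpow_mul (by positivity)]
    congr 1
    simp
    ring
  · rw [← Finset.sum_div, Finset.sum_neg_distrib]

/-- The Gram matrix is diagonal, so given g the coefficients are independent a priori; the sign
condition is what makes √g · √g equal to g. -/
theorem IsOrthoDesign.priorCov_eq [DecidableEq ι] (hX : IsOrthoDesign X) (s : ℝ) {g : ι → ℝ} (hg : ∀ j, 0 ≤ g j) :
    priorCov X s g = Matrix.diagonal fun j => s * g j / colSq X j := by
  have h1 : Xᵀ * X = Matrix.diagonal (colSq X) := by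
    ext j k
    simp only [Matrix.mul_apply, Matrix.transpose_apply, Matrix.diagonal_apply]
    split_ifs with h
    · subst h
      exact Finset.sum_congr rfl fun i _ => by ring
    · exact hX.orth j k h
  have h2 : (Matrix.diagonal (colSq X))⁻¹ = Matrix.diagonal fun j => (colSq X j)⁻¹ := by
    refine Matrix.inv_eq_right_inv ?_
    rw [Matrix.diagonal_mul_diagonal, ← Matrix.diagonal_one]
    congr 1
    funext i
    exact mul_inv_cancel₀ (hX.colSq_pos i).ne'
  rw [priorCov, h1, h2, Matrix.diagonal_mul_diagonal, Matrix.diagonal_mul_diagonal,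
    ← Matrix.diagonal_smul]
  congr 1
  funext j
  simp only [Pi.smul_apply, smul_eq_mul]
  rw [mul_right_comm, Real.mul_self_sqrt (hg j)]
  ring

theorem lintegral_exp_neg_mul_sq {k : ℝ} (hk : 0 < k) (m : ℝ) :
    ∫⁻ t : ℝ, ENNReal.ofReal (Real.exp (-k * (t - m) ^ 2)) = ENNReal.ofReal (√(Real.pi / k)) := by
  have hi : Integrable fun t : ℝ => Real.exp (-k * (t - m) ^ 2) :=
    (integrable_exp_neg_mul_sq hk).comp_sub_right m
  rw [← ofReal_integral_eq_lintegral_ofReal hi (ae_of_all _ fun _ => (Real.exp_pos _).le),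
    integral_sub_right_eq_self (fun t : ℝ => Real.exp (-k * t ^ 2)) m, integral_gaussian]

theorem lintegral_coef {d s g : ℝ} (hd : 0 < d) (hs : 0 < s) (hg : 0 < g) (b : ℝ) :
    ∫⁻ t : ℝ, ENNReal.ofReal (Real.exp (-(d * (t - b) ^ 2) / (2 * s))) *
        ENNReal.ofReal ((2 * Real.pi * (s * g / d)) ^ (-(1 : ℝ) / 2) *
          Real.exp (-(t - 0) ^ 2 / (2 * (s * g / d)))) =
      ENNReal.ofReal ((1 + g) ^ (-(1 : ℝ) / 2) *
        Real.exp (-(d * b ^ 2 / (1 + g)) / (2 * s))) := by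
  have hk : 0 < d * (1 + g) / (2 * s * g) := by positivity
  have e : ∀ t : ℝ, ENNReal.ofReal (Real.exp (-(d * (t - b) ^ 2) / (2 * s))) *
        ENNReal.ofReal ((2 * Real.pi * (s * g / d)) ^ (-(1 : ℝ) / 2) *
          Real.exp (-(t - 0) ^ 2 / (2 * (s * g / d)))) =
      ENNReal.ofReal ((2 * Real.pi * (s * g / d)) ^ (-(1 : ℝ) / 2) *
        Real.exp (-(d * b ^ 2 / (1 + g)) / (2 * s))) *
      -- Completing the square: the new centre is the least squares coefficient `b` shrunk by
      -- g/(1+g), and the leftover exponent is the shrunken explained sum of squares.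
      ENNReal.ofReal (Real.exp (-(d * (1 + g) / (2 * s * g)) * (t - b * g / (1 + g)) ^ 2)) := by
    intro t
    rw [← ENNReal.ofReal_mul (by positivity), ← ENNReal.ofReal_mul (by positivity)]
    congr 1
    rw [mul_left_comm, ← Real.exp_add, mul_assoc ((2 * Real.pi * (s * g / d)) ^ (-(1 : ℝ) / 2)),
      ← Real.exp_add]
    congr 2
    field_simp
    ring
  simp_rw [e]
  rw [lintegral_const_mul _ (by fun_prop), lintegral_exp_neg_mul_sq hk,
    ← ENNReal.ofReal_mul (by positivity)]
  congr 1
  rw [mul_right_comm]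
  congr 1
  have h1 : Real.pi / (d * (1 + g) / (2 * s * g)) =
      2 * Real.pi * (s * g / d) * (1 + g)⁻¹ := by field_simp
  have h2 : 0 < 2 * Real.pi * (s * g / d) := by positivity
  rw [h1]
  generalize 2 * Real.pi * (s * g / d) = A at h2 ⊢
  rw [Real.sqrt_eq_rpow, Real.mul_rpow h2.le (by positivity), ← mul_assoc,
    ← Real.rpow_add h2, Real.inv_rpow (by positivity), ← Real.rpow_neg (by positivity)]
  norm_num

end BlockG
end

/-! ### Reduction of the marginal likelihood to integrals over the shrinkage factors -/

noncomputable section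
namespace BlockG

/-- The contribution of a block of `κ` coefficients with shrinkage factor `g` to the integrated
likelihood: the prior density of `g` times `(1 + g) ^ (-κ / 2)`. -/
def slab (τ2 a b κ g : ℝ) : ℝ≥0∞ :=
  ENNReal.ofReal (shrinkagePDF τ2 a b g) * ENNReal.ofReal ((1 + g) ^ (-κ / 2))

/-- The integral over the error variance and the intercept of the likelihood of a shrunken residual
sum of squares `Q`. -/
def ridge (n : ℕ) (Q : ℝ) : ℝ≥0∞ :=
  ∫⁻ s in Set.Ioi (0 : ℝ), ENNReal.ofReal (1 / s * (2 * Real.pi * s) ^ (-(n : ℝ) / 2) *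
    √(Real.pi / (n / (2 * s)))) * ENNReal.ofReal (Real.exp (-Q / (2 * s)))

/-- The prior probability of the partition `ρ`. -/
def partitionWeight {ι : Type*} [Fintype ι] [DecidableEq ι]
    (ρ : Finpartition (Finset.univ : Finset ι)) : ℝ≥0∞ :=
  ∫⁻ α, ENNReal.ofReal (partitionProb α ρ) ∂(concentrationPrior (Fintype.card ι))

/-- The integral over the shrinkage factors of blocks with sizes `κ`, explained sums of
squares `T` and residual sum of squares `R`. -/
def blockIntegral {B : Type*} [Fintype B] (n : ℕ) (τ2 a b : ℝ) (κ T : B → ℝ) (R : ℝ) : ℝ≥0∞ :=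
  ∫⁻ g : B → ℝ, (∏ S, slab τ2 a b (κ S) (g S)) * ridge n (R + ∑ S, T S / (1 + g S))

theorem measurable_shrinkagePDF (τ2 a b : ℝ) : Measurable (shrinkagePDF τ2 a b) := by
  unfold shrinkagePDF
  exact Measurable.ite measurableSet_Ioi (by fun_prop) measurable_const

theorem measurable_slab (τ2 a b κ : ℝ) : Measurable (slab τ2 a b κ) := by
  have := measurable_shrinkagePDF τ2 a b
  unfold slab
  fun_prop

theorem slab_of_nonpos {τ2 a b κ g : ℝ} (hg : g ≤ 0) : slab τ2 a b κ g = 0 := by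
  simp [slab, shrinkagePDF, not_lt.2 hg]

theorem continuousOn_partitionProb {ι : Type*} [Fintype ι] [DecidableEq ι]
    (ρ : Finpartition (Finset.univ : Finset ι)) :
    ContinuousOn (fun α => partitionProb α ρ) (Set.Ioi 0) := by
  have hG : ∀ x : ℝ, 0 < x → ContinuousAt Real.Gamma x := fun x hx =>
    (Real.differentiableAt_Gamma fun m => by
      have : (0 : ℝ) ≤ m := m.cast_nonneg
      intro h; linarith).continuousAt
  intro α (hα : 0 < α)
  have h1 : 0 < α + Fintype.card ι := by positivity
  refine ContinuousAt.continuousWithinAt ?_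
  unfold partitionProb
  refine ((((hG α hα).div ?_ (Real.Gamma_pos_of_pos h1).ne').mul
    (continuousAt_id.pow _)).mul continuousAt_const)
  exact ContinuousAt.comp (f := fun x : ℝ => x + Fintype.card ι) (g := Real.Gamma)
    (hG _ h1) (by fun_prop)

/-- Continuity on the positive half line suffices: the law of α is a point mass or absolutely
continuous with respect to Lebesgue measure restricted there. -/
theorem aemeasurable_partitionProb {ι : Type*} [Fintype ι] [DecidableEq ι]
    (ρ : Finpartition (Finset.univ : Finset ι)) (c : ℕ) :
    AEMeasurable (fun α => ENNReal.ofReal (partitionProb α ρ)) (concentrationPrior c) := by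
  unfold concentrationPrior
  split_ifs
  · exact aemeasurable_dirac
  · refine AEMeasurable.smul_measure (AEMeasurable.mono_ac ?_
      (withDensity_absolutelyContinuous _ _)) _
    exact ((continuousOn_partitionProb ρ).aemeasurable measurableSet_Ioi).ennreal_ofReal

section
variable {n : ℕ} {ι : Type*} [Fintype ι] [DecidableEq ι] {X : Matrix (Fin n) ι ℝ}
  {τ2 a b : ℝ}

theorem blockOf_of_mem {ρ : Finpartition (Finset.univ : Finset ι)} (S : ρ.parts) {j : ι}
    (hj : j ∈ S.1) : blockOf ρ j = S :=
  Subtype.ext (ρ.part_eq_of_mem S.2 hj)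

theorem prod_eq_prod_blocks {M : Type*} [CommMonoid M]
    (ρ : Finpartition (Finset.univ : Finset ι)) (f : ι → M) :
    ∏ j, f j = ∏ S : ρ.parts, ∏ j ∈ S.1, f j := by
  rw [Finset.prod_coe_sort ρ.parts (fun S => ∏ j ∈ S, f j), ← Finset.prod_biUnion,
    ← Finset.prod_congr ρ.biUnion_parts fun _ _ => rfl]
  · rfl
  · exact ρ.supIndep.pairwiseDisjoint

theorem sum_eq_sum_blocks {M : Type*} [AddCommMonoid M]
    (ρ : Finpartition (Finset.univ : Finset ι)) (f : ι → M) :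
    ∑ j, f j = ∑ S : ρ.parts, ∑ j ∈ S.1, f j :=
  prod_eq_prod_blocks (M := Multiplicative M) ρ f

theorem IsOrthoDesign.dpBlockGPrior_eq (hX : IsOrthoDesign X)
    (hf : ∀ g, 0 ≤ shrinkagePDF τ2 a b g) {s : ℝ} (hs : 0 < s) (β : ι → ℝ) :
    dpBlockGPrior τ2 a b X s β = ∑ ρ : Finpartition (Finset.univ : Finset ι),
      partitionWeight ρ * ∫⁻ g : ρ.parts → ℝ,
        (∏ S, ENNReal.ofReal (shrinkagePDF τ2 a b (g S))) *
          ∏ j, ENNReal.ofReal ((2 * Real.pi * (s * g (blockOf ρ j) / colSq X j)) ^ (-(1 : ℝ) / 2) *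
            Real.exp (-(β j - 0) ^ 2 / (2 * (s * g (blockOf ρ j) / colSq X j)))) := by
  unfold dpBlockGPrior
  rw [lintegral_finsetSum' _ fun ρ _ => (aemeasurable_partitionProb ρ _).mul_const _]
  refine Finset.sum_congr rfl fun ρ _ => ?_
  rw [lintegral_mul_const'' _ (aemeasurable_partitionProb ρ _), partitionWeight]
  congr 1
  refine lintegral_congr fun g => ?_
  rw [ENNReal.ofReal_prod_of_nonneg fun S _ => hf _]
  by_cases hg : ∀ S, 0 < g S
  · congr 1
    rw [hX.priorCov_eq s fun j => (hg _).le, normalPDF_diagonal, ENNReal.ofReal_prod_of_nonneg]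
    · rfl
    · intro j _
      have := hX.colSq_pos j
      have := hg (blockOf ρ j)
      positivity
    · intro j
      have := hX.colSq_pos j
      have := hg (blockOf ρ j)
      positivity
  -- If some factor is not positive its density vanishes, so the value of `normalPDF` at a
  -- degenerate covariance plays no role.
  · push Not at hg
    obtain ⟨S, hS⟩ := hg
    have : ∏ S, ENNReal.ofReal (shrinkagePDF τ2 a b (g S)) = 0 :=
      Finset.prod_eq_zero (Finset.mem_univ S) (by simp [shrinkagePDF, not_lt.2 hS])
    rw [this, zero_mul, zero_mul]

theorem prod_ofReal_coef (X : Matrix (Fin n) ι ℝ) (y : Fin n → ℝ)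
    (ρ : Finpartition (Finset.univ : Finset ι)) {g : ρ.parts → ℝ} (hg : ∀ S, 0 < g S) (s : ℝ) :
    ∏ j, ENNReal.ofReal ((1 + g (blockOf ρ j)) ^ (-(1 : ℝ) / 2) *
        Real.exp (-(fitSq X y j / (1 + g (blockOf ρ j))) / (2 * s))) =
      (∏ S : ρ.parts, ENNReal.ofReal ((1 + g S) ^ (-(S.1.card : ℝ) / 2))) *
        ENNReal.ofReal (Real.exp (-(∑ S, (∑ j ∈ S.1, fitSq X y j) / (1 + g S)) / (2 * s))) := by
  have h1 : ∀ S : ρ.parts, 0 < 1 + g S := fun S => by have := hg S; linarith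
  rw [← ENNReal.ofReal_prod_of_nonneg fun j _ => by have := h1 (blockOf ρ j); positivity,
    ← ENNReal.ofReal_prod_of_nonneg fun S _ => by have := h1 S; positivity,
    ← ENNReal.ofReal_mul (Finset.prod_nonneg fun S _ => by have := h1 S; positivity),
    Finset.prod_mul_distrib, ← Real.exp_sum]
  congr 2
  · rw [prod_eq_prod_blocks ρ]
    refine Finset.prod_congr rfl fun S _ => ?_
    rw [Finset.prod_congr rfl fun j hj => by rw [blockOf_of_mem S hj], Finset.prod_const,
      ← Real.rpow_natCast, ← Real.rpow_mul (h1 S).le]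
    congr 1
    ring
  · rw [← Finset.sum_div, Finset.sum_neg_distrib, sum_eq_sum_blocks ρ]
    have h : ∑ S : ρ.parts, ∑ j ∈ S.1, fitSq X y j / (1 + g (blockOf ρ j)) =
        ∑ S : ρ.parts, (∑ j ∈ S.1, fitSq X y j) / (1 + g S) := by
      refine Finset.sum_congr rfl fun S _ => ?_
      rw [Finset.sum_div]
      exact Finset.sum_congr rfl fun j hj => by rw [blockOf_of_mem S hj]
    rw [h]

theorem IsOrthoDesign.lintegral_coef_mul_prior (hX : IsOrthoDesign X)
    (hf : ∀ g, 0 ≤ shrinkagePDF τ2 a b g) {s : ℝ} (hs : 0 < s) (y : Fin n → ℝ) :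
    ∫⁻ β : ι → ℝ, (∏ j, ENNReal.ofReal
        (Real.exp (-(colSq X j * (β j - lsCoef X y j) ^ 2) / (2 * s)))) *
          dpBlockGPrior τ2 a b X s β =
      ∑ ρ : Finpartition (Finset.univ : Finset ι),
        partitionWeight ρ * ∫⁻ g : ρ.parts → ℝ, (∏ S, slab τ2 a b (S.1.card) (g S)) *
          ENNReal.ofReal (Real.exp (-(∑ S, (∑ j ∈ S.1, fitSq X y j) / (1 + g S)) / (2 * s))) := by
  have hmf := measurable_shrinkagePDF τ2 a b
  simp_rw [hX.dpBlockGPrior_eq hf hs, Finset.mul_sum]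
  rw [lintegral_finsetSum']
  swap
  · intro ρ _
    refine (Measurable.mul (by fun_prop) (Measurable.const_mul ?_ _)).aemeasurable
    refine Measurable.lintegral_prod_right ?_
    simp only [Function.uncurry_def]
    fun_prop
  refine Finset.sum_congr rfl fun ρ _ => ?_
  simp_rw [mul_left_comm _ (partitionWeight ρ)]
  rw [lintegral_const_mul]
  swap
  · refine Measurable.mul (by fun_prop) ?_
    refine Measurable.lintegral_prod_right ?_
    simp only [Function.uncurry_def]
    fun_prop
  congr 1
  have e1 : ∀ β : ι → ℝ, (∏ j, ENNReal.ofReal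
        (Real.exp (-(colSq X j * (β j - lsCoef X y j) ^ 2) / (2 * s)))) *
        ∫⁻ g : ρ.parts → ℝ,
        (∏ S, ENNReal.ofReal (shrinkagePDF τ2 a b (g S))) *
          ∏ j, ENNReal.ofReal ((2 * Real.pi * (s * g (blockOf ρ j) / colSq X j)) ^ (-(1 : ℝ) / 2) *
            Real.exp (-(β j - 0) ^ 2 / (2 * (s * g (blockOf ρ j) / colSq X j)))) =
      ∫⁻ g : ρ.parts → ℝ, (∏ S, ENNReal.ofReal (shrinkagePDF τ2 a b (g S))) *
          ∏ j, (ENNReal.ofReal (Real.exp (-(colSq X j * (β j - lsCoef X y j) ^ 2) / (2 * s))) *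
            ENNReal.ofReal ((2 * Real.pi * (s * g (blockOf ρ j) / colSq X j)) ^ (-(1 : ℝ) / 2) *
            Real.exp (-(β j - 0) ^ 2 / (2 * (s * g (blockOf ρ j) / colSq X j))))) := by
    intro β
    rw [← lintegral_const_mul _ (by fun_prop)]
    refine lintegral_congr fun g => ?_
    rw [Finset.prod_mul_distrib, mul_left_comm]
  simp_rw [e1]
  rw [lintegral_lintegral_swap (by fun_prop)]
  refine lintegral_congr fun g => ?_
  rw [lintegral_const_mul _ (by fun_prop), lintegral_pi_prod (fun j t =>
    ENNReal.ofReal (Real.exp (-(colSq X j * (t - lsCoef X y j) ^ 2) / (2 * s))) *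
            ENNReal.ofReal ((2 * Real.pi * (s * g (blockOf ρ j) / colSq X j)) ^ (-(1 : ℝ) / 2) *
            Real.exp (-(t - 0) ^ 2 / (2 * (s * g (blockOf ρ j) / colSq X j)))))
    fun j => by fun_prop]
  simp only [slab, Finset.prod_mul_distrib, mul_assoc]
  by_cases hg : ∀ S, 0 < g S
  · congr 1
    rw [← prod_ofReal_coef X y ρ hg]
    exact Finset.prod_congr rfl fun j _ => by
      simpa only [mul_assoc, fitSq] using
        lintegral_coef (hX.colSq_pos j) hs (hg (blockOf ρ j)) (lsCoef X y j)
  · push Not at hg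
    obtain ⟨S, hS⟩ := hg
    have : ∏ S, ENNReal.ofReal (shrinkagePDF τ2 a b (g S)) = 0 :=
      Finset.prod_eq_zero (Finset.mem_univ S) (by simp [shrinkagePDF, not_lt.2 hS])
    rw [this, zero_mul, zero_mul]

/-- The likelihood splits into Gaussian factors in the intercept and in each coefficient. Tonelli
allows these to be integrated first, leaving the variance for `ridge`; no finiteness of the result
is needed. -/
theorem IsOrthoDesign.marginalLikelihood_eq (hX : IsOrthoDesign X)
    (hf : ∀ g, 0 ≤ shrinkagePDF τ2 a b g) (y : Fin n → ℝ) :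
    marginalLikelihood τ2 a b X y =
      ∑ ρ : Finpartition (Finset.univ : Finset ι), partitionWeight ρ *
        blockIntegral n τ2 a b (fun S : ρ.parts => (S.1.card : ℝ))
          (fun S => ∑ j ∈ S.1, fitSq X y j) (rss X y) := by
  have hmf := measurable_slab τ2 a b
  have hn : (0 : ℝ) < n := by have := hX.size_pos; positivity
  have key : ∀ s ∈ Set.Ioi (0 : ℝ), ∫⁻ β₀ : ℝ, ∫⁻ β : ι → ℝ,
      ENNReal.ofReal (normalPDF ((fun _ => β₀) + X *ᵥ β) (s • (1 : Matrix (Fin n) (Fin n) ℝ)) y) *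
        (ENNReal.ofReal (1 / s) * dpBlockGPrior τ2 a b X s β) =
      ∑ ρ : Finpartition (Finset.univ : Finset ι),
        partitionWeight ρ * ∫⁻ g : ρ.parts → ℝ, (∏ S, slab τ2 a b (S.1.card) (g S)) *
          (ENNReal.ofReal (1 / s * (2 * Real.pi * s) ^ (-(n : ℝ) / 2) *
            √(Real.pi / (n / (2 * s)))) * ENNReal.ofReal (Real.exp
            (-(rss X y + ∑ S, (∑ j ∈ S.1, fitSq X y j) / (1 + g S)) / (2 * s)))) := by
    intro s (hs : 0 < s)
    have e : ∀ β₀ β, ENNReal.ofReal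
        (normalPDF ((fun _ => β₀) + X *ᵥ β) (s • (1 : Matrix (Fin n) (Fin n) ℝ)) y) *
        (ENNReal.ofReal (1 / s) * dpBlockGPrior τ2 a b X s β) =
        ENNReal.ofReal (1 / s * (2 * Real.pi * s) ^ (-(n : ℝ) / 2) *
          Real.exp (-(rss X y) / (2 * s))) *
        ENNReal.ofReal (Real.exp (-(n / (2 * s)) * (β₀ - mean y) ^ 2)) *
        ((∏ j, ENNReal.ofReal
          (Real.exp (-(colSq X j * (β j - lsCoef X y j) ^ 2) / (2 * s)))) *
            dpBlockGPrior τ2 a b X s β) := by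
      intro β₀ β
      simp only [← mul_assoc]
      congr 1
      rw [normalPDF_smul_one hs, ← ENNReal.ofReal_prod_of_nonneg fun j _ => (Real.exp_pos _).le,
        ← ENNReal.ofReal_mul (by positivity), ← ENNReal.ofReal_mul (by positivity),
        ← ENNReal.ofReal_mul (by positivity)]
      congr 1
      have := hX.sum_sq_eq y β₀ β
      simp only [Pi.add_apply]
      rw [this, ← Real.exp_sum, mul_right_comm, mul_comm _ (1 / s), mul_assoc (1 / s * _),
        mul_assoc (1 / s * _), ← Real.exp_add, ← Real.exp_add]
      congr 2
      rw [← Finset.sum_div, Finset.sum_neg_distrib]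
      field_simp
      ring
    simp_rw [e]
    -- A finite constant can be pulled out without knowing that the prior density is measurable in
    -- β.
    have hm : ∀ C : ℝ≥0∞, C ≠ ∞ → ∀ F : (ι → ℝ) → ℝ≥0∞, ∫⁻ β, C * F β = C * ∫⁻ β, F β :=
      fun C hC F => lintegral_const_mul' C F hC
    simp_rw [hm _ (ENNReal.mul_ne_top ENNReal.ofReal_ne_top ENNReal.ofReal_ne_top),
      hX.lintegral_coef_mul_prior hf hs]
    rw [lintegral_mul_const _ (by fun_prop), lintegral_const_mul _ (by fun_prop),
      lintegral_exp_neg_mul_sq (by positivity), Finset.mul_sum]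
    refine Finset.sum_congr rfl fun ρ _ => ?_
    rw [mul_left_comm, ← lintegral_const_mul _ (by fun_prop)]
    congr 1
    refine lintegral_congr fun g => ?_
    rw [mul_left_comm, ← ENNReal.ofReal_mul (by positivity), ← ENNReal.ofReal_mul (by positivity),
      ← ENNReal.ofReal_mul (by positivity)]
    congr 2
    rw [mul_right_comm, mul_assoc _ (Real.exp _) (Real.exp _), ← Real.exp_add, mul_right_comm]
    congr 2
    ring
  unfold marginalLikelihood
  rw [setLIntegral_congr_fun measurableSet_Ioi key, lintegral_finsetSum']
  swap
  · intro ρ _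
    refine (Measurable.const_mul ?_ _).aemeasurable
    refine Measurable.lintegral_prod_right ?_
    simp only [Function.uncurry_def]
    fun_prop
  refine Finset.sum_congr rfl fun ρ _ => ?_
  rw [lintegral_const_mul]
  swap
  · refine Measurable.lintegral_prod_right ?_
    simp only [Function.uncurry_def]
    fun_prop
  congr 1
  rw [lintegral_lintegral_swap (by fun_prop)]
  refine lintegral_congr fun g => ?_
  rw [lintegral_const_mul _ (by fun_prop), ridge]

end

end BlockG
end

noncomputable section
namespace BlockG

/-! ### The integral over the error variance -/

theorem ridge_anti (n : ℕ) {Q Q' : ℝ} (h : Q ≤ Q') : ridge n Q' ≤ ridge n Q := by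
  refine setLIntegral_mono' measurableSet_Ioi fun s (hs : 0 < s) => ?_
  gcongr

theorem measurable_ridge (n : ℕ) : Measurable (ridge n) := by
  unfold ridge
  refine Measurable.lintegral_prod_right ?_
  simp only [Function.uncurry_def]
  fun_prop

/-- The substitution s ↦ 1/s turns this into Euler's integral for Γ. -/
theorem lintegral_rpow_mul_exp_neg_div {r : ℝ} (hr : 0 < r) {Q : ℝ} (hQ : 0 < Q) :
    ∫⁻ s in Set.Ioi (0 : ℝ), ENNReal.ofReal (s ^ (-r - 1) * Real.exp (-(Q / s))) =
      ENNReal.ofReal (Q ^ (-r) * Real.Gamma r) := by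
  have h1 := Real.integral_rpow_mul_exp_neg_mul_Ioi hr hQ
  have e : ∀ s ∈ Set.Ioi (0 : ℝ), (|(-1 : ℝ)| * s ^ ((-1 : ℝ) - 1)) •
      ((s ^ (-1 : ℝ)) ^ (r - 1) * Real.exp (-(Q * s ^ (-1 : ℝ)))) =
      s ^ (-r - 1) * Real.exp (-(Q / s)) := by
    intro s (hs : 0 < s)
    rw [smul_eq_mul, ← Real.rpow_mul hs.le, ← mul_assoc, abs_neg, abs_one, one_mul,
      ← Real.rpow_add hs, Real.rpow_neg_one, div_eq_mul_inv]
    congr 2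
    ring
  have h2 := integral_comp_rpow_Ioi (fun t : ℝ => t ^ (r - 1) * Real.exp (-(Q * t)))
    (p := -1) (by norm_num)
  rw [setIntegral_congr_fun measurableSet_Ioi e, h1, one_div, Real.inv_rpow hQ.le,
    ← Real.rpow_neg hQ.le] at h2
  rw [← h2, ofReal_integral_eq_lintegral_ofReal]
  -- Integrability comes for free: a nonintegrable function would have Bochner integral zero, but
  -- the computed value is positive.
  · by_contra hni
    rw [integral_undef hni] at h2
    have : 0 < Q ^ (-r) * Real.Gamma r := by
      have := Real.Gamma_pos_of_pos hr
      positivity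
    exact this.ne h2
  · refine (ae_restrict_iff' measurableSet_Ioi).2 (ae_of_all _ fun s (hs : 0 < s) => ?_)
    show (0 : ℝ) ≤ _
    positivity

/-- The powers of s are -1 from the reference prior, -n/2 from the likelihood and +1/2 from
integrating out the intercept; hence the exponent -(n-1)/2 after the Gamma integral. -/
theorem exists_ridge_eq {n : ℕ} (hn : 2 ≤ n) :
    ∃ C : ℝ, 0 < C ∧ ∀ Q, 0 < Q →
      ridge n Q = ENNReal.ofReal C * ENNReal.ofReal (Q ^ (-((n : ℝ) - 1) / 2)) := by
  have hn' : (2 : ℝ) ≤ n := by exact_mod_cast hn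
  have hr : 0 < ((n : ℝ) - 1) / 2 := by linarith
  have hG := Real.Gamma_pos_of_pos hr
  set A : ℝ := (2 * Real.pi) ^ (-(n : ℝ) / 2) * √(2 * Real.pi / n) with hA
  have hApos : 0 < A := by positivity
  refine ⟨A * ((2 : ℝ)⁻¹ ^ (-(((n : ℝ) - 1) / 2)) * Real.Gamma (((n : ℝ) - 1) / 2)),
    by positivity, fun Q hQ => ?_⟩
  have e : ∀ s ∈ Set.Ioi (0 : ℝ), ENNReal.ofReal (1 / s * (2 * Real.pi * s) ^ (-(n : ℝ) / 2) *
      √(Real.pi / (n / (2 * s)))) * ENNReal.ofReal (Real.exp (-Q / (2 * s))) =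
      ENNReal.ofReal A * ENNReal.ofReal (s ^ (-(((n : ℝ) - 1) / 2) - 1) *
        Real.exp (-((2⁻¹ * Q) / s))) := by
    intro s (hs : 0 < s)
    rw [← ENNReal.ofReal_mul (by positivity), ← ENNReal.ofReal_mul hApos.le]
    congr 1
    rw [← mul_assoc]
    congr 1
    · have h1 : Real.pi / (n / (2 * s)) = (2 * Real.pi / n) * s := by field_simp
      have h2 : s ^ (-(((n : ℝ) - 1) / 2) - 1) = s⁻¹ * s ^ (-(n : ℝ) / 2) * √s := by
        rw [Real.sqrt_eq_rpow, ← Real.rpow_neg_one, ← Real.rpow_add hs, ← Real.rpow_add hs]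
        congr 1
        ring
      rw [h1, h2, Real.sqrt_mul (by positivity), Real.mul_rpow (by positivity) hs.le, hA]
      ring
    · congr 1
      field_simp
  rw [ridge, setLIntegral_congr_fun measurableSet_Ioi e, lintegral_const_mul _ (by fun_prop),
    lintegral_rpow_mul_exp_neg_div hr (by positivity), ← ENNReal.ofReal_mul hApos.le,
    ← ENNReal.ofReal_mul (by positivity), Real.mul_rpow (by positivity) hQ.le]
  congr 1
  rw [neg_div]
  ring

/-! ### Weights of the partitions -/

section
variable {ι : Type*} [Fintype ι] [DecidableEq ι]

theorem partitionProb_pos {α : ℝ} (hα : 0 < α) (ρ : Finpartition (Finset.univ : Finset ι)) :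
    0 < partitionProb α ρ := by
  have h1 := Real.Gamma_pos_of_pos hα
  have h2 : 0 < Real.Gamma (α + Fintype.card ι) := Real.Gamma_pos_of_pos (by positivity)
  have h3 : 0 < ∏ S ∈ ρ.parts, Real.Gamma (S.card : ℝ) :=
    Finset.prod_pos fun S hS => Real.Gamma_pos_of_pos (by
      have := Finset.card_pos.2 (ρ.nonempty_of_mem_parts hS)
      exact_mod_cast this)
  unfold partitionProb
  positivity

/-- Γ(α+c)/Γ(α) is the rising factorial α(α+1)⋯(α+c-1): each factor is at least α, and all but the
first are at least 1. The first factor needs one power of α, hence 1 ≤ k. -/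
theorem Gamma_mul_pow_le {α : ℝ} (hα : 0 < α) {k c : ℕ} (hk : 1 ≤ k) (hkc : k ≤ c) :
    Real.Gamma α * α ^ k ≤ Real.Gamma (α + c) := by
  induction c generalizing k with
  | zero => omega
  | succ c ih =>
    have hpos : 0 < α + c := by positivity
    have hG : Real.Gamma (α + (c + 1 : ℕ)) = (α + c) * Real.Gamma (α + c) := by
      rw [← Real.Gamma_add_one hpos.ne']; push_cast; ring_nf
    rw [hG]
    rcases Nat.lt_or_ge 1 k with h | h
    · obtain ⟨m, rfl⟩ : ∃ m, k = m + 1 := ⟨k - 1, by omega⟩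
      have := ih (k := m) (by omega) (by omega)
      have h0 : 0 ≤ Real.Gamma α * α ^ m := by
        have := Real.Gamma_pos_of_pos hα
        positivity
      calc Real.Gamma α * α ^ (m + 1) = α * (Real.Gamma α * α ^ m) := by ring
        _ ≤ (α + c) * Real.Gamma (α + c) :=
          mul_le_mul (by simp) this h0 hpos.le
    · obtain rfl : k = 1 := by omega
      rcases Nat.eq_zero_or_pos c with rfl | hc
      · simp; linarith [mul_comm α (Real.Gamma α)]
      · have := ih (k := 1) le_rfl hc
        have hc1 : (1 : ℝ) ≤ c := by exact_mod_cast hc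
        have h0 := (Real.Gamma_pos_of_pos hpos).le
        nlinarith

theorem partitionProb_le [Nonempty ι] {α : ℝ} (hα : 0 < α)
    (ρ : Finpartition (Finset.univ : Finset ι)) :
    partitionProb α ρ ≤ ∏ S ∈ ρ.parts, Real.Gamma (S.card : ℝ) := by
  have h2 : 0 < Real.Gamma (α + Fintype.card ι) := Real.Gamma_pos_of_pos (by positivity)
  have h3 : 0 ≤ ∏ S ∈ ρ.parts, Real.Gamma (S.card : ℝ) :=
    Finset.prod_nonneg fun S _ => Real.Gamma_nonneg_of_nonneg (by positivity)
  have h4 : 1 ≤ ρ.parts.card :=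
    Finset.card_pos.2 (ρ.parts_nonempty (by simp [Finset.univ_nonempty.ne_empty]))
  have h5 : ρ.parts.card ≤ Fintype.card ι := ρ.card_parts_le_card
  have := Gamma_mul_pow_le hα h4 h5
  unfold partitionProb
  refine mul_le_of_le_one_left h3 ?_
  rw [div_mul_eq_mul_div, div_le_one h2]
  exact this

end

theorem lintegral_rpow_Ioc_lt_top {s : ℝ} (hs : -1 < s) :
    ∫⁻ x in Set.Ioc (0 : ℝ) 1, ENNReal.ofReal (x ^ s) < ∞ := by
  have h := (intervalIntegral.intervalIntegrable_rpow' (a := 0) (b := 1) hs)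
  rw [intervalIntegrable_iff_integrableOn_Ioc_of_le zero_le_one] at h
  exact h.lintegral_lt_top

theorem lintegral_rpow_Ioi_one_lt_top {s : ℝ} (hs : s < -1) :
    ∫⁻ x in Set.Ioi (1 : ℝ), ENNReal.ofReal (x ^ s) < ∞ :=
  (integrableOn_Ioi_rpow_of_lt hs zero_lt_one).lintegral_lt_top

/-- The first rate is integrable at 0 and the second at infinity, which makes the prior of α proper.
-/
theorem concentrationKernel_le (c : ℕ) {α : ℝ} (hα : 0 < α) :
    concentrationKernel c α ≤ c * α ^ (-(1 : ℝ) / 2) ∧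
      concentrationKernel c α ≤ c * α ^ (-(3 : ℝ) / 2) := by
  have hterm : ∀ j ∈ Finset.Icc 1 (c - 1), (j : ℝ) / (α + j) ^ 2 ≤ c ∧
      (j : ℝ) / (α + j) ^ 2 ≤ c * (1 / α ^ 2) := by
    intro j hj
    rw [Finset.mem_Icc] at hj
    have h1 : (1 : ℝ) ≤ j := by exact_mod_cast hj.1
    have h2 : (j : ℝ) ≤ c := by exact_mod_cast (by omega : j ≤ c)
    constructor
    · rw [div_le_iff₀ (by positivity)]
      nlinarith [mul_pos hα hα]
    · rw [mul_one_div]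
      gcongr
      linarith
  have hcard : ((Finset.Icc 1 (c - 1)).card : ℝ) ≤ c := by
    simp
  have hc : (0 : ℝ) ≤ c := by positivity
  have hs : √((c : ℝ) * c) = c := Real.sqrt_mul_self hc
  constructor
  · have h : ∑ j ∈ Finset.Icc 1 (c - 1), (j : ℝ) / (α + j) ^ 2 ≤ c * c :=
      (Finset.sum_le_card_nsmul _ _ _ fun j hj => (hterm j hj).1).trans
        (by rw [nsmul_eq_mul]; gcongr)
    have e : √(1 / α) = α ^ (-(1 : ℝ) / 2) := by
      rw [Real.sqrt_eq_rpow, one_div, Real.inv_rpow hα.le, ← Real.rpow_neg hα.le]; norm_num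
    calc concentrationKernel c α ≤ √(1 / α * (c * c)) := by
          unfold concentrationKernel; gcongr
      _ = c * α ^ (-(1 : ℝ) / 2) := by
          rw [Real.sqrt_mul (by positivity), hs, e, mul_comm]
  · have h : ∑ j ∈ Finset.Icc 1 (c - 1), (j : ℝ) / (α + j) ^ 2 ≤ c * (c * (1 / α ^ 2)) :=
      (Finset.sum_le_card_nsmul _ _ _ fun j hj => (hterm j hj).2).trans
        (by rw [nsmul_eq_mul]; gcongr)
    have e : √(1 / α ^ 3) = α ^ (-(3 : ℝ) / 2) := by
      rw [Real.sqrt_eq_rpow, one_div, Real.inv_rpow (by positivity), ← Real.rpow_natCast,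
        ← Real.rpow_mul hα.le, ← Real.rpow_neg hα.le]; norm_num
    calc concentrationKernel c α ≤ √(1 / α * (c * (c * (1 / α ^ 2)))) := by
          unfold concentrationKernel; gcongr
      _ = √(1 / α ^ 3 * (c * c)) := by congr 1; field_simp
      _ = c * α ^ (-(3 : ℝ) / 2) := by
          rw [Real.sqrt_mul (by positivity), hs, e, mul_comm]

theorem lintegral_concentrationKernel_lt_top (c : ℕ) :
    ∫⁻ α in Set.Ioi (0 : ℝ), ENNReal.ofReal (concentrationKernel c α) < ∞ := by
  rw [← Set.Ioc_union_Ioi_eq_Ioi (zero_le_one' ℝ)]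
  refine (lintegral_union_le _ _ _).trans_lt (ENNReal.add_lt_top.2 ⟨?_, ?_⟩)
  · calc _ ≤ ∫⁻ α in Set.Ioc (0 : ℝ) 1, ENNReal.ofReal c * ENNReal.ofReal (α ^ (-(1 : ℝ) / 2)) := by
          refine setLIntegral_mono' measurableSet_Ioc fun α hα => ?_
          rw [← ENNReal.ofReal_mul (by positivity)]
          exact ENNReal.ofReal_le_ofReal (concentrationKernel_le c hα.1).1
      _ < ∞ := by
          rw [lintegral_const_mul _ (by fun_prop)]
          exact ENNReal.mul_lt_top ENNReal.ofReal_lt_top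
            (lintegral_rpow_Ioc_lt_top (by norm_num))
  · calc _ ≤ ∫⁻ α in Set.Ioi (1 : ℝ), ENNReal.ofReal c * ENNReal.ofReal (α ^ (-(3 : ℝ) / 2)) := by
          refine setLIntegral_mono' measurableSet_Ioi fun α (hα : 1 < α) => ?_
          rw [← ENNReal.ofReal_mul (by positivity)]
          exact ENNReal.ofReal_le_ofReal (concentrationKernel_le c (by linarith)).2
      _ < ∞ := by
          rw [lintegral_const_mul _ (by fun_prop)]
          exact ENNReal.mul_lt_top ENNReal.ofReal_lt_top
            (lintegral_rpow_Ioi_one_lt_top (by norm_num))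

theorem concentrationKernel_pos {c : ℕ} (hc : 2 ≤ c) {α : ℝ} (hα : 0 < α) :
    0 < concentrationKernel c α := by
  refine Real.sqrt_pos.2 (mul_pos (by positivity) (Finset.sum_pos (fun j hj => ?_) ?_))
  · have : 0 < j := (Finset.mem_Icc.1 hj).1
    positivity
  · exact ⟨1, by simp; omega⟩

theorem measurable_concentrationKernel (c : ℕ) : Measurable (concentrationKernel c) := by
  unfold concentrationKernel
  fun_prop

theorem lintegral_pos_of_pos_on_Ioi {f : ℝ → ℝ≥0∞} (hf : AEMeasurable f (volume.restrict (Set.Ioi 0)))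
    (h : ∀ x, 0 < x → 0 < f x) : 0 < ∫⁻ x in Set.Ioi (0 : ℝ), f x := by
  rw [pos_iff_ne_zero, Ne, lintegral_eq_zero_iff' hf]
  intro h0
  have h1 : ∀ᵐ x ∂(volume.restrict (Set.Ioi (0 : ℝ))), False := by
    filter_upwards [h0, ae_restrict_mem measurableSet_Ioi] with x hx hx'
    exact (h x hx').ne' hx
  rw [Filter.eventually_false_iff_eq_bot, ae_eq_bot, Measure.restrict_eq_zero] at h1
  simp at h1

section
variable {ι : Type*} [Fintype ι] [DecidableEq ι]

theorem partitionWeight_pos (ρ : Finpartition (Finset.univ : Finset ι)) :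
    0 < partitionWeight ρ := by
  have hm := measurable_concentrationKernel (Fintype.card ι)
  unfold partitionWeight concentrationPrior
  split_ifs with h
  · rw [lintegral_dirac]
    simpa using partitionProb_pos one_pos ρ
  · rw [lintegral_smul_measure, smul_eq_mul]
    refine ENNReal.mul_pos (ENNReal.inv_ne_zero.2
      (lintegral_concentrationKernel_lt_top _).ne) (ne_of_gt ?_)
    have hp := ((continuousOn_partitionProb ρ).aemeasurable
      (μ := volume) measurableSet_Ioi).ennreal_ofReal
    rw [lintegral_withDensity_eq_lintegral_mul₀ (by fun_prop) hp]
    refine lintegral_pos_of_pos_on_Ioi (AEMeasurable.mul (by fun_prop) hp) fun x hx => ?_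
    have h1 := concentrationKernel_pos (c := Fintype.card ι) (by omega) hx
    have h2 := partitionProb_pos hx ρ
    exact ENNReal.mul_pos (by simpa using h1) (by simpa using h2)

theorem partitionWeight_lt_top [Nonempty ι] (ρ : Finpartition (Finset.univ : Finset ι)) :
    partitionWeight ρ < ∞ := by
  have hm := measurable_concentrationKernel (Fintype.card ι)
  unfold partitionWeight concentrationPrior
  split_ifs with h
  · rw [lintegral_dirac]
    exact ENNReal.ofReal_lt_top
  · rw [lintegral_smul_measure, smul_eq_mul]
    have hK : 0 < ∫⁻ α in Set.Ioi (0 : ℝ),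
        ENNReal.ofReal (concentrationKernel (Fintype.card ι) α) :=
      lintegral_pos_of_pos_on_Ioi (by fun_prop) fun x hx => by
        simpa using concentrationKernel_pos (by omega) hx
    refine ENNReal.mul_lt_top (ENNReal.inv_lt_top.2 hK) ?_
    have hp := ((continuousOn_partitionProb ρ).aemeasurable
      (μ := volume) measurableSet_Ioi).ennreal_ofReal
    rw [lintegral_withDensity_eq_lintegral_mul₀ (by fun_prop) hp]
    calc _ ≤ ∫⁻ α in Set.Ioi (0 : ℝ), ENNReal.ofReal (concentrationKernel (Fintype.card ι) α) *
          ENNReal.ofReal (∏ S ∈ ρ.parts, Real.Gamma (S.card : ℝ)) := by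
          refine setLIntegral_mono' measurableSet_Ioi fun α (hα : 0 < α) => ?_
          exact mul_le_mul_right (ENNReal.ofReal_le_ofReal (partitionProb_le hα ρ)) _
      _ < ∞ := by
          rw [lintegral_mul_const _ (by fun_prop)]
          exact ENNReal.mul_lt_top (lintegral_concentrationKernel_lt_top _) ENNReal.ofReal_lt_top

end

end BlockG
end

noncomputable section
namespace BlockG

/-! ### Tail behaviour of the prior of the shrinkage factors -/

/-- The ratio of the prior density of `1 + g` to its Pareto tail, at `u = 1 + g`. -/
def tailRatio (τ a u : ℝ) : ℝ :=
  if 1 < u then (a + 1) / τ * (u / (1 + (u - 1) / τ)) ^ (a + 2) else 0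

/-- The limit at infinity of `tailRatio`. -/
def tailConst (τ a : ℝ) : ℝ := (a + 1) / τ * τ ^ (a + 2)

theorem measurable_tailRatio (τ a : ℝ) : Measurable (tailRatio τ a) := by
  unfold tailRatio
  exact Measurable.ite measurableSet_Ioi (by fun_prop) measurable_const

section
variable {τ a : ℝ}

theorem shrinkagePDF_zero_right (ha : -1 < a) {g : ℝ} (hg : 0 < g) :
    shrinkagePDF τ a 0 g = (a + 1) / τ * (1 + g / τ) ^ (-(a + 2)) := by
  have h1 : Real.Gamma (a + 0 + 2) = (a + 1) * Real.Gamma (a + 1) := by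
    rw [← Real.Gamma_add_one (by linarith)]; ring_nf
  have h2 : Real.Gamma (a + 1) ≠ 0 := (Real.Gamma_pos_of_pos (by linarith)).ne'
  rw [shrinkagePDF, if_pos hg, h1]
  have h3 : -a - 0 - 2 = -(a + 2) := by ring
  rw [h3]
  simp only [zero_add, Real.Gamma_one, Real.rpow_zero, mul_one]
  congr 1
  field_simp

theorem shrinkagePDF_nonneg (hτ : 1 ≤ τ) (ha : -1 < a) (g : ℝ) : 0 ≤ shrinkagePDF τ a 0 g := by
  rcases le_or_gt g 0 with h | h
  · simp [shrinkagePDF, not_lt.2 h]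
  · rw [shrinkagePDF_zero_right ha h]
    have : 0 < a + 1 := by linarith
    positivity

theorem slab_pos (hτ : 1 ≤ τ) (ha : -1 < a) (κ : ℝ) {g : ℝ} (hg : 0 < g) :
    0 < slab τ a 0 κ g := by
  have : 0 < a + 1 := by linarith
  refine ENNReal.mul_pos ?_ ?_
  · rw [shrinkagePDF_zero_right ha hg]
    simp only [ne_eq, ENNReal.ofReal_eq_zero, not_le]
    positivity
  · simp only [ne_eq, ENNReal.ofReal_eq_zero, not_le]
    positivity

theorem tailConst_pos (hτ : 1 ≤ τ) (ha : -1 < a) : 0 < tailConst τ a := by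
  have : 0 < a + 1 := by linarith
  unfold tailConst
  positivity

theorem tailRatio_nonneg (hτ : 1 ≤ τ) (ha : -1 < a) (u : ℝ) : 0 ≤ tailRatio τ a u := by
  have : 0 < a + 1 := by linarith
  unfold tailRatio
  split_ifs with h
  · have : 0 < u - 1 := by linarith
    positivity
  · exact le_rfl

theorem tailRatio_le (hτ : 1 ≤ τ) (ha : -1 < a) (u : ℝ) : tailRatio τ a u ≤ tailConst τ a := by
  have h1 : 0 < a + 1 := by linarith
  unfold tailRatio
  split_ifs with h
  · have h2 : 0 < u - 1 := by linarith
    have h3 : 0 < 1 + (u - 1) / τ := by positivity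
    unfold tailConst
    have h4 : u / (1 + (u - 1) / τ) ≤ τ := by
      rw [div_le_iff₀ h3]
      field_simp
      linarith
    gcongr
    linarith
  · exact (tailConst_pos hτ ha).le

theorem tendsto_tailRatio (hτ : 1 ≤ τ) :
    Tendsto (tailRatio τ a) atTop (𝓝 (tailConst τ a)) := by
  have hτ0 : 0 < τ := by linarith
  have h1 : Tendsto (fun u : ℝ => ((1 - 1 / τ) / u + 1 / τ)⁻¹) atTop (𝓝 (0 + 1 / τ)⁻¹) := by
    refine Tendsto.inv₀ ?_ (by positivity)
    exact (tendsto_const_nhds.div_atTop tendsto_id).add_const _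
  have h2 : Tendsto (fun u : ℝ => (a + 1) / τ * (u / (1 + (u - 1) / τ)) ^ (a + 2)) atTop
      (𝓝 (tailConst τ a)) := by
    unfold tailConst
    refine Tendsto.const_mul _ ?_
    have h3 : (0 + 1 / τ)⁻¹ = τ := by simp
    rw [h3] at h1
    refine (h1.rpow_const (p := a + 2) (Or.inl hτ0.ne')).congr' ?_
    filter_upwards [eventually_gt_atTop 1] with u hu
    congr 1
    rw [inv_eq_iff_eq_inv, inv_div]
    field_simp
    ring
  refine h2.congr' ?_
  filter_upwards [eventually_gt_atTop 1] with u hu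
  rw [tailRatio, if_pos hu]

theorem slab_eq_tailRatio (hτ : 1 ≤ τ) (ha : -1 < a) (κ : ℝ) {u : ℝ} (hu : 0 < u) :
    slab τ a 0 κ (u - 1) =
      ENNReal.ofReal (tailRatio τ a u * u ^ (-(a + 1 + κ / 2) - 1)) := by
  have h1 : 0 < a + 1 := by linarith
  rcases le_or_gt u 1 with h | h
  · rw [slab_of_nonpos (by linarith), tailRatio, if_neg (not_lt.2 h)]
    simp
  · have h2 : 0 < u - 1 := by linarith
    have h3 : 0 < 1 + (u - 1) / τ := by positivity
    rw [slab, shrinkagePDF_zero_right ha h2, ← ENNReal.ofReal_mul (by positivity), tailRatio,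
      if_pos h]
    congr 1
    rw [Real.div_rpow hu.le h3.le, Real.rpow_neg h3.le, add_sub_cancel]
    have e : -(a + 1 + κ / 2) - 1 = -(a + 2) + -κ / 2 := by ring
    rw [e, Real.rpow_add hu (-(a + 2)), Real.rpow_neg hu.le]
    have := (Real.rpow_pos_of_pos hu (a + 2)).ne'
    field_simp

theorem lintegral_slab_mul (hτ : 1 ≤ τ) (ha : -1 < a) (κ : ℝ) (F : ℝ → ℝ≥0∞) :
    ∫⁻ g, slab τ a 0 κ g * F (1 + g) =
      ∫⁻ u in Set.Ioi (0 : ℝ),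
        ENNReal.ofReal (tailRatio τ a u * u ^ (-(a + 1 + κ / 2) - 1)) * F u := by
  rw [← lintegral_sub_right_eq_self _ (1 : ℝ)]
  rw [← lintegral_indicator measurableSet_Ioi]
  refine lintegral_congr fun u => ?_
  rw [add_sub_cancel]
  by_cases hu : 0 < u
  · rw [Set.indicator_of_mem (by exact hu), slab_eq_tailRatio hτ ha κ hu]
  · rw [Set.indicator_of_notMem (by exact hu), slab_of_nonpos (by linarith [not_lt.1 hu]), zero_mul]

/-- In u = 1+g the integrand is supported on u > 1 and bounded there by a constant times u^(θ-q-1),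
q = a+1+κ/2. Thus q is the block's capacity: it can absorb any power of 1+g below it. -/
theorem lintegral_slab_mul_rpow_lt_top (hτ : 1 ≤ τ) (ha : -1 < a) {κ θ : ℝ}
    (h : θ < a + 1 + κ / 2) :
    ∫⁻ g, slab τ a 0 κ g * ENNReal.ofReal ((1 + g) ^ θ) < ∞ := by
  rw [lintegral_slab_mul hτ ha κ fun u => ENNReal.ofReal (u ^ θ)]
  have hA := tailConst_pos hτ ha
  calc _ ≤ ∫⁻ u in Set.Ioi (0 : ℝ), (Set.Ioi (1 : ℝ)).indicator (fun u =>
          ENNReal.ofReal (tailConst τ a) *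
            ENNReal.ofReal (u ^ (θ - (a + 1 + κ / 2) - 1))) u := by
        refine setLIntegral_mono' measurableSet_Ioi fun u (hu : 0 < u) => ?_
        by_cases h1 : 1 < u
        · rw [Set.indicator_of_mem (by exact h1), ← ENNReal.ofReal_mul hA.le,
            ← ENNReal.ofReal_mul
              (mul_nonneg (tailRatio_nonneg hτ ha u) (Real.rpow_nonneg hu.le _)),
            mul_assoc, ← Real.rpow_add hu]
          refine ENNReal.ofReal_le_ofReal ?_
          rw [show -(a + 1 + κ / 2) - 1 + θ = θ - (a + 1 + κ / 2) - 1 by ring]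
          exact mul_le_mul_of_nonneg_right (tailRatio_le hτ ha u) (Real.rpow_nonneg hu.le _)
        · rw [Set.indicator_of_notMem (by exact h1), tailRatio, if_neg h1]
          simp
    _ ≤ ∫⁻ u in Set.Ioi (1 : ℝ), ENNReal.ofReal (tailConst τ a) *
            ENNReal.ofReal (u ^ (θ - (a + 1 + κ / 2) - 1)) := by
        exact (setLIntegral_le_lintegral _ _).trans_eq (lintegral_indicator measurableSet_Ioi _)
    _ < ∞ := by
        rw [lintegral_const_mul _ (by fun_prop)]
        exact ENNReal.mul_lt_top ENNReal.ofReal_lt_top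
          (lintegral_rpow_Ioi_one_lt_top (by linarith))

theorem lintegral_slab_lt_top (hτ : 1 ≤ τ) (ha : -1 < a) {κ : ℝ} (hκ : 0 ≤ κ) :
    ∫⁻ g, slab τ a 0 κ g < ∞ := by
  have := lintegral_slab_mul_rpow_lt_top hτ ha (κ := κ) (θ := 0) (by linarith)
  simpa using this

end

/-! ### Integrals of powers -/

/-- The integral over the shrinkage factors of a power of the shrunken residual sum of
squares. -/
def powerIntegral {B : Type*} [Fintype B] (τ a : ℝ) (κ T : B → ℝ) (R r : ℝ) : ℝ≥0∞ :=
  ∫⁻ g : B → ℝ, (∏ S, slab τ a 0 (κ S) (g S)) *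
    ENNReal.ofReal ((R + ∑ S, T S / (1 + g S)) ^ (-r))

/-- The total dominates each summand, so each share of the negative exponent may be charged to its
own summand. A summand equal to zero must get the share 0, where 0^0 = 1 keeps the bound true. -/
theorem rpow_neg_add_sum_le {B : Type*} [Fintype B] {R : ℝ} (hR : 0 ≤ R) {x : B → ℝ}
    (hx : ∀ S, 0 ≤ x S) {θ₀ : ℝ} (hθ₀ : 0 ≤ θ₀) {θ : B → ℝ} (hθ : ∀ S, 0 ≤ θ S)
    (hR0 : R = 0 → θ₀ = 0) (hx0 : ∀ S, x S = 0 → θ S = 0) :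
    (R + ∑ S, x S) ^ (-(θ₀ + ∑ S, θ S)) ≤ R ^ (-θ₀) * ∏ S, x S ^ (-θ S) := by
  have hsum : 0 ≤ ∑ S, x S := Finset.sum_nonneg fun S _ => hx S
  rcases (add_nonneg hR hsum).eq_or_lt with h0 | h0
  · have h1 : R = 0 := by linarith
    have h2 : ∑ S, x S = 0 := by linarith
    rw [Finset.sum_eq_zero_iff_of_nonneg fun S _ => hx S] at h2
    have h3 : ∀ S, θ S = 0 := fun S => hx0 S (h2 S (Finset.mem_univ S))
    simp [h3, hR0 h1]
  · have aux : ∀ {z t : ℝ}, 0 ≤ z → 0 ≤ t → (z = 0 → t = 0) → z ≤ R + ∑ S, x S →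
        (R + ∑ S, x S) ^ (-t) ≤ z ^ (-t) := by
      intro z t hz ht hz0 hle
      rcases hz.eq_or_lt with h | h
      · rw [hz0 h.symm]; simp
      · exact Real.rpow_le_rpow_of_nonpos h hle (by linarith)
    rw [neg_add, Real.rpow_add h0, ← Finset.sum_neg_distrib, Real.rpow_sum_of_pos h0]
    refine mul_le_mul (aux hR hθ₀ hR0 (by linarith)) ?_ (by positivity) (by positivity)
    refine Finset.prod_le_prod (fun S _ => by positivity) fun S _ => ?_
    refine aux (hx S) (hθ S) (hx0 S) ?_
    have := Finset.single_le_sum (fun S _ => hx S) (Finset.mem_univ S)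
    linarith

/-- Distributing the exponent decouples the blocks: the bound factorizes into one-dimensional
integrals and displays the decay T_S^(-θ_S). The freedom in choosing θ is exploited throughout. -/
theorem powerIntegral_le {B : Type*} [Fintype B] (τ a : ℝ) (κ : B → ℝ) {T : B → ℝ} {R : ℝ}
    (hR : 0 ≤ R) (hT : ∀ S, 0 ≤ T S) {θ₀ : ℝ} (hθ₀ : 0 ≤ θ₀) {θ : B → ℝ} (hθ : ∀ S, 0 ≤ θ S)
    (hR0 : R = 0 → θ₀ = 0) (hT0 : ∀ S, T S = 0 → θ S = 0) :
    powerIntegral τ a κ T R (θ₀ + ∑ S, θ S) ≤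
      ENNReal.ofReal (R ^ (-θ₀)) * ∏ S, (ENNReal.ofReal (T S ^ (-θ S)) *
        ∫⁻ g, slab τ a 0 (κ S) g * ENNReal.ofReal ((1 + g) ^ θ S)) := by
  have hm : ∀ κ, Measurable (slab τ a 0 κ) := measurable_slab τ a 0
  have e : ∏ S, (ENNReal.ofReal (T S ^ (-θ S)) *
        ∫⁻ g, slab τ a 0 (κ S) g * ENNReal.ofReal ((1 + g) ^ θ S)) =
      ∫⁻ g : B → ℝ, ∏ S, (ENNReal.ofReal (T S ^ (-θ S)) *
        (slab τ a 0 (κ S) (g S) * ENNReal.ofReal ((1 + g S) ^ θ S))) := by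
    rw [lintegral_pi_prod (fun S t => ENNReal.ofReal (T S ^ (-θ S)) *
        (slab τ a 0 (κ S) t * ENNReal.ofReal ((1 + t) ^ θ S))) fun S => by fun_prop]
    exact Finset.prod_congr rfl fun S _ => (lintegral_const_mul _ (by fun_prop)).symm
  rw [e, ← lintegral_const_mul _ (by fun_prop), powerIntegral]
  refine lintegral_mono fun g => ?_
  by_cases hg : ∀ S, 0 < g S
  · have hg1 : ∀ S, 0 < 1 + g S := fun S => by linarith [hg S]
    have hbound := rpow_neg_add_sum_le hR (x := fun S => T S / (1 + g S))
      (fun S => div_nonneg (hT S) (hg1 S).le) hθ₀ hθ hR0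
      (fun S h => hT0 S (by simpa [(hg1 S).ne'] using h))
    have e2 : ∏ S, (T S / (1 + g S)) ^ (-θ S) =
        (∏ S, T S ^ (-θ S)) * ∏ S, (1 + g S) ^ θ S := by
      rw [← Finset.prod_mul_distrib]
      refine Finset.prod_congr rfl fun S _ => ?_
      rw [Real.div_rpow (hT S) (hg1 S).le, Real.rpow_neg (hg1 S).le, div_inv_eq_mul]
    rw [e2] at hbound
    simp only [Finset.prod_mul_distrib]
    rw [← ENNReal.ofReal_prod_of_nonneg fun S _ => Real.rpow_nonneg (hT S) _,
      ← ENNReal.ofReal_prod_of_nonneg fun S _ => Real.rpow_nonneg (hg1 S).le _]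
    calc _ ≤ (∏ S, slab τ a 0 (κ S) (g S)) * ENNReal.ofReal (R ^ (-θ₀) *
          ((∏ S, T S ^ (-θ S)) * ∏ S, (1 + g S) ^ θ S)) := by gcongr
      _ = _ := by
        rw [ENNReal.ofReal_mul (by positivity), ENNReal.ofReal_mul
          (Finset.prod_nonneg fun S _ => Real.rpow_nonneg (hT S) _)]
        ring
  · push Not at hg
    obtain ⟨S, hS⟩ := hg
    rw [Finset.prod_eq_zero (Finset.mem_univ S) (slab_of_nonpos hS), zero_mul]
    exact zero_le

end BlockG
end

noncomputable section
namespace BlockG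

/-! ### A single block with a diverging explained sum of squares -/

/-- The integral over one shrinkage factor of a power of the shrunken sum of squares. -/
def slabIntegral (τ a κ r T b : ℝ) : ℝ≥0∞ :=
  ∫⁻ g, slab τ a 0 κ g * ENNReal.ofReal ((b + T / (1 + g)) ^ (-r))

theorem lintegral_Ioi_eq_mul {T : ℝ} (hT : 0 < T) (F : ℝ → ℝ≥0∞) :
    ∫⁻ u in Set.Ioi (0 : ℝ), F u = ∫⁻ s in Set.Ioi (0 : ℝ), ENNReal.ofReal T * F (T * s) := by
  have h := lintegral_image_eq_lintegral_abs_deriv_mul (s := Set.Ioi (0 : ℝ))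
    (f := fun s => T * s) (f' := fun _ => T) measurableSet_Ioi
    (fun x _ => by simpa using ((hasDerivAt_id x).const_mul T).hasDerivWithinAt)
    (fun x _ y _ hxy => mul_left_cancel₀ hT.ne' hxy) F
  have himg : (fun s => T * s) '' Set.Ioi (0 : ℝ) = Set.Ioi 0 := by
    ext u
    constructor
    · rintro ⟨s, hs, rfl⟩
      exact mul_pos hT hs
    · intro hu
      exact ⟨u / T, div_pos hu hT, by field_simp⟩
  rw [himg, abs_of_pos hT] at h
  exact h

theorem lintegral_Ioi_eq_exp {L : ℝ} (hL : 0 < L) (F : ℝ → ℝ≥0∞) :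
    ∫⁻ u in Set.Ioi (0 : ℝ), F u =
      ∫⁻ x : ℝ, ENNReal.ofReal (L * Real.exp (L * x)) * F (Real.exp (L * x)) := by
  have h := lintegral_image_eq_lintegral_abs_deriv_mul (s := Set.univ)
    (f := fun x => Real.exp (L * x)) (f' := fun x => L * Real.exp (L * x)) MeasurableSet.univ
    (fun x _ => by
      have := (((hasDerivAt_id x).const_mul L).exp).hasDerivWithinAt (s := Set.univ)
      simpa [mul_comm] using this)
    (fun x _ y _ hxy => mul_left_cancel₀ hL.ne' (Real.exp_injective hxy)) F
  have himg : (fun x => Real.exp (L * x)) '' Set.univ = Set.Ioi 0 := by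
    ext u
    constructor
    · rintro ⟨s, -, rfl⟩
      exact Real.exp_pos _
    · intro (hu : 0 < u)
      exact ⟨Real.log u / L, trivial, by simp only; rw [mul_div_cancel₀ _ hL.ne', Real.exp_log hu]⟩
  rw [himg, setLIntegral_univ] at h
  rw [h]
  refine lintegral_congr fun x => ?_
  rw [abs_of_pos (by positivity)]

section
variable {τ a κ r : ℝ}

/-- Substitution u = 1+g = Ts: the relevant shrinkage factors are of size T, and T survives only
inside the bounded `tailRatio`. -/
theorem slabIntegral_eq_scaled (hτ : 1 ≤ τ) (ha : -1 < a) {T : ℝ} (hT : 0 < T) (b : ℝ) :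
    ENNReal.ofReal (T ^ (a + 1 + κ / 2)) * slabIntegral τ a κ r T b =
      ∫⁻ s in Set.Ioi (0 : ℝ), ENNReal.ofReal
        (tailRatio τ a (T * s) * (s ^ (-(a + 1 + κ / 2) - 1) * (b + 1 / s) ^ (-r))) := by
  have hm := measurable_tailRatio τ a
  rw [slabIntegral, lintegral_slab_mul hτ ha κ fun u => ENNReal.ofReal ((b + T / u) ^ (-r)),
    lintegral_Ioi_eq_mul hT, ← lintegral_const_mul _ (by fun_prop)]
  refine setLIntegral_congr_fun measurableSet_Ioi fun s (hs : 0 < s) => ?_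
  have h0 := tailRatio_nonneg hτ ha (T * s)
  rw [← ENNReal.ofReal_mul (by positivity), ← ENNReal.ofReal_mul (by positivity),
    ← ENNReal.ofReal_mul (by positivity)]
  congr 1
  have h1 : T / (T * s) = 1 / s := by field_simp
  have h2 : T ^ (a + 1 + κ / 2) * T * T ^ (-(a + 1 + κ / 2) - 1) = 1 := by
    rw [← Real.rpow_add_one hT.ne', ← Real.rpow_add hT]
    ring_nf
    simp
  rw [h1, Real.mul_rpow hT.le hs.le]
  calc _ = (T ^ (a + 1 + κ / 2) * T * T ^ (-(a + 1 + κ / 2) - 1)) *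
        (tailRatio τ a (T * s) * (s ^ (-(a + 1 + κ / 2) - 1) * (b + 1 / s) ^ (-r))) := by ring
    _ = _ := by rw [h2, one_mul]

/-- Substitution u = T^x. At the critical exponent all logarithmic scales 0 < x < 1 contribute
equally, which produces the factor log T. -/
theorem slabIntegral_eq_log_scaled (hτ : 1 ≤ τ) (ha : -1 < a) (hr : a + 1 + κ / 2 = r)
    {T b : ℝ} (hT : 1 < T) (hb : 0 < b) :
    ENNReal.ofReal (T ^ r / Real.log T) * slabIntegral τ a κ r T b =
      ∫⁻ x : ℝ, ENNReal.ofReal (tailRatio τ a (Real.exp (Real.log T * x)) *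
        (1 + b * Real.exp (Real.log T * (x - 1))) ^ (-r)) := by
  have hm := measurable_tailRatio τ a
  have hL : 0 < Real.log T := Real.log_pos hT
  have hT0 : 0 < T := by linarith
  rw [slabIntegral, lintegral_slab_mul hτ ha κ fun u => ENNReal.ofReal ((b + T / u) ^ (-r)),
    lintegral_Ioi_eq_exp hL, ← lintegral_const_mul _ (by fun_prop), hr]
  refine lintegral_congr fun x => ?_
  have h0 := tailRatio_nonneg hτ ha (Real.exp (Real.log T * x))
  have hE : Real.exp (Real.log T * (x - 1)) = Real.exp (Real.log T * x) / T := by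
    rw [mul_sub, mul_one, Real.exp_sub, Real.exp_log hT0]
  rw [hE]
  have hu := Real.exp_pos (Real.log T * x)
  generalize Real.exp (Real.log T * x) = u at *
  rw [← ENNReal.ofReal_mul (by positivity), ← ENNReal.ofReal_mul (by positivity),
    ← ENNReal.ofReal_mul (by positivity)]
  congr 1
  have h1 : 1 + b * (u / T) = u * (b + T / u) * T⁻¹ := by field_simp; ring
  have h2 : u * u ^ (-r - 1) = u ^ (-r) := by
    rw [Real.rpow_sub_one hu.ne']; field_simp
  rw [h1, Real.mul_rpow (by positivity) (by positivity), Real.mul_rpow hu.le (by positivity),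
    Real.inv_rpow hT0.le, Real.rpow_neg hT0.le, inv_inv, ← h2]
  field_simp

/-- For s ≤ 1 the summand b is dropped. For s > 1 the exponent r is shared, η going to b and r-η to
1/s. The right side is finite when q < r and r-q < η, so b may enter with an exponent smaller than
r; this matters because b can be arbitrarily close to zero when R = 0. -/
theorem lintegral_scaled_le (hr : 0 ≤ r) {q η : ℝ} (hη : η ≤ r) (hη0 : 0 ≤ η) {b : ℝ} (hb : 0 < b) :
    ∫⁻ s in Set.Ioi (0 : ℝ), ENNReal.ofReal (s ^ (-q - 1) * (b + 1 / s) ^ (-r)) ≤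
      ((∫⁻ s in Set.Ioc (0 : ℝ) 1, ENNReal.ofReal (s ^ (r - q - 1))) +
        ∫⁻ s in Set.Ioi (1 : ℝ), ENNReal.ofReal (s ^ (r - η - q - 1))) *
        (1 + ENNReal.ofReal (b ^ (-η))) := by
  rw [← Set.Ioc_union_Ioi_eq_Ioi (zero_le_one' ℝ)]
  refine (lintegral_union_le _ _ _).trans ?_
  rw [add_mul]
  refine add_le_add ?_ ?_
  · refine le_trans ?_ (le_mul_of_one_le_right zero_le (le_add_of_nonneg_right zero_le))
    refine setLIntegral_mono' measurableSet_Ioc fun s hs => ENNReal.ofReal_le_ofReal ?_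
    have h0 : 0 < s := hs.1
    calc s ^ (-q - 1) * (b + 1 / s) ^ (-r) ≤ s ^ (-q - 1) * (1 / s) ^ (-r) := by
          refine mul_le_mul_of_nonneg_left ?_ (by positivity)
          exact Real.rpow_le_rpow_of_nonpos (by positivity) (by linarith) (by linarith)
      _ = s ^ (r - q - 1) := by
          rw [one_div, Real.inv_rpow h0.le, Real.rpow_neg h0.le, inv_inv, ← Real.rpow_add h0]
          congr 1
          ring
  · refine le_trans ?_ (mul_le_mul_right (le_add_of_nonneg_left zero_le) _)
    rw [← lintegral_mul_const _ (by fun_prop)]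
    refine setLIntegral_mono' measurableSet_Ioi fun s (hs : 1 < s) => ?_
    have h0 : 0 < s := by linarith
    rw [← ENNReal.ofReal_mul (by positivity)]
    refine ENNReal.ofReal_le_ofReal ?_
    have h1 : 0 < 1 / s := by positivity
    calc s ^ (-q - 1) * (b + 1 / s) ^ (-r) =
          s ^ (-q - 1) * ((b + 1 / s) ^ (-(r - η)) * (b + 1 / s) ^ (-η)) := by
          rw [← Real.rpow_add (by positivity)]
          congr 2
          ring
      _ ≤ s ^ (-q - 1) * ((1 / s) ^ (-(r - η)) * b ^ (-η)) := by
          gcongr s ^ (-q - 1) * (?_ * ?_)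
          · exact Real.rpow_le_rpow_of_nonpos h1 (by linarith) (by linarith)
          · exact Real.rpow_le_rpow_of_nonpos hb (by linarith) (by linarith)
      _ = s ^ (r - η - q - 1) * b ^ (-η) := by
          rw [one_div, Real.inv_rpow h0.le, Real.rpow_neg h0.le, inv_inv, ← mul_assoc,
            ← Real.rpow_add h0]
          congr 2
          ring

theorem one_add_rpow_neg_le {z η : ℝ} (hz : 0 < z) (hη : η ≤ r) (hη0 : 0 ≤ η) :
    (1 + z) ^ (-r) ≤ z ^ (-η) :=
  (Real.rpow_le_rpow_of_exponent_le (by linarith) (by linarith)).trans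
    (Real.rpow_le_rpow_of_nonpos hz (by linarith) (by linarith))

/-- A dominating function for the logarithmically rescaled integrand. -/
def logBound (τ a η b x : ℝ) : ℝ≥0∞ :=
  (Set.Ioc (0 : ℝ) 1).indicator (fun _ => ENNReal.ofReal (tailConst τ a)) x +
    (Set.Ioi (1 : ℝ)).indicator (fun x => ENNReal.ofReal (tailConst τ a) *
      (ENNReal.ofReal (b ^ (-η)) * ENNReal.ofReal (Real.exp (-η * (x - 1))))) x

theorem log_scaled_le_logBound (hτ : 1 ≤ τ) (ha : -1 < a) {η b L : ℝ} (hη : η ≤ r) (hη0 : 0 < η)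
    (hb : 0 < b) (hL : 1 ≤ L) (x : ℝ) :
    ENNReal.ofReal (tailRatio τ a (Real.exp (L * x)) *
      (1 + b * Real.exp (L * (x - 1))) ^ (-r)) ≤ logBound τ a η b x := by
  have hA := (tailConst_pos hτ ha).le
  have hr : 0 ≤ r := by linarith
  have h1 := tailRatio_le hτ ha (Real.exp (L * x))
  have hz : 0 < b * Real.exp (L * (x - 1)) := by positivity
  unfold logBound
  rcases le_or_gt x 0 with hx | hx
  · have : ¬ 1 < Real.exp (L * x) := by
      rw [not_lt, Real.exp_le_one_iff]
      nlinarith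
    rw [tailRatio, if_neg this]
    simp
  rcases le_or_gt x 1 with hx1 | hx1
  · rw [Set.indicator_of_mem (show x ∈ Set.Ioc (0 : ℝ) 1 from ⟨hx, hx1⟩)]
    refine le_trans (ENNReal.ofReal_le_ofReal ?_) (le_add_of_nonneg_right zero_le)
    refine (mul_le_of_le_one_right (tailRatio_nonneg hτ ha _) ?_).trans h1
    exact Real.rpow_le_one_of_one_le_of_nonpos (by linarith) (by linarith)
  · rw [Set.indicator_of_mem (show x ∈ Set.Ioi (1 : ℝ) from hx1)]
    refine le_trans ?_ (le_add_of_nonneg_left zero_le)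
    rw [← ENNReal.ofReal_mul (by positivity), ← ENNReal.ofReal_mul hA]
    refine ENNReal.ofReal_le_ofReal (mul_le_mul h1 ?_ (by positivity) hA)
    refine (one_add_rpow_neg_le hz hη hη0.le).trans ?_
    rw [Real.mul_rpow hb.le (Real.exp_pos _).le, ← Real.exp_mul]
    refine mul_le_mul_of_nonneg_left (Real.exp_le_exp.2 ?_) (by positivity)
    nlinarith [mul_nonneg (mul_nonneg hη0.le (sub_pos.2 hx1).le) (sub_nonneg.2 hL)]

theorem lintegral_logBound (τ a : ℝ) {η : ℝ} (hη0 : 0 < η) :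
    ∃ C : ℝ≥0∞, C ≠ ∞ ∧ ∀ b, ∫⁻ x, logBound τ a η b x ≤ C * (1 + ENNReal.ofReal (b ^ (-η))) := by
  have hfin : ∫⁻ x in Set.Ioi (1 : ℝ), ENNReal.ofReal (Real.exp (-η * (x - 1))) ≠ ∞ := by
    have h := (exp_neg_integrableOn_Ioi 1 hη0).mul_const (Real.exp η)
    have e : ∀ x : ℝ, Real.exp (-η * (x - 1)) = Real.exp (-η * x) * Real.exp η := fun x => by
      rw [← Real.exp_add]; ring_nf
    simp_rw [e]
    exact h.lintegral_lt_top.ne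
  refine ⟨ENNReal.ofReal (tailConst τ a) *
    (1 + ∫⁻ x in Set.Ioi (1 : ℝ), ENNReal.ofReal (Real.exp (-η * (x - 1)))),
    ENNReal.mul_ne_top ENNReal.ofReal_ne_top (ENNReal.add_ne_top.2 ⟨ENNReal.one_ne_top, hfin⟩), fun b => ?_⟩
  unfold logBound
  rw [lintegral_add_left (measurable_const.indicator measurableSet_Ioc),
    lintegral_indicator measurableSet_Ioc, lintegral_indicator measurableSet_Ioi,
    lintegral_const_mul _ (by fun_prop), lintegral_const_mul _ (by fun_prop), setLIntegral_const,
    Real.volume_Ioc, mul_assoc, ← mul_add]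
  simp only [sub_zero, ENNReal.ofReal_one]
  refine mul_le_mul_right ?_ _
  rw [add_mul, one_mul, mul_add, mul_one, mul_comm]
  exact add_le_add (le_add_of_nonneg_right zero_le) (le_add_of_nonneg_left zero_le)

/-- A block with explained sum of squares `T` tending to infinity has an integral of the exact
order `1 / ψ T`. -/
structure IsScale (τ a κ r : ℝ) (ψ : ℝ → ℝ) (l : ℝ → ℝ≥0∞) : Prop where
  pos : ∀ T, 1 < T → 0 < ψ T
  measurable : Measurable l
  limit_pos : ∀ b, 0 < b → 0 < l b
  tendsto : ∀ b, 0 < b →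
    Tendsto (fun T => ENNReal.ofReal (ψ T) * slabIntegral τ a κ r T b) atTop (𝓝 (l b))
  bound : ∀ η, r - (a + 1 + κ / 2) < η → η ≤ r → ∃ C : ℝ≥0∞, C ≠ ∞ ∧ ∀ᶠ T in atTop, ∀ b, 0 < b →
    ENNReal.ofReal (ψ T) * slabIntegral τ a κ r T b ≤ C * (1 + ENNReal.ofReal (b ^ (-η)))
  negligible : ∀ q', (a + 1 + κ / 2 < q' ∨ a + 1 + κ / 2 = q' ∧ q' = r) →
    Tendsto (fun T => ψ T * T ^ (-q')) atTop (𝓝 0)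

/-- Dominated convergence in the variable s = u/T: the strict inequality gives integrability at s =
0 and b > 0 gives it at infinity. -/
theorem isScale_of_lt (hτ : 1 ≤ τ) (ha : -1 < a) (hκ : 0 ≤ κ) (hr : a + 1 + κ / 2 < r) :
    IsScale τ a κ r (fun T => T ^ (a + 1 + κ / 2)) (fun b => ∫⁻ s in Set.Ioi (0 : ℝ),
      ENNReal.ofReal (tailConst τ a * (s ^ (-(a + 1 + κ / 2) - 1) * (b + 1 / s) ^ (-r)))) := by
  have hm := measurable_tailRatio τ a
  have hA := tailConst_pos hτ ha
  set q := a + 1 + κ / 2 with hq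
  have hq0 : 0 < q := by rw [hq]; linarith
  have hle : ∀ {T : ℝ}, ∀ {b : ℝ}, 0 < b → ∀ s ∈ Set.Ioi (0 : ℝ), ENNReal.ofReal
        (tailRatio τ a (T * s) * (s ^ (-q - 1) * (b + 1 / s) ^ (-r))) ≤
      ENNReal.ofReal (tailConst τ a * (s ^ (-q - 1) * (b + 1 / s) ^ (-r))) := by
    intro T b hb s (hs : 0 < s)
    gcongr
    exact tailRatio_le hτ ha _
  have hbd : ∀ η, r - q < η → η ≤ r → ∃ C : ℝ≥0∞, C ≠ ∞ ∧ ∀ b, 0 < b →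
      ∫⁻ s in Set.Ioi (0 : ℝ), ENNReal.ofReal (tailConst τ a *
        (s ^ (-q - 1) * (b + 1 / s) ^ (-r))) ≤ C * (1 + ENNReal.ofReal (b ^ (-η))) := by
    intro η h1 h2
    refine ⟨ENNReal.ofReal (tailConst τ a) *
      ((∫⁻ s in Set.Ioc (0 : ℝ) 1, ENNReal.ofReal (s ^ (r - q - 1))) +
        ∫⁻ s in Set.Ioi (1 : ℝ), ENNReal.ofReal (s ^ (r - η - q - 1))),
      ENNReal.mul_ne_top ENNReal.ofReal_ne_top (ENNReal.add_ne_top.2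
        ⟨(lintegral_rpow_Ioc_lt_top (by linarith)).ne,
          (lintegral_rpow_Ioi_one_lt_top (by linarith)).ne⟩), fun b hb => ?_⟩
    simp_rw [ENNReal.ofReal_mul hA.le]
    rw [lintegral_const_mul _ (by fun_prop), mul_assoc]
    exact mul_le_mul_right (lintegral_scaled_le (by linarith) h2 (by linarith) hb) _
  refine ⟨fun T hT => by positivity, ?_, fun b hb => ?_, fun b hb => ?_, fun η h1 h2 => ?_,
    fun q' hq' => ?_⟩
  · refine Measurable.lintegral_prod_right ?_
    simp only [Function.uncurry_def]
    fun_prop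
  · refine lintegral_pos_of_pos_on_Ioi (by fun_prop) fun s hs => ?_
    rw [ENNReal.ofReal_pos]
    positivity
  · obtain ⟨C, hC, hCb⟩ := hbd r (by linarith) le_rfl
    refine Tendsto.congr' (f₁ := fun T => ∫⁻ s in Set.Ioi (0 : ℝ), ENNReal.ofReal
        (tailRatio τ a (T * s) * (s ^ (-q - 1) * (b + 1 / s) ^ (-r)))) ?_ ?_
    · filter_upwards [eventually_gt_atTop 0] with T hT
      rw [slabIntegral_eq_scaled hτ ha hT b]
    · refine tendsto_lintegral_filter_of_dominated_convergence (fun s =>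
        ENNReal.ofReal (tailConst τ a * (s ^ (-q - 1) * (b + 1 / s) ^ (-r)))) ?_ ?_ ?_ ?_
      · exact Eventually.of_forall fun T => by fun_prop
      · exact Eventually.of_forall fun T =>
          (ae_restrict_iff' measurableSet_Ioi).2 (ae_of_all _ (hle hb))
      · exact ((hCb b hb).trans_lt (ENNReal.mul_lt_top hC.lt_top (by simp))).ne
      · refine (ae_restrict_iff' measurableSet_Ioi).2 (ae_of_all _ fun s (hs : 0 < s) => ?_)
        refine ENNReal.tendsto_ofReal (Tendsto.mul_const _ ?_)
        exact (tendsto_tailRatio hτ).comp (tendsto_id.atTop_mul_const hs)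
  · obtain ⟨C, hC, hCb⟩ := hbd η h1 h2
    refine ⟨C, hC, ?_⟩
    filter_upwards [eventually_gt_atTop 0] with T hT b hb
    rw [slabIntegral_eq_scaled hτ ha hT b]
    exact (setLIntegral_mono' measurableSet_Ioi (hle hb)).trans (hCb b hb)
  · rcases hq' with h | ⟨h1, h2⟩
    · refine (tendsto_rpow_neg_atTop (sub_pos.2 h)).congr' ?_
      filter_upwards [eventually_gt_atTop 0] with T hT
      rw [← Real.rpow_add hT]
      congr 1
      ring
    · linarith

/-- On the logarithmic scale the integrand tends to the tail constant times the indicator of (0,1),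
so the limit does not depend on b. The factor 1/log T makes even a decay T^(-r) negligible. -/
theorem isScale_of_eq (hτ : 1 ≤ τ) (ha : -1 < a) (hκ : 0 ≤ κ) (hr : a + 1 + κ / 2 = r) :
    IsScale τ a κ r (fun T => T ^ r / Real.log T) (fun _ => ENNReal.ofReal (tailConst τ a)) := by
  have hm := measurable_tailRatio τ a
  have hA := tailConst_pos hτ ha
  have hr0 : 0 < r := by rw [← hr]; linarith
  refine ⟨fun T hT => ?_, measurable_const, fun b hb => by simpa using hA, fun b hb => ?_,
    fun η h1 h2 => ?_, fun q' hq' => ?_⟩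
  · have := Real.log_pos hT
    positivity
  · obtain ⟨C, hC, hCb⟩ := lintegral_logBound τ a hr0
    have hlim : ∫⁻ x, (Set.Ioo (0 : ℝ) 1).indicator
        (fun _ => ENNReal.ofReal (tailConst τ a)) x = ENNReal.ofReal (tailConst τ a) := by
      rw [lintegral_indicator measurableSet_Ioo, setLIntegral_const]
      simp
    rw [← hlim]
    refine Tendsto.congr' (f₁ := fun T => ∫⁻ x, ENNReal.ofReal (tailRatio τ a
      (Real.exp (Real.log T * x)) * (1 + b * Real.exp (Real.log T * (x - 1))) ^ (-r))) ?_ ?_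
    · filter_upwards [eventually_gt_atTop 1] with T hT
      rw [slabIntegral_eq_log_scaled hτ ha hr hT hb]
    · refine tendsto_lintegral_filter_of_dominated_convergence (logBound τ a r b) ?_ ?_ ?_ ?_
      · exact Eventually.of_forall fun T => by fun_prop
      · filter_upwards [Real.tendsto_log_atTop.eventually_ge_atTop 1] with T hT
        exact ae_of_all _ (log_scaled_le_logBound hτ ha le_rfl hr0 hb hT)
      · exact ((hCb b).trans_lt (ENNReal.mul_lt_top hC.lt_top (by simp))).ne
      -- At x = 1 the factor is (1+b)^(-r) for every T, so the indicator is the limit only off this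
      -- null set.
      · have hne : ∀ᵐ x : ℝ, x ≠ 1 := by simp [ae_iff, measure_singleton]
        filter_upwards [hne] with x hx1
        rcases le_or_gt x 0 with hx | hx
        · rw [Set.indicator_of_notMem (fun h => absurd h.1 (not_lt.2 hx))]
          refine tendsto_const_nhds.congr' ?_
          filter_upwards [Real.tendsto_log_atTop.eventually_ge_atTop 1] with T hT
          have : ¬ 1 < Real.exp (Real.log T * x) := by
            rw [not_lt, Real.exp_le_one_iff]
            nlinarith
          rw [tailRatio, if_neg this]
          simp
        · have h1 : Tendsto (fun T => tailRatio τ a (Real.exp (Real.log T * x))) atTop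
              (𝓝 (tailConst τ a)) :=
            (tendsto_tailRatio hτ).comp (Real.tendsto_exp_atTop.comp
              (Real.tendsto_log_atTop.atTop_mul_const hx))
          rcases lt_or_gt_of_ne hx1 with hx1 | hx1
          · rw [Set.indicator_of_mem (show x ∈ Set.Ioo (0 : ℝ) 1 from ⟨hx, hx1⟩)]
            refine ENNReal.tendsto_ofReal ?_
            have h2 : Tendsto (fun T : ℝ => (1 + b * Real.exp (Real.log T * (x - 1))) ^ (-r)) atTop
                (𝓝 ((1 + b * 0) ^ (-r))) := by
              refine Tendsto.rpow_const ?_ (Or.inl (by simp))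
              refine Tendsto.const_add _ (Tendsto.const_mul _ (Real.tendsto_exp_atBot.comp ?_))
              exact Real.tendsto_log_atTop.atTop_mul_const_of_neg (by linarith)
            simpa using h1.mul h2
          · rw [Set.indicator_of_notMem (fun h => absurd h.2 (not_lt.2 hx1.le))]
            rw [← ENNReal.ofReal_zero]
            refine ENNReal.tendsto_ofReal ?_
            have h2 : Tendsto (fun T : ℝ => (1 + b * Real.exp (Real.log T * (x - 1))) ^ (-r)) atTop
                (𝓝 0) := by
              refine (tendsto_rpow_neg_atTop hr0).comp ?_
              refine tendsto_atTop_add_const_left _ _ (Tendsto.const_mul_atTop hb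
                (Real.tendsto_exp_atTop.comp ?_))
              exact Real.tendsto_log_atTop.atTop_mul_const (by linarith)
            simpa using h1.mul h2
  · have hη0 : 0 < η := by linarith
    obtain ⟨C, hC, hCb⟩ := lintegral_logBound τ a hη0
    refine ⟨C, hC, ?_⟩
    filter_upwards [Real.tendsto_log_atTop.eventually_ge_atTop 1, eventually_gt_atTop 1] with
      T hT hT1 b hb
    rw [slabIntegral_eq_log_scaled hτ ha hr hT1 hb]
    exact (lintegral_mono (log_scaled_le_logBound hτ ha h2 hη0 hb hT)).trans (hCb b)
  · have hle : r ≤ q' := by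
      rcases hq' with h | ⟨h1, h2⟩ <;> linarith
    have hlog : Tendsto (fun T : ℝ => (Real.log T)⁻¹) atTop (𝓝 0) :=
      Real.tendsto_log_atTop.inv_tendsto_atTop
    refine squeeze_zero' ?_ ?_ hlog
    · filter_upwards [eventually_gt_atTop 1] with T hT
      have := Real.log_pos hT
      positivity
    · filter_upwards [eventually_gt_atTop 1] with T hT
      have h0 := Real.log_pos hT
      have hT0 : 0 < T := by linarith
      rw [div_mul_eq_mul_div, ← Real.rpow_add hT0, div_eq_mul_inv]
      refine mul_le_of_le_one_left (by positivity) ?_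
      exact Real.rpow_le_one_of_one_le_of_nonpos hT.le (by linarith)

theorem exists_isScale (hτ : 1 ≤ τ) (ha : -1 < a) (hκ : 0 ≤ κ) (hr : a + 1 + κ / 2 ≤ r) :
    ∃ ψ l, IsScale τ a κ r ψ l := by
  rcases hr.lt_or_eq with h | h
  · exact ⟨_, _, isScale_of_lt hτ ha hκ h⟩
  · exact ⟨_, _, isScale_of_eq hτ ha hκ h⟩

end

end BlockG
end

noncomputable section
namespace BlockG

/-! ### Several blocks -/

theorem lintegral_pi_pos {B : Type*} [Fintype B] {F : (B → ℝ) → ℝ≥0∞} (hF : Measurable F)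
    (h : ∀ g : B → ℝ, (∀ S, 0 < g S) → 0 < F g) : 0 < ∫⁻ g, F g := by
  rw [lintegral_pos_iff_support hF]
  have hsub : Set.univ.pi (fun _ : B => Set.Ioi (0 : ℝ)) ⊆ Function.support F := fun g hg =>
    (h g fun S => hg S trivial).ne'
  refine lt_of_lt_of_le ?_ (measure_mono hsub)
  rw [volume_pi_pi, pos_iff_ne_zero, Finset.prod_ne_zero_iff]
  simp

section
variable {B : Type*} [Fintype B] {τ a r : ℝ}

theorem prod_slab_pos (hτ : 1 ≤ τ) (ha : -1 < a) (κ : B → ℝ) {g : B → ℝ} (hg : ∀ S, 0 < g S) :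
    0 < ∏ S, slab τ a 0 (κ S) (g S) :=
  pos_iff_ne_zero.2 (Finset.prod_ne_zero_iff.2 fun S _ => (slab_pos hτ ha (κ S) (hg S)).ne')

theorem prod_slab_mul_congr {κ : B → ℝ} {g : B → ℝ} {x y : ℝ≥0∞}
    (h : (∀ S, 0 < g S) → x = y) :
    (∏ S, slab τ a 0 (κ S) (g S)) * x = (∏ S, slab τ a 0 (κ S) (g S)) * y := by
  by_cases hg : ∀ S, 0 < g S
  · rw [h hg]
  · push Not at hg
    obtain ⟨S, hS⟩ := hg
    rw [Finset.prod_eq_zero (Finset.mem_univ S) (slab_of_nonpos hS), zero_mul, zero_mul]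

theorem prod_slab_mul_mono {κ : B → ℝ} {g : B → ℝ} {x y : ℝ≥0∞}
    (h : (∀ S, 0 < g S) → x ≤ y) :
    (∏ S, slab τ a 0 (κ S) (g S)) * x ≤ (∏ S, slab τ a 0 (κ S) (g S)) * y := by
  by_cases hg : ∀ S, 0 < g S
  · exact mul_le_mul_right (h hg) _
  · push Not at hg
    obtain ⟨S, hS⟩ := hg
    rw [Finset.prod_eq_zero (Finset.mem_univ S) (slab_of_nonpos hS), zero_mul, zero_mul]

theorem shrunken_pos {T : B → ℝ} {R : ℝ} (hR : 0 ≤ R) (hT : ∀ S, 0 ≤ T S)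
    (hpos : 0 < R ∨ ∃ S, 0 < T S) {g : B → ℝ} (hg : ∀ S, 0 < g S) :
    0 < R + ∑ S, T S / (1 + g S) := by
  have hterm : ∀ S ∈ Finset.univ, 0 ≤ T S / (1 + g S) := fun S _ =>
    div_nonneg (hT S) (by linarith [hg S])
  rcases hpos with h | ⟨S, hS⟩
  · linarith [Finset.sum_nonneg hterm]
  · have h1 := Finset.single_le_sum hterm (Finset.mem_univ S)
    have h2 : 0 < T S / (1 + g S) := div_pos hS (by linarith [hg S])
    linarith

theorem powerIntegral_pos (hτ : 1 ≤ τ) (ha : -1 < a) (κ : B → ℝ) {T : B → ℝ} {R : ℝ}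
    (hR : 0 ≤ R) (hT : ∀ S, 0 ≤ T S) (hpos : 0 < R ∨ ∃ S, 0 < T S) :
    0 < powerIntegral τ a κ T R r := by
  have hm : ∀ κ, Measurable (slab τ a 0 κ) := measurable_slab τ a 0
  refine lintegral_pi_pos (by fun_prop) fun g hg => ENNReal.mul_pos (prod_slab_pos hτ ha κ hg).ne' ?_
  have := shrunken_pos hR hT hpos hg
  rw [← pos_iff_ne_zero, ENNReal.ofReal_pos]
  positivity

theorem lintegral_prod_slab_lt_top (hτ : 1 ≤ τ) (ha : -1 < a) {κ : B → ℝ} (hκ : ∀ S, 0 ≤ κ S) :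
    ∫⁻ g : B → ℝ, ∏ S, slab τ a 0 (κ S) (g S) < ∞ := by
  rw [lintegral_pi_prod _ fun S => measurable_slab τ a 0 (κ S)]
  exact ENNReal.prod_lt_top fun S _ => lintegral_slab_lt_top hτ ha (hκ S)

theorem powerIntegral_lt_top (hτ : 1 ≤ τ) (ha : -1 < a) {κ T : B → ℝ} {R : ℝ}
    (hR : 0 ≤ R) (hT : ∀ S, 0 ≤ T S) {θ₀ : ℝ} (hθ₀ : 0 ≤ θ₀) {θ : B → ℝ} (hθ : ∀ S, 0 ≤ θ S)
    (hcap : ∀ S, θ S < a + 1 + κ S / 2) (hR0 : R = 0 → θ₀ = 0) (hT0 : ∀ S, T S = 0 → θ S = 0) :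
    powerIntegral τ a κ T R (θ₀ + ∑ S, θ S) < ∞ := by
  refine (powerIntegral_le τ a κ hR hT hθ₀ hθ hR0 hT0).trans_lt ?_
  exact ENNReal.mul_lt_top ENNReal.ofReal_lt_top (ENNReal.prod_lt_top fun S _ =>
    ENNReal.mul_lt_top ENNReal.ofReal_lt_top (lintegral_slab_mul_rpow_lt_top hτ ha (hcap S)))

theorem powerIntegral_equiv {B' : Type*} [Fintype B'] (e : B ≃ B') (κ T : B' → ℝ) (R : ℝ) :
    powerIntegral τ a κ T R r =
      powerIntegral τ a (fun S => κ (e S)) (fun S => T (e S)) R r := by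
  rw [powerIntegral, lintegral_pi_equiv e, powerIntegral]
  refine lintegral_congr fun g => ?_
  rw [← Equiv.prod_comp e, ← Equiv.sum_comp e]
  simp

theorem powerIntegral_option (κ T : Option B → ℝ) (R : ℝ) :
    powerIntegral τ a κ T R r = ∫⁻ g : B → ℝ, (∏ S, slab τ a 0 (κ (some S)) (g S)) *
      slabIntegral τ a (κ none) r (T none) (R + ∑ S, T (some S) / (1 + g S)) := by
  have hm : ∀ κ, Measurable (slab τ a 0 κ) := measurable_slab τ a 0
  rw [powerIntegral, lintegral_pi_option (by fun_prop)]
  refine lintegral_congr fun g => ?_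
  simp only [Fintype.prod_option, Fintype.sum_option, Option.elim_none, Option.elim_some]
  rw [slabIntegral, ← lintegral_const_mul _ (by fun_prop)]
  refine lintegral_congr fun t => ?_
  rw [mul_comm (slab _ _ _ _ _), mul_assoc]
  congr 4
  ring

theorem measurable_slabIntegral (τ a κ r T : ℝ) : Measurable (slabIntegral τ a κ r T) := by
  have hm : ∀ κ, Measurable (slab τ a 0 κ) := measurable_slab τ a 0
  unfold slabIntegral
  refine Measurable.lintegral_prod_right ?_
  simp only [Function.uncurry_def]
  fun_prop

/-- If one block has a diverging explained sum of squares and the others have constant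
ones, then the integral has the exact order of the diverging block. -/
theorem IsScale.tendsto_powerIntegral (hτ : 1 ≤ τ) (ha : -1 < a) {κ : Option B → ℝ}
    (hκ : ∀ S, 0 ≤ κ S) {ψ : ℝ → ℝ} {l : ℝ → ℝ≥0∞} (hψ : IsScale τ a (κ none) r ψ l)
    {t : B → ℝ} (ht : ∀ S, 0 ≤ t S) {R : ℝ} (hR : 0 ≤ R) (hpos : 0 < R ∨ ∃ S, 0 < t S)
    {θ₀ : ℝ} (hθ₀ : 0 ≤ θ₀) {θ : B → ℝ} (hθ : ∀ S, 0 ≤ θ S)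
    (hcap : ∀ S, θ S < a + 1 + κ (some S) / 2) (hR0 : R = 0 → θ₀ = 0)
    (ht0 : ∀ S, t S = 0 → θ S = 0)
    (hlow : r - (a + 1 + κ none / 2) < θ₀ + ∑ S, θ S) (hup : θ₀ + ∑ S, θ S ≤ r)
    {T : ℕ → ℝ} (hT : Tendsto T atTop atTop) :
    ∃ L : ℝ≥0∞, 0 < L ∧ L < ∞ ∧ Tendsto (fun N => ENNReal.ofReal (ψ (T N)) *
      powerIntegral τ a κ (fun o => o.elim (T N) t) R r) atTop (𝓝 L) := by
  have hm : ∀ κ, Measurable (slab τ a 0 κ) := measurable_slab τ a 0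
  have hml := hψ.measurable
  have hms := measurable_slabIntegral τ a (κ none) r
  -- The exponent of b is chosen as θ₀ + ∑ θ, so that the same exponents prove b(g)^(-η) integrable
  -- over the remaining factors.
  obtain ⟨C, hC, hCb⟩ := hψ.bound _ hlow hup
  set b : (B → ℝ) → ℝ := fun g => R + ∑ S, t S / (1 + g S) with hb
  have hbm : Measurable b := by fun_prop
  have hbpos : ∀ g : B → ℝ, (∀ S, 0 < g S) → 0 < b g := fun g hg => shrunken_pos hR ht hpos hg
  set F : ℝ → (B → ℝ) → ℝ≥0∞ := fun T g => (∏ S, slab τ a 0 (κ (some S)) (g S)) *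
    (ENNReal.ofReal (ψ T) * slabIntegral τ a (κ none) r T (b g)) with hF
  set D : (B → ℝ) → ℝ≥0∞ := fun g => (∏ S, slab τ a 0 (κ (some S)) (g S)) *
    (C * (1 + ENNReal.ofReal (b g ^ (-(θ₀ + ∑ S, θ S))))) with hD
  have hFD : ∀ᶠ T in atTop, ∀ g, F T g ≤ D g := by
    filter_upwards [hCb] with T hT g
    exact prod_slab_mul_mono fun hg => hT _ (hbpos g hg)
  have hDfin : ∫⁻ g, D g < ∞ := by
    have e : ∀ g, D g = C * ((∏ S, slab τ a 0 (κ (some S)) (g S)) +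
        (∏ S, slab τ a 0 (κ (some S)) (g S)) *
          ENNReal.ofReal (b g ^ (-(θ₀ + ∑ S, θ S)))) := fun g => by rw [hD]; ring
    simp_rw [e]
    rw [lintegral_const_mul _ (by fun_prop), lintegral_add_left (by fun_prop)]
    exact ENNReal.mul_lt_top hC.lt_top (ENNReal.add_lt_top.2
      ⟨lintegral_prod_slab_lt_top hτ ha fun S => hκ _,
        powerIntegral_lt_top hτ ha hR ht hθ₀ hθ hcap hR0 ht0⟩)
  have hlim : Tendsto (fun T => ∫⁻ g, F T g) atTop
      (𝓝 (∫⁻ g : B → ℝ, (∏ S, slab τ a 0 (κ (some S)) (g S)) * l (b g))) := by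
    refine tendsto_lintegral_filter_of_dominated_convergence D
      (Eventually.of_forall fun T => by have := hms T; fun_prop)
      (hFD.mono fun T h => ae_of_all _ h) hDfin.ne (ae_of_all _ fun g => ?_)
    by_cases hg : ∀ S, 0 < g S
    · refine ENNReal.Tendsto.const_mul (hψ.tendsto _ (hbpos g hg)) (Or.inr ?_)
      exact (ENNReal.prod_lt_top fun S _ =>
        ENNReal.mul_lt_top ENNReal.ofReal_lt_top ENNReal.ofReal_lt_top).ne
    · push Not at hg
      obtain ⟨S, hS⟩ := hg
      have h0 : ∏ S, slab τ a 0 (κ (some S)) (g S) = 0 :=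
        Finset.prod_eq_zero (Finset.mem_univ S) (slab_of_nonpos hS)
      simp only [hF, h0, zero_mul]
      exact tendsto_const_nhds
  refine ⟨_, ?_, ?_, ((hlim.comp hT).congr fun N => ?_)⟩
  · exact lintegral_pi_pos (by fun_prop) fun g hg =>
      ENNReal.mul_pos (prod_slab_pos hτ ha _ hg).ne' (hψ.limit_pos _ (hbpos g hg)).ne'
  · exact (le_of_tendsto hlim (hFD.mono fun T h => lintegral_mono h)).trans_lt hDfin
  · rw [powerIntegral_option, ← lintegral_const_mul _ (by have := hms (T N); fun_prop)]
    refine lintegral_congr fun g => ?_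
    simp only [hF, hb, Option.elim_none, Option.elim_some]
    rw [mul_left_comm]

/-- A configuration of blocks whose diverging blocks allow a larger exponent is negligible. -/
theorem IsScale.tendsto_powerIntegral_zero (hτ : 1 ≤ τ) (ha : -1 < a) {κ : B → ℝ} {κ' : ℝ}
    {ψ : ℝ → ℝ} {l : ℝ → ℝ≥0∞} (hψ : IsScale τ a κ' r ψ l) [DecidableEq B] (big : Finset B)
    {T : ℕ → B → ℝ} (hT : ∀ N S, 0 ≤ T N S) {t : B → ℝ} (ht : ∀ N, ∀ S ∉ big, T N S = t S)
    {U : ℕ → ℝ} (hU : Tendsto U atTop atTop) {c : ℝ} (hc : 0 < c)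
    (hbig : ∀ᶠ N in atTop, ∀ S ∈ big, c * U N ≤ T N S)
    {R : ℝ} (hR : 0 ≤ R) {θ₀ : ℝ} (hθ₀ : 0 ≤ θ₀) {θ : B → ℝ} (hθ : ∀ S, 0 ≤ θ S)
    (hcap : ∀ S, θ S < a + 1 + κ S / 2) (hsum : θ₀ + ∑ S, θ S = r) (hR0 : R = 0 → θ₀ = 0)
    (ht0 : ∀ S ∉ big, t S = 0 → θ S = 0)
    (hq : a + 1 + κ' / 2 < ∑ S ∈ big, θ S ∨
      a + 1 + κ' / 2 = ∑ S ∈ big, θ S ∧ ∑ S ∈ big, θ S = r) :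
    Tendsto (fun N => ENNReal.ofReal (ψ (U N)) * powerIntegral τ a κ (T N) R r) atTop (𝓝 0) := by
  set M : B → ℝ≥0∞ := fun S => ∫⁻ g, slab τ a 0 (κ S) g * ENNReal.ofReal ((1 + g) ^ θ S) with hM
  set K : ℝ≥0∞ := ENNReal.ofReal (R ^ (-θ₀)) *
    ∏ S, (ENNReal.ofReal (if S ∈ big then c ^ (-θ S) else t S ^ (-θ S)) * M S) with hK
  have hKfin : K ≠ ∞ := (ENNReal.mul_lt_top ENNReal.ofReal_lt_top (ENNReal.prod_lt_top fun S _ =>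
    ENNReal.mul_lt_top ENNReal.ofReal_lt_top (lintegral_slab_mul_rpow_lt_top hτ ha (hcap S)))).ne
  have hmain : ∀ᶠ N in atTop, ENNReal.ofReal (ψ (U N)) * powerIntegral τ a κ (T N) R r ≤
      ENNReal.ofReal (ψ (U N) * U N ^ (-∑ S ∈ big, θ S)) * K := by
    filter_upwards [hbig, hU.eventually_gt_atTop 1] with N hN hN1
    have hU0 : 0 < U N := by linarith
    have hTpos : ∀ S, T N S = 0 → θ S = 0 := by
      intro S hS
      by_cases hSb : S ∈ big
      · have := hN S hSb
        have : 0 < c * U N := by positivity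
        linarith
      · exact ht0 S hSb (by rw [← ht N S hSb, hS])
    rw [← hsum]
    rw [ENNReal.ofReal_mul (hψ.pos _ hN1).le, mul_assoc]
    refine mul_le_mul_right ((powerIntegral_le τ a κ hR (hT N) hθ₀ hθ hR0 hTpos).trans ?_) _
    rw [hK, mul_left_comm]
    refine mul_le_mul_right ?_ _
    -- Only the diverging blocks contribute powers of U; the exponents placed on R and on the
    -- constant blocks go into K.
    have e : ENNReal.ofReal (U N ^ (-∑ S ∈ big, θ S)) =
        ∏ S, ENNReal.ofReal (if S ∈ big then U N ^ (-θ S) else 1) := by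
      rw [← Finset.sum_neg_distrib, Real.rpow_sum_of_pos hU0,
        ENNReal.ofReal_prod_of_nonneg fun S _ => by positivity]
      rw [← Finset.prod_subset (Finset.subset_univ big)
        (fun S _ hS => by rw [if_neg hS, ENNReal.ofReal_one])]
      exact Finset.prod_congr rfl fun S hS => by rw [if_pos hS]
    rw [e, ← Finset.prod_mul_distrib]
    refine Finset.prod_le_prod' fun S _ => ?_
    rw [← mul_assoc, ← ENNReal.ofReal_mul (by split_ifs <;> positivity)]
    refine mul_le_mul_left (ENNReal.ofReal_le_ofReal ?_) _
    split_ifs with hSb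
    · rw [mul_comm, ← Real.mul_rpow hc.le hU0.le]
      exact Real.rpow_le_rpow_of_nonpos (by positivity) (hN S hSb) (by linarith [hθ S])
    · rw [one_mul, ht N S hSb]
  have h0 : Tendsto (fun N => ENNReal.ofReal (ψ (U N) * U N ^ (-∑ S ∈ big, θ S)) * K) atTop
      (𝓝 (ENNReal.ofReal 0 * K)) :=
    ENNReal.Tendsto.mul_const (ENNReal.tendsto_ofReal ((hψ.negligible _ hq).comp hU))
      (Or.inr hKfin)
  rw [ENNReal.ofReal_zero, zero_mul] at h0
  exact tendsto_of_tendsto_of_tendsto_of_le_of_le' tendsto_const_nhds h0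
    (Eventually.of_forall fun _ => zero_le) hmain

end

/-! ### Choice of the exponents -/

/-- Give each block of `s` a share of x proportional to its capacity. -/
theorem exists_exponents_of_lt_sum {B : Type*} [DecidableEq B] (s : Finset B) {cap : B → ℝ}
    (hcap : ∀ S, 0 < cap S) {x : ℝ} (hx : 0 ≤ x) (hxs : x = 0 ∨ x < ∑ S ∈ s, cap S) :
    ∃ θ : B → ℝ, (∀ S, 0 ≤ θ S) ∧ (∀ S, θ S < cap S) ∧ (∀ S ∉ s, θ S = 0) ∧
      ∑ S ∈ s, θ S = x := by
  rcases hxs with rfl | hxs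
  · exact ⟨fun _ => 0, fun _ => le_rfl, hcap, fun _ _ => rfl, by simp⟩
  have hA : 0 < ∑ S ∈ s, cap S := by linarith
  refine ⟨fun S => if S ∈ s then x / (∑ S ∈ s, cap S) * cap S else 0, fun S => ?_, fun S => ?_,
    fun S hS => if_neg hS, ?_⟩
  · have := hcap S
    dsimp only
    split_ifs <;> positivity
  · dsimp only
    split_ifs
    · exact mul_lt_of_lt_one_left (hcap S) ((div_lt_one hA).2 hxs)
    · exact hcap S
  · rw [Finset.sum_congr rfl fun S hS => if_pos hS, ← Finset.mul_sum, div_mul_cancel₀ _ hA.ne']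

/-- The diverging blocks should carry more than q, which their capacity permits. If they can carry
all of r they do. Otherwise the excess goes to the residual when R > 0, or else to the constant
blocks, for which the total capacity has to exceed r. When q = r the diverging blocks cannot carry
more than q, so the last alternative records equality. -/
theorem exists_exponents {B : Type*} [Fintype B] [DecidableEq B] (big : Finset B) {cap : B → ℝ}
    (hcap : ∀ S, 0 < cap S) {q r R : ℝ} (hq : 0 < q) (hqr : q ≤ r) (hqb : q < ∑ S ∈ big, cap S)
    {t : B → ℝ} (h : 0 < R ∨ (∀ S ∉ big, 0 < t S) ∧ r < ∑ S, cap S) :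
    ∃ (θ₀ : ℝ) (θ : B → ℝ), 0 ≤ θ₀ ∧ (∀ S, 0 ≤ θ S) ∧ (∀ S, θ S < cap S) ∧
      θ₀ + ∑ S, θ S = r ∧ (R = 0 → θ₀ = 0) ∧ (∀ S ∉ big, t S = 0 → θ S = 0) ∧
      (q < ∑ S ∈ big, θ S ∨ q = ∑ S ∈ big, θ S ∧ ∑ S ∈ big, θ S = r) := by
  have hsplit : ∀ f : B → ℝ, ∑ S, f S = ∑ S ∈ big, f S + ∑ S ∈ bigᶜ, f S := fun f =>
    (Finset.sum_add_sum_compl big f).symm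
  by_cases hrA : r < ∑ S ∈ big, cap S
  · obtain ⟨θ, h1, h2, h3, h4⟩ := exists_exponents_of_lt_sum big hcap (hq.le.trans hqr) (Or.inr hrA)
    have h5 : ∑ S ∈ bigᶜ, θ S = 0 :=
      Finset.sum_eq_zero fun S hS => h3 S (Finset.mem_compl.1 hS)
    refine ⟨0, θ, le_rfl, h1, h2, by rw [hsplit, h4, h5]; ring, fun _ => rfl,
      fun S hS _ => h3 S hS, ?_⟩
    rw [h4]
    rcases hqr.lt_or_eq with h | h
    · exact Or.inl h
    · exact Or.inr ⟨h, rfl⟩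
  rw [not_lt] at hrA
  rcases h with hR | ⟨ht, hr⟩
  · obtain ⟨x, hx1, hx2⟩ := exists_between hqb
    obtain ⟨θ, h1, h2, h3, h4⟩ := exists_exponents_of_lt_sum big hcap (x := x)
      (by linarith) (Or.inr hx2)
    have h5 : ∑ S ∈ bigᶜ, θ S = 0 :=
      Finset.sum_eq_zero fun S hS => h3 S (Finset.mem_compl.1 hS)
    exact ⟨r - x, θ, by linarith, h1, h2, by rw [hsplit, h4, h5]; ring, fun h => by linarith,
      fun S hS _ => h3 S hS, Or.inl (by rw [h4]; exact hx1)⟩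
  · rw [hsplit] at hr
    -- The lower bound r - ∑ cap over the complement ensures that the remainder r - x fits into the
    -- constant blocks.
    obtain ⟨x, hx1, hx2⟩ := exists_between
      (max_lt hqb (by linarith : r - ∑ S ∈ bigᶜ, cap S < ∑ S ∈ big, cap S))
    rw [max_lt_iff] at hx1
    obtain ⟨θ, h1, h2, h3, h4⟩ := exists_exponents_of_lt_sum big hcap (x := x)
      (by linarith) (Or.inr hx2)
    obtain ⟨θ', h1', h2', h3', h4'⟩ := exists_exponents_of_lt_sum bigᶜ hcap (x := r - x)
      (by linarith) (Or.inr (by linarith))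
    have e1 : ∑ S ∈ big, (if S ∈ big then θ S else θ' S) = x := by
      rw [← h4]; exact Finset.sum_congr rfl fun S hS => if_pos hS
    have e2 : ∑ S ∈ bigᶜ, (if S ∈ big then θ S else θ' S) = r - x := by
      rw [← h4']; exact Finset.sum_congr rfl fun S hS => if_neg (Finset.mem_compl.1 hS)
    refine ⟨0, fun S => if S ∈ big then θ S else θ' S, le_rfl, fun S => ?_, fun S => ?_,
      by rw [hsplit, e1, e2]; ring, fun _ => rfl, fun S hS h => absurd h (ht S hS).ne',
      Or.inl (by rw [e1]; exact hx1.1)⟩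
    · dsimp only; split_ifs
      exacts [h1 S, h1' S]
    · dsimp only; split_ifs
      exacts [h2 S, h2' S]

end BlockG
end

noncomputable section
namespace BlockG

/-! ### Partitions -/

section
variable {ι : Type*} [Fintype ι] [DecidableEq ι] {τ a r : ℝ}

theorem sum_card_blocks (ρ : Finpartition (Finset.univ : Finset ι)) :
    ∑ S : ρ.parts, (S.1.card : ℝ) = Fintype.card ι := by
  have h := sum_eq_sum_blocks ρ fun _ : ι => (1 : ℝ)
  simpa using h.symm

/-- Each block adds a+1 > 0 to half its size. This replaces R > 0 when r is at most half the number
of columns. -/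
theorem half_card_lt_sum_cap [Nonempty ι] (ha : -1 < a)
    (ρ : Finpartition (Finset.univ : Finset ι)) :
    (Fintype.card ι : ℝ) / 2 < ∑ S : ρ.parts, (a + 1 + (S.1.card : ℝ) / 2) := by
  have hK : 0 < ρ.parts.card :=
    Finset.card_pos.2 (ρ.parts_nonempty (by simp [Finset.univ_nonempty.ne_empty]))
  have hK' : (0 : ℝ) < ρ.parts.card := by exact_mod_cast hK
  rw [Finset.sum_add_distrib, ← Finset.sum_div, sum_card_blocks]
  simp only [Finset.sum_const, Finset.card_univ, Fintype.card_coe, nsmul_eq_mul]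
  have : 0 < (ρ.parts.card : ℝ) * (a + 1) := mul_pos hK' (by linarith)
  linarith

/-- The blocks of `ρ` that meet `J`. -/
def meeting (ρ : Finpartition (Finset.univ : Finset ι)) (J : Finset ι) : Finset ρ.parts :=
  Finset.univ.filter fun S => ¬ Disjoint S.1 J

theorem mem_meeting {ρ : Finpartition (Finset.univ : Finset ι)} {J : Finset ι} {S : ρ.parts} :
    S ∈ meeting ρ J ↔ ¬ Disjoint S.1 J := by
  simp [meeting]

theorem exists_mem_meeting (ρ : Finpartition (Finset.univ : Finset ι)) {J : Finset ι} {j : ι}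
    (hj : j ∈ J) : ∃ S ∈ meeting ρ J, j ∈ S.1 :=
  ⟨blockOf ρ j, mem_meeting.2 (Finset.not_disjoint_iff.2
    ⟨j, ρ.mem_part_self.2 (Finset.mem_univ j), hj⟩), ρ.mem_part_self.2 (Finset.mem_univ j)⟩

theorem card_le_sum_meeting (ρ : Finpartition (Finset.univ : Finset ι)) (J : Finset ι) :
    (J.card : ℝ) ≤ ∑ S ∈ meeting ρ J, (S.1.card : ℝ) := by
  have h : J ⊆ (meeting ρ J).biUnion Subtype.val := fun j hj => by
    obtain ⟨S, hS, hjS⟩ := exists_mem_meeting ρ hj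
    exact Finset.mem_biUnion.2 ⟨S, hS, hjS⟩
  exact_mod_cast (Finset.card_le_card h).trans Finset.card_biUnion_le

theorem cap_le_sum_meeting (ha : -1 < a) (ρ : Finpartition (Finset.univ : Finset ι))
    {J : Finset ι} (hJ : J.Nonempty) :
    a + 1 + (J.card : ℝ) / 2 ≤ ∑ S ∈ meeting ρ J, (a + 1 + (S.1.card : ℝ) / 2) := by
  obtain ⟨j, hj⟩ := hJ
  obtain ⟨S, hS, -⟩ := exists_mem_meeting ρ hj
  have hK : (1 : ℝ) ≤ (meeting ρ J).card := by exact_mod_cast Finset.card_pos.2 ⟨S, hS⟩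
  have := card_le_sum_meeting ρ J
  rw [Finset.sum_add_distrib, ← Finset.sum_div]
  simp only [Finset.sum_const, nsmul_eq_mul]
  nlinarith

/-- If J is not a block, either two blocks meet J, costing an extra a+1, or a single block contains
J strictly, costing at least 1/2. This singles out the partitions with J as a block. -/
theorem cap_lt_sum_meeting (ha : -1 < a) (ρ : Finpartition (Finset.univ : Finset ι))
    {J : Finset ι} (hJ : J.Nonempty) (hJρ : J ∉ ρ.parts) :
    a + 1 + (J.card : ℝ) / 2 < ∑ S ∈ meeting ρ J, (a + 1 + (S.1.card : ℝ) / 2) := by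
  obtain ⟨j, hj⟩ := id hJ
  obtain ⟨S, hS, -⟩ := exists_mem_meeting ρ hj
  have hpos : 0 < (meeting ρ J).card := Finset.card_pos.2 ⟨S, hS⟩
  rcases Nat.lt_or_ge 1 (meeting ρ J).card with h | h
  · have hK : (2 : ℝ) ≤ (meeting ρ J).card := by exact_mod_cast h
    have := card_le_sum_meeting ρ J
    rw [Finset.sum_add_distrib, ← Finset.sum_div]
    simp only [Finset.sum_const, nsmul_eq_mul]
    nlinarith
  · obtain ⟨S', hS'⟩ := Finset.card_eq_one.1 (le_antisymm h hpos)
    have hsub : J ⊆ S'.1 := fun i hi => by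
      obtain ⟨S'', h1, h2⟩ := exists_mem_meeting ρ hi
      rw [hS', Finset.mem_singleton] at h1
      exact h1 ▸ h2
    have hss : J ⊂ S'.1 := hsub.ssubset_of_ne fun h => hJρ (h ▸ S'.2)
    have hlt : (J.card : ℝ) < S'.1.card := by exact_mod_cast Finset.card_lt_card hss
    rw [hS', Finset.sum_singleton]
    linarith

/-- If J is a block, it alone diverges and its explained sum of squares is exactly the argument of
ψ; otherwise the excess capacity of the blocks meeting J forces the limit 0. No convergence of the
individual growth rates is needed. -/
theorem IsScale.tendsto_partition (hτ : 1 ≤ τ) (ha : -1 < a) {J : Finset ι} (hJ : J.Nonempty)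
    {ψ : ℝ → ℝ} {l : ℝ → ℝ≥0∞} (hψ : IsScale τ a J.card r ψ l)
    (hqr : a + 1 + (J.card : ℝ) / 2 ≤ r) {v : ℕ → ι → ℝ} (hv : ∀ N j, 0 ≤ v N j) {t : ι → ℝ}
    (hvt : ∀ N, ∀ j ∉ J, v N j = t j) (hU : Tendsto (fun N => ∑ j ∈ J, v N j) atTop atTop)
    {c : ℝ} (hc : 0 < c) (hbig : ∀ᶠ N in atTop, ∀ j ∈ J, c * ∑ i ∈ J, v N i ≤ v N j)
    {R : ℝ} (hR : 0 ≤ R) (h : 0 < R ∨ (∀ j ∉ J, 0 < t j) ∧ r ≤ (Fintype.card ι : ℝ) / 2)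
    (ρ : Finpartition (Finset.univ : Finset ι)) :
    ∃ L : ℝ≥0∞, L < ∞ ∧ (J ∈ ρ.parts → 0 < L) ∧
      Tendsto (fun N => ENNReal.ofReal (ψ (∑ j ∈ J, v N j)) *
        powerIntegral τ a (fun S : ρ.parts => (S.1.card : ℝ)) (fun S => ∑ j ∈ S.1, v N j) R r)
        atTop (𝓝 L) := by
  have : Nonempty ι := ⟨hJ.choose⟩
  have hq0 : 0 < a + 1 + (J.card : ℝ) / 2 := by
    have : (0 : ℝ) ≤ J.card := by positivity
    linarith
  have hcap : ∀ S : ρ.parts, 0 < a + 1 + (S.1.card : ℝ) / 2 := fun S => by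
    have : (0 : ℝ) ≤ S.1.card := by positivity
    linarith
  have ht : ∀ j ∉ J, 0 ≤ t j := fun j hj => by rw [← hvt 0 j hj]; exact hv 0 j
  have htot := half_card_lt_sum_cap ha ρ
  have hconst : ∀ S : ρ.parts, Disjoint S.1 J → ∀ N, ∑ j ∈ S.1, v N j = ∑ j ∈ S.1, t j :=
    fun S hS N => Finset.sum_congr rfl fun j hj => hvt N j (Finset.disjoint_left.1 hS hj)
  have htpos : (∀ j ∉ J, 0 < t j) → ∀ S : ρ.parts, Disjoint S.1 J → 0 < ∑ j ∈ S.1, t j :=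
    fun h S hS => Finset.sum_pos (fun j hj => h j (Finset.disjoint_left.1 hS hj))
      (ρ.nonempty_of_mem_parts S.2)
  by_cases hJρ : J ∈ ρ.parts
  · set J' : ρ.parts := ⟨J, hJρ⟩ with hJ'
    have hdisj : ∀ S : {S : ρ.parts // S ≠ J'}, Disjoint S.1.1 J := fun S =>
      ρ.disjoint S.1.2 hJρ fun h => S.2 (Subtype.ext h)
    set e := Equiv.optionSubtypeNe J' with he
    have hsum : ∑ S : ρ.parts, (a + 1 + (S.1.card : ℝ) / 2) = a + 1 + (J.card : ℝ) / 2 +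
        ∑ S : {S : ρ.parts // S ≠ J'}, (a + 1 + (S.1.1.card : ℝ) / 2) := by
      rw [← Equiv.sum_comp e, Fintype.sum_option]
      simp [he, hJ']
    set D := ∑ S : {S : ρ.parts // S ≠ J'}, (a + 1 + (S.1.1.card : ℝ) / 2) with hD
    have hθ : ∃ (θ₀ : ℝ) (θ : {S : ρ.parts // S ≠ J'} → ℝ), 0 ≤ θ₀ ∧ (∀ S, 0 ≤ θ S) ∧
        (∀ S, θ S < a + 1 + (S.1.1.card : ℝ) / 2) ∧ (R = 0 → θ₀ = 0) ∧
        (∀ S, ∑ j ∈ S.1.1, t j = 0 → θ S = 0) ∧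
        r - (a + 1 + (J.card : ℝ) / 2) < θ₀ + ∑ S, θ S ∧ θ₀ + ∑ S, θ S ≤ r := by
      rcases h with hR' | ⟨h1, h2⟩
      · exact ⟨r, fun _ => 0, by linarith, fun _ => le_rfl, fun S => hcap S.1,
          fun h => by linarith, fun _ _ => rfl, by simp; linarith, by simp⟩
      -- The exponent η must exceed r - q for the bound on the diverging block and stay below the
      -- capacity D of the others; this room exists since r is below the total capacity.
      · have hrD : r - (a + 1 + (J.card : ℝ) / 2) < D := by linarith
        obtain ⟨η, hη1, hη2⟩ := exists_between (lt_min (by linarith :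
          r - (a + 1 + (J.card : ℝ) / 2) < r) hrD)
        rw [lt_min_iff] at hη2
        obtain ⟨θ, h3, h4, -, h6⟩ := exists_exponents_of_lt_sum
          (Finset.univ : Finset {S : ρ.parts // S ≠ J'})
          (cap := fun S => a + 1 + (S.1.1.card : ℝ) / 2) (fun S => hcap S.1) (x := η)
          (by linarith) (Or.inr hη2.2)
        exact ⟨0, θ, le_rfl, h3, h4, fun _ => rfl,
          fun S hS => absurd hS (htpos h1 S.1 (hdisj S)).ne', by rw [h6]; linarith,
          by rw [h6]; linarith⟩
    obtain ⟨θ₀, θ, h1, h2, h3, h4, h5, h6, h7⟩ := hθ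
    have hpos : 0 < R ∨ ∃ S : {S : ρ.parts // S ≠ J'}, 0 < ∑ j ∈ S.1.1, t j := by
      rcases h with hR' | ⟨h8, h9⟩
      · exact Or.inl hR'
      · right
        -- D > r - q ≥ 0 forces a block other than J, whose positive explained sum of squares
        -- replaces R > 0.
        have hDpos : 0 < D := by linarith
        obtain ⟨S, -, -⟩ := Finset.exists_ne_zero_of_sum_ne_zero hDpos.ne'
        exact ⟨S, htpos h8 S.1 (hdisj S)⟩
    obtain ⟨L, hL1, hL2, hL3⟩ := IsScale.tendsto_powerIntegral hτ ha
      (κ := fun o => ((e o).1.card : ℝ)) (fun _ => by positivity) (ψ := ψ) (l := l)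
      (by simpa [he, hJ'] using hψ) (t := fun S => ∑ j ∈ S.1.1, t j)
      (fun S => Finset.sum_nonneg fun j hj => ht j (Finset.disjoint_left.1 (hdisj S) hj))
      hR hpos h1 h2 (by simpa [he] using h3) h4 h5 (by simpa [he, hJ'] using h6) h7 hU
    refine ⟨L, hL2, fun _ => hL1, hL3.congr fun N => ?_⟩
    rw [powerIntegral_equiv e]
    congr 2
    funext o
    cases o with
    | none => simp [he, hJ']
    | some S => simp [he, hconst S.1 (hdisj S) N]
  · obtain ⟨θ₀, θ, h1, h2, h3, h4, h5, h6, h7⟩ := exists_exponents (meeting ρ J) hcap hq0 hqr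
      (cap_lt_sum_meeting ha ρ hJ hJρ) (t := fun S => ∑ j ∈ S.1, t j) (R := R) (by
        rcases h with h | ⟨h8, h9⟩
        · exact Or.inl h
        · refine Or.inr ⟨fun S hS => htpos h8 S ?_, by linarith⟩
          rwa [mem_meeting, not_not] at hS)
    refine ⟨0, by simp, fun h => absurd h hJρ, ?_⟩
    refine IsScale.tendsto_powerIntegral_zero hτ ha hψ (meeting ρ J)
      (fun N S => Finset.sum_nonneg fun j _ => hv N j) (t := fun S => ∑ j ∈ S.1, t j)
      (fun N S hS => ?_) hU hc ?_ hR h1 h2 h3 h4 h5 h6 h7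
    · rw [mem_meeting, not_not] at hS
      exact hconst S hS N
    · filter_upwards [hbig] with N hN S hS
      rw [mem_meeting, Finset.not_disjoint_iff] at hS
      obtain ⟨j, hjS, hjJ⟩ := hS
      exact (hN j hjJ).trans (Finset.single_le_sum (fun i _ => hv N i) hjS)

/-- Homogeneity of degree -r in (T, R): dividing the data by N sends R to 0 and leaves a limit
problem with bounded data. -/
theorem powerIntegral_rescale {B : Type*} [Fintype B] (κ : B → ℝ) {T : B → ℝ} (hT : ∀ S, 0 ≤ T S)
    {R : ℝ} (hR : 0 ≤ R) {x : ℝ} (hx : 0 < x) :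
    ENNReal.ofReal (x ^ r) * powerIntegral τ a κ T R r =
      powerIntegral τ a κ (fun S => T S / x) (R / x) r := by
  have hm : ∀ κ, Measurable (slab τ a 0 κ) := measurable_slab τ a 0
  rw [powerIntegral, ← lintegral_const_mul _ (by fun_prop), powerIntegral]
  refine lintegral_congr fun g => ?_
  rw [mul_left_comm]
  refine prod_slab_mul_congr fun hg => ?_
  have h0 : 0 ≤ R + ∑ S, T S / (1 + g S) := add_nonneg hR (Finset.sum_nonneg fun S _ =>
    div_nonneg (hT S) (by linarith [hg S]))
  have h1 : R / x + ∑ S, T S / x / (1 + g S) = (R + ∑ S, T S / (1 + g S)) / x := by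
    rw [add_div, Finset.sum_div]
    congr 1
    exact Finset.sum_congr rfl fun S _ => by rw [div_right_comm]
  rw [h1, ← ENNReal.ofReal_mul (by positivity), Real.div_rpow h0 hx.le, Real.rpow_neg hx.le,
    div_inv_eq_mul, mul_comm]

/-- The case where the shrinkage factors stay bounded: the integral is of exact order
`N ^ (-r)`. -/
theorem tendsto_partition_of_lt (hτ : 1 ≤ τ) (ha : -1 < a) {J : Finset ι} (hJ : J.Nonempty)
    (hr : 0 < r) (hqr : r < a + 1 + (J.card : ℝ) / 2) {v : ℕ → ι → ℝ} (hv : ∀ N j, 0 ≤ v N j)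
    {s : ι → ℝ} (hs : ∀ j ∈ J, 0 < s j) (hs0 : ∀ j ∉ J, s j = 0)
    (hvs : ∀ j, Tendsto (fun N : ℕ => v N j / N) atTop (𝓝 (s j)))
    {R : ℝ} (hR : 0 ≤ R) (ρ : Finpartition (Finset.univ : Finset ι)) :
    ∃ L : ℝ≥0∞, L < ∞ ∧ 0 < L ∧ Tendsto (fun N : ℕ => ENNReal.ofReal ((N : ℝ) ^ r) *
        powerIntegral τ a (fun S : ρ.parts => (S.1.card : ℝ)) (fun S => ∑ j ∈ S.1, v N j) R r)
        atTop (𝓝 L) := by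
  have hm : ∀ κ, Measurable (slab τ a 0 κ) := measurable_slab τ a 0
  have hs' : ∀ j, 0 ≤ s j := fun j => by
    by_cases h : j ∈ J
    · exact (hs j h).le
    · rw [hs0 j h]
  set s' : ρ.parts → ℝ := fun S => ∑ j ∈ S.1, s j with hs'def
  have hs'0 : ∀ S, 0 ≤ s' S := fun S => Finset.sum_nonneg fun j _ => hs' j
  have hs'pos : ∀ S ∈ meeting ρ J, 0 < s' S := fun S hS => by
    rw [mem_meeting, Finset.not_disjoint_iff] at hS
    obtain ⟨j, hjS, hjJ⟩ := hS
    exact (hs j hjJ).trans_le (Finset.single_le_sum (fun i _ => hs' i) hjS)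
  have hcap : ∀ S : ρ.parts, 0 < a + 1 + (S.1.card : ℝ) / 2 := fun S => by
    have : (0 : ℝ) ≤ S.1.card := by positivity
    linarith
  obtain ⟨S₀, hS₀⟩ : ∃ S, 0 < s' S := by
    obtain ⟨j, hj⟩ := hJ
    obtain ⟨S, hS, -⟩ := exists_mem_meeting ρ hj
    exact ⟨S, hs'pos S hS⟩
  have hlimT : ∀ S : ρ.parts, Tendsto (fun N : ℕ => (∑ j ∈ S.1, v N j) / N) atTop (𝓝 (s' S)) :=
    fun S => by
      simp_rw [Finset.sum_div]
      exact tendsto_finsetSum _ fun j _ => hvs j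
  have hhalf : ∀ᶠ N : ℕ in atTop, ∀ S : ρ.parts, s' S / 2 ≤ (∑ j ∈ S.1, v N j) / N := by
    rw [eventually_all]
    intro S
    rcases (hs'0 S).eq_or_lt with h0 | h0
    · refine Eventually.of_forall fun N => ?_
      rw [← h0, zero_div]
      exact div_nonneg (Finset.sum_nonneg fun j _ => hv N j) (by positivity)
    · exact ((hlimT S).eventually (lt_mem_nhds (by linarith : s' S / 2 < s' S))).mono fun N h => h.le
  obtain ⟨θ, h1, h2, h3, h4⟩ := exists_exponents_of_lt_sum (meeting ρ J) hcap hr.le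
    (Or.inr (hqr.trans_le (cap_le_sum_meeting ha ρ hJ)))
  have hsumθ : 0 + ∑ S, θ S = r := by
    rw [zero_add, ← h4]
    exact (Finset.sum_subset (Finset.subset_univ _) fun S _ hS => h3 S hS).symm
  have hfin : ∀ w : ℝ, 0 < w →
      powerIntegral τ a (fun S : ρ.parts => (S.1.card : ℝ)) (fun S => s' S * w) 0 r < ∞ := by
    intro w hw
    have := powerIntegral_lt_top hτ ha (κ := fun S : ρ.parts => (S.1.card : ℝ))
      (T := fun S => s' S * w) le_rfl (fun S => mul_nonneg (hs'0 S) hw.le) le_rfl h1 h2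
      (fun _ => rfl) (fun S hS => h3 S fun hS' => by
        have := hs'pos S hS'
        have : 0 < s' S * w := by positivity
        linarith)
    rwa [hsumθ] at this
  refine ⟨powerIntegral τ a (fun S : ρ.parts => (S.1.card : ℝ)) s' 0 r, ?_,
    powerIntegral_pos hτ ha _ le_rfl hs'0 (Or.inr ⟨S₀, hS₀⟩), ?_⟩
  · simpa using hfin 1 one_pos
  have hRlim : Tendsto (fun N : ℕ => R / (N : ℝ)) atTop (𝓝 0) :=
    tendsto_const_nhds.div_atTop tendsto_natCast_atTop_atTop
  refine Tendsto.congr' (f₁ := fun N : ℕ => powerIntegral τ a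
    (fun S : ρ.parts => (S.1.card : ℝ)) (fun S => (∑ j ∈ S.1, v N j) / N) (R / N) r) ?_ ?_
  · filter_upwards [eventually_gt_atTop 0] with N hN
    rw [powerIntegral_rescale _ (fun S => Finset.sum_nonneg fun j _ => hv N j) hR
      (by exact_mod_cast hN)]
  · unfold powerIntegral
    -- The sums of squares are eventually at least half their limits, so the limit integrand at half
    -- these values dominates.
    refine tendsto_lintegral_filter_of_dominated_convergence (fun g : ρ.parts → ℝ =>
      (∏ S, slab τ a 0 (S.1.card : ℝ) (g S)) *
        ENNReal.ofReal ((0 + ∑ S, s' S * (1 / 2) / (1 + g S)) ^ (-r)))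
      (Eventually.of_forall fun N => by fun_prop) ?_ (hfin (1 / 2) (by norm_num)).ne
      (ae_of_all _ fun g => ?_)
    · filter_upwards [hhalf] with N hN
      refine ae_of_all _ fun g => prod_slab_mul_mono fun hg => ENNReal.ofReal_le_ofReal ?_
      refine Real.rpow_le_rpow_of_nonpos (shrunken_pos le_rfl
        (fun S => mul_nonneg (hs'0 S) (by norm_num))
        (Or.inr ⟨S₀, mul_pos hS₀ (by norm_num)⟩) hg) ?_ (by linarith)
      refine add_le_add (div_nonneg hR (by positivity)) (Finset.sum_le_sum fun S _ => ?_)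
      have : 0 < 1 + g S := by linarith [hg S]
      have := hN S
      gcongr
      linarith
    · by_cases hg : ∀ S, 0 < g S
      · refine ENNReal.Tendsto.const_mul (ENNReal.tendsto_ofReal (Tendsto.rpow_const
          (hRlim.add (tendsto_finsetSum _ fun S _ => (hlimT S).div_const _))
          (Or.inl (shrunken_pos le_rfl hs'0 (Or.inr ⟨S₀, hS₀⟩) hg).ne'))) (Or.inr ?_)
        exact (ENNReal.prod_lt_top fun S _ =>
          ENNReal.mul_lt_top ENNReal.ofReal_lt_top ENNReal.ofReal_lt_top).ne
      · push Not at hg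
        obtain ⟨S, hS⟩ := hg
        have h0 : ∏ S : ρ.parts, slab τ a 0 (S.1.card : ℝ) (g S) = 0 :=
          Finset.prod_eq_zero (Finset.mem_univ S) (slab_of_nonpos hS)
        simp only [h0, zero_mul]
        exact tendsto_const_nhds

end

/-! ### Back to the integrated likelihood -/

/-- The power formula for `ridge` is available only at positive arguments; the last condition
ensures this wherever the slab densities do not vanish. -/
theorem exists_blockIntegral_eq {n : ℕ} (hn : 2 ≤ n) (a : ℝ) :
    ∃ C : ℝ≥0∞, 0 < C ∧ C < ∞ ∧ ∀ {B : Type} [Fintype B] (κ T : B → ℝ) (R : ℝ), 0 ≤ R →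
      (∀ S, 0 ≤ T S) → (0 < R ∨ ∃ S, 0 < T S) →
        blockIntegral n n a 0 κ T R = C * powerIntegral n a κ T R (((n : ℝ) - 1) / 2) := by
  have hm : ∀ κ, Measurable (slab (n : ℝ) a 0 κ) := measurable_slab _ a 0
  obtain ⟨C, hC, h⟩ := exists_ridge_eq hn
  refine ⟨ENNReal.ofReal C, by simpa using hC, ENNReal.ofReal_lt_top, ?_⟩
  intro B _ κ T R hR hT hpos
  rw [powerIntegral, ← lintegral_const_mul _ (by fun_prop), blockIntegral]
  refine lintegral_congr fun g => ?_
  rw [mul_left_comm]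
  refine prod_slab_mul_congr fun hg => ?_
  rw [h _ (shrunken_pos hR hT hpos hg), neg_div]

end BlockG
end

noncomputable section
namespace BlockG

/-! ### Comparison of nested models -/

section
variable {ι₁ ι : Type} [Fintype ι₁] [DecidableEq ι₁] [Fintype ι] [DecidableEq ι]

/-- The extension of a partition along an embedding by one further block. -/
def extendPartition (f : ι₁ ↪ ι) (K : Finset ι) (hK : K.Nonempty)
    (hf : ∀ j, j ∈ K ↔ j ∉ Set.range f) (ρ : Finpartition (Finset.univ : Finset ι₁)) :
    Finpartition (Finset.univ : Finset ι) :=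
  Finpartition.ofExistsUnique (insert K (ρ.parts.map (Finset.mapEmbedding f).toEmbedding))
    (fun _ _ => Finset.subset_univ _)
    (by
      intro j _
      by_cases hj : j ∈ K
      · refine ⟨K, ⟨Finset.mem_insert_self _ _, hj⟩, ?_⟩
        rintro S ⟨hS, hjS⟩
        rcases Finset.mem_insert.1 hS with rfl | hS
        · rfl
        · obtain ⟨S', -, rfl⟩ := Finset.mem_map.1 hS
          obtain ⟨i, -, rfl⟩ := Finset.mem_map.1 hjS
          exact absurd ⟨i, rfl⟩ ((hf _).1 hj)
      · obtain ⟨i, rfl⟩ : j ∈ Set.range f := by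
          by_contra h
          exact hj ((hf j).2 h)
        obtain ⟨S, ⟨hS, hiS⟩, huniq⟩ := ρ.existsUnique_mem (Finset.mem_univ i)
        refine ⟨S.map f, ⟨Finset.mem_insert_of_mem (Finset.mem_map.2 ⟨S, hS, rfl⟩),
          Finset.mem_map_of_mem f hiS⟩, ?_⟩
        rintro S' ⟨hS', hjS'⟩
        rcases Finset.mem_insert.1 hS' with rfl | hS'
        · exact absurd hjS' hj
        · obtain ⟨S'', h1, rfl⟩ := Finset.mem_map.1 hS'
          have : i ∈ S'' := by simpa using hjS'
          rw [huniq S'' ⟨h1, this⟩]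
          rfl)
    (by
      intro h
      rcases Finset.mem_insert.1 h with h | h
      · exact hK.ne_empty h.symm
      · obtain ⟨S, hS, h⟩ := Finset.mem_map.1 h
        have : S = ∅ := by simpa using h
        exact (ρ.nonempty_of_mem_parts hS).ne_empty this)

theorem extendPartition_parts (f : ι₁ ↪ ι) (K : Finset ι) (hK : K.Nonempty)
    (hf : ∀ j, j ∈ K ↔ j ∉ Set.range f) (ρ : Finpartition (Finset.univ : Finset ι₁)) :
    (extendPartition f K hK hf ρ).parts =
      insert K (ρ.parts.map (Finset.mapEmbedding f).toEmbedding) := rfl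

theorem exists_equiv_extendPartition (f : ι₁ ↪ ι) (K : Finset ι) (hK : K.Nonempty)
    (hf : ∀ j, j ∈ K ↔ j ∉ Set.range f) (ρ : Finpartition (Finset.univ : Finset ι₁)) :
    ∃ e : Option ρ.parts ≃ (extendPartition f K hK hf ρ).parts,
      (e none).1 = K ∧ ∀ S : ρ.parts, (e (some S)).1 = S.1.map f := by
  have hne : ∀ S : ρ.parts, S.1.map f ≠ K := by
    intro S h
    obtain ⟨i, hi⟩ := ρ.nonempty_of_mem_parts S.2
    exact (hf (f i)).1 (h ▸ Finset.mem_map_of_mem f hi) ⟨i, rfl⟩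
  let g : Option ρ.parts → (extendPartition f K hK hf ρ).parts := fun o =>
    o.elim ⟨K, by rw [extendPartition_parts]; exact Finset.mem_insert_self _ _⟩
      fun S => ⟨S.1.map f, by
        rw [extendPartition_parts]
        exact Finset.mem_insert_of_mem (Finset.mem_map.2 ⟨S.1, S.2, rfl⟩)⟩
  have hg : Function.Bijective g := by
    constructor
    · intro o o' h
      cases o <;> cases o'
      · rfl
      · exact absurd (congrArg Subtype.val h).symm (hne _)
      · exact absurd (congrArg Subtype.val h) (hne _)
      · have h' := congrArg Subtype.val h
        exact congrArg some (Subtype.ext (Finset.map_injective f h'))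
    · rintro ⟨S, hS⟩
      rw [extendPartition_parts] at hS
      rcases Finset.mem_insert.1 hS with h | h
      · exact ⟨none, Subtype.ext h.symm⟩
      · obtain ⟨S', h1, h2⟩ := Finset.mem_map.1 h
        exact ⟨some ⟨S', h1⟩, Subtype.ext h2⟩
  exact ⟨Equiv.ofBijective g hg, rfl, fun _ => rfl⟩

theorem blockIntegral_equiv {B B' : Type*} [Fintype B] [Fintype B'] (n : ℕ) (τ2 a b : ℝ)
    (e : B ≃ B') (κ T : B' → ℝ) (R : ℝ) :
    blockIntegral n τ2 a b κ T R =
      blockIntegral n τ2 a b (fun S => κ (e S)) (fun S => T (e S)) R := by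
  rw [blockIntegral, lintegral_pi_equiv e, blockIntegral]
  refine lintegral_congr fun g => ?_
  rw [← Equiv.prod_comp e, ← Equiv.sum_comp e]
  simp

/-- Moving the sum of squares explained by one block to the residual decreases the integral. -/
theorem mul_blockIntegral_le_option {B : Type*} [Fintype B] (n : ℕ) (τ2 a b : ℝ)
    (κ T : Option B → ℝ) (hT : 0 ≤ T none) (R : ℝ) :
    (∫⁻ g, slab τ2 a b (κ none) g) *
        blockIntegral n τ2 a b (fun S => κ (some S)) (fun S => T (some S)) (R + T none) ≤
      blockIntegral n τ2 a b κ T R := by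
  have hm : ∀ κ, Measurable (slab τ2 a b κ) := measurable_slab τ2 a b
  have hr := measurable_ridge n
  rw [blockIntegral, ← lintegral_const_mul _ (by fun_prop), blockIntegral,
    lintegral_pi_option (by fun_prop)]
  refine lintegral_mono fun g => ?_
  rw [← lintegral_mul_const _ (by fun_prop)]
  refine lintegral_mono fun t => ?_
  simp only [Fintype.prod_option, Fintype.sum_option, Option.elim_none, Option.elim_some]
  rcases le_or_gt t 0 with ht | ht
  · rw [slab_of_nonpos ht]
    simp
  · rw [mul_assoc]
    refine mul_le_mul_right (mul_le_mul_right (ridge_anti n ?_) _) _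
    have : T none / (1 + t) ≤ T none := div_le_self hT (by linarith)
    linarith

/-- Each partition of the small model is compared with its extension by K. The constant depends only
on prior weights and the mass of the slab of K, so it is uniform in the data. -/
theorem exists_sum_blockIntegral_le [Nonempty ι₁] {n : ℕ} {τ a : ℝ} (hτ : 1 ≤ τ) (ha : -1 < a)
    (f : ι₁ ↪ ι) (K : Finset ι) (hK : K.Nonempty) (hf : ∀ j, j ∈ K ↔ j ∉ Set.range f) :
    ∃ C : ℝ≥0∞, C < ∞ ∧ ∀ (v : ι → ℝ) (R : ℝ), (∀ j, 0 ≤ v j) →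
      ∑ ρ : Finpartition (Finset.univ : Finset ι₁), partitionWeight ρ *
        blockIntegral n τ a 0 (fun S : ρ.parts => (S.1.card : ℝ))
          (fun S => ∑ j ∈ S.1, v (f j)) (R + ∑ j ∈ K, v j) ≤
      C * ∑ ρ : Finpartition (Finset.univ : Finset ι), partitionWeight ρ *
        blockIntegral n τ a 0 (fun S : ρ.parts => (S.1.card : ℝ))
          (fun S => ∑ j ∈ S.1, v j) R := by
  have : Nonempty ι := ⟨hK.choose⟩
  set m := ∫⁻ g, slab τ a 0 (K.card : ℝ) g with hmdef
  have hm0 : m ≠ 0 := by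
    refine (lt_of_lt_of_le (lintegral_pos_of_pos_on_Ioi
      (measurable_slab τ a 0 _).aemeasurable fun x hx => slab_pos hτ ha _ hx)
      (setLIntegral_le_lintegral _ _)).ne'
  have hmtop : m ≠ ∞ := (lintegral_slab_lt_top hτ ha (by positivity)).ne
  refine ⟨∑ ρ : Finpartition (Finset.univ : Finset ι₁), partitionWeight ρ *
    (partitionWeight (extendPartition f K hK hf ρ) * m)⁻¹, ?_, fun v R hv => ?_⟩
  · refine ENNReal.sum_lt_top.2 fun ρ _ => ENNReal.mul_lt_top (partitionWeight_lt_top ρ) ?_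
    exact ENNReal.inv_lt_top.2 (ENNReal.mul_pos (partitionWeight_pos _).ne' hm0)
  · rw [Finset.sum_mul]
    refine Finset.sum_le_sum fun ρ _ => ?_
    set ρ' := extendPartition f K hK hf ρ with hρ'
    obtain ⟨e, he1, he2⟩ := exists_equiv_extendPartition f K hK hf ρ
    have h1 := mul_blockIntegral_le_option n τ a 0 (fun o => ((e o).1.card : ℝ))
      (fun o => ∑ j ∈ (e o).1, v j) (Finset.sum_nonneg fun j _ => hv j) R
    rw [← blockIntegral_equiv n τ a 0 e (fun S => (S.1.card : ℝ)) (fun S => ∑ j ∈ S.1, v j)] at h1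
    simp only [he1, he2, Finset.card_map, Finset.sum_map] at h1
    have hw0 := (partitionWeight_pos ρ').ne'
    have hwtop := (partitionWeight_lt_top ρ').ne
    rw [mul_assoc]
    refine mul_le_mul_right ?_ _
    rw [← ENNReal.mul_le_iff_le_inv (mul_ne_zero hw0 hm0) (ENNReal.mul_ne_top hwtop hmtop),
      mul_assoc]
    refine (mul_le_mul_right h1 _).trans ?_
    exact Finset.single_le_sum (f := fun ρ => partitionWeight ρ *
        blockIntegral n τ a 0 (fun S : ρ.parts => (S.1.card : ℝ))
          (fun S => ∑ j ∈ S.1, v j) R) (fun _ _ => zero_le) (Finset.mem_univ ρ')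

end

end BlockG
end

noncomputable section
namespace BlockG

/-! ### Asymptotics of the marginal likelihood of one model -/

section
variable {ι : Type} [Fintype ι] [DecidableEq ι] {a : ℝ} {n : ℕ}

/-- The marginal likelihood as a function of the explained sums of squares `v` and the
residual sum of squares `R`. -/
def mixture (ι : Type) [Fintype ι] [DecidableEq ι] (n : ℕ) (a : ℝ) (v : ι → ℝ) (R : ℝ) : ℝ≥0∞ :=
  ∑ ρ : Finpartition (Finset.univ : Finset ι), partitionWeight ρ *
    blockIntegral n n a 0 (fun S : ρ.parts => (S.1.card : ℝ)) (fun S => ∑ j ∈ S.1, v j) R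

/-- The sum over partitions is finite with positive finite weights, so one partition of exact order
suffices for a positive limit; `P` marks such partitions. -/
theorem tendsto_mixture (hn : 2 ≤ n) {v : ℕ → ι → ℝ} (hv : ∀ N j, 0 ≤ v N j)
    {R : ℝ} (hR : 0 ≤ R) (hpos : ∀ᶠ N in atTop, 0 < R ∨ ∃ j, 0 < v N j) {φ : ℕ → ℝ≥0∞}
    (P : Finpartition (Finset.univ : Finset ι) → Prop) (hP : ∃ ρ, P ρ)
    (h : ∀ ρ : Finpartition (Finset.univ : Finset ι), ∃ L : ℝ≥0∞, L < ∞ ∧ (P ρ → 0 < L) ∧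
      Tendsto (fun N => φ N * powerIntegral n a (fun S : ρ.parts => (S.1.card : ℝ))
        (fun S => ∑ j ∈ S.1, v N j) R (((n : ℝ) - 1) / 2)) atTop (𝓝 L)) [Nonempty ι] :
    ∃ L : ℝ≥0∞, 0 < L ∧ L < ∞ ∧ Tendsto (fun N => φ N * mixture ι n a (v N) R) atTop (𝓝 L) := by
  obtain ⟨C, hC0, hC, hCeq⟩ := exists_blockIntegral_eq hn a
  choose L hL hLpos hlim using h
  obtain ⟨ρ₀, hρ₀⟩ := hP
  refine ⟨∑ ρ, partitionWeight ρ * C * L ρ, ?_, ?_, ?_⟩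
  · refine lt_of_lt_of_le ?_ (Finset.single_le_sum (f := fun ρ => partitionWeight ρ * C * L ρ)
      (fun _ _ => zero_le) (Finset.mem_univ ρ₀))
    exact ENNReal.mul_pos (mul_ne_zero (partitionWeight_pos ρ₀).ne' hC0.ne') (hLpos _ hρ₀).ne'
  · exact ENNReal.sum_lt_top.2 fun ρ _ =>
      ENNReal.mul_lt_top (ENNReal.mul_lt_top (partitionWeight_lt_top ρ) hC) (hL ρ)
  · refine Tendsto.congr' (f₁ := fun N => ∑ ρ : Finpartition (Finset.univ : Finset ι),
      partitionWeight ρ * C * (φ N * powerIntegral n a (fun S : ρ.parts => (S.1.card : ℝ))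
        (fun S => ∑ j ∈ S.1, v N j) R (((n : ℝ) - 1) / 2))) ?_ ?_
    · filter_upwards [hpos] with N hN
      rw [mixture, Finset.mul_sum]
      refine Finset.sum_congr rfl fun ρ _ => ?_
      rw [hCeq _ _ R hR (fun S => Finset.sum_nonneg fun j _ => hv N j)]
      · ring
      · rcases hN with h | ⟨j, hj⟩
        · exact Or.inl h
        · exact Or.inr ⟨blockOf ρ j, hj.trans_le (Finset.single_le_sum (fun i _ => hv N i)
            (ρ.mem_part_self.2 (Finset.mem_univ j)))⟩
    · exact tendsto_finsetSum _ fun ρ _ => ENNReal.Tendsto.const_mul (hlim ρ)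
        (Or.inr (ENNReal.mul_lt_top (partitionWeight_lt_top ρ) hC).ne)

theorem exists_partition_mem {J : Finset ι} (hJ : J.Nonempty) :
    ∃ ρ : Finpartition (Finset.univ : Finset ι), J ∈ ρ.parts := by
  by_cases h : Jᶜ = ∅
  · have h' : J = Finset.univ := by simpa using h
    refine ⟨Finpartition.indiscrete (h' ▸ hJ.ne_empty), ?_⟩
    simp [Finpartition.indiscrete, h']
  · refine ⟨(Finpartition.indiscrete hJ.ne_empty).extend h disjoint_compl_right
      (by rw [sup_compl_eq_top]; rfl), ?_⟩
    simp [Finpartition.extend, Finpartition.indiscrete]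

theorem IsScale.tendsto_mixture (hn : 2 ≤ n) (ha : -1 < a) {J : Finset ι} (hJ : J.Nonempty)
    {ψ : ℝ → ℝ} {l : ℝ → ℝ≥0∞} (hψ : IsScale n a J.card (((n : ℝ) - 1) / 2) ψ l)
    (hqr : a + 1 + (J.card : ℝ) / 2 ≤ ((n : ℝ) - 1) / 2) {v : ℕ → ι → ℝ} (hv : ∀ N j, 0 ≤ v N j)
    {t : ι → ℝ} (hvt : ∀ N, ∀ j ∉ J, v N j = t j) {U : ℕ → ℝ} (hUv : ∀ N, ∑ j ∈ J, v N j = U N)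
    (hU : Tendsto U atTop atTop)
    {c : ℝ} (hc : 0 < c) (hbig : ∀ᶠ N in atTop, ∀ j ∈ J, c * U N ≤ v N j)
    {R : ℝ} (hR : 0 ≤ R)
    (h : 0 < R ∨ (∀ j ∉ J, 0 < t j) ∧ ((n : ℝ) - 1) / 2 ≤ (Fintype.card ι : ℝ) / 2) :
    ∃ L : ℝ≥0∞, 0 < L ∧ L < ∞ ∧
      Tendsto (fun N => ENNReal.ofReal (ψ (U N)) * mixture ι n a (v N) R) atTop (𝓝 L) := by
  have : Nonempty ι := ⟨hJ.choose⟩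
  have hτ : (1 : ℝ) ≤ n := by exact_mod_cast (by omega : 1 ≤ n)
  obtain rfl : (fun N => ∑ j ∈ J, v N j) = U := funext hUv
  refine BlockG.tendsto_mixture hn hv hR ?_ (fun ρ => J ∈ ρ.parts) (exists_partition_mem hJ)
    fun ρ => hψ.tendsto_partition hτ ha hJ hqr hv hvt hU hc hbig hR h ρ
  filter_upwards [hbig, hU.eventually_gt_atTop 0] with N hN hN0
  obtain ⟨j, hj⟩ := hJ
  exact Or.inr ⟨j, (mul_pos hc hN0).trans_le (hN j hj)⟩

theorem tendsto_mixture_of_lt (hn : 2 ≤ n) (ha : -1 < a) {J : Finset ι} (hJ : J.Nonempty)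
    (hqr : ((n : ℝ) - 1) / 2 < a + 1 + (J.card : ℝ) / 2) {v : ℕ → ι → ℝ}
    (hv : ∀ N j, 0 ≤ v N j) {s : ι → ℝ} (hs : ∀ j ∈ J, 0 < s j) (hs0 : ∀ j ∉ J, s j = 0)
    (hvs : ∀ j, Tendsto (fun N : ℕ => v N j / N) atTop (𝓝 (s j))) {R : ℝ} (hR : 0 ≤ R) :
    ∃ L : ℝ≥0∞, 0 < L ∧ L < ∞ ∧ Tendsto (fun N : ℕ =>
      ENNReal.ofReal ((N : ℝ) ^ (((n : ℝ) - 1) / 2)) * mixture ι n a (v N) R) atTop (𝓝 L) := by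
  have : Nonempty ι := ⟨hJ.choose⟩
  have hn' : (2 : ℝ) ≤ n := by exact_mod_cast hn
  have hτ : (1 : ℝ) ≤ n := by linarith
  obtain ⟨j, hj⟩ := id hJ
  refine BlockG.tendsto_mixture hn hv hR ?_ (fun _ => True) (exists_partition_mem hJ |>.imp
    fun _ _ => trivial) fun ρ => ?_
  · filter_upwards [(hvs j).eventually (lt_mem_nhds (hs j hj))] with N hN
    refine Or.inr ⟨j, lt_of_not_ge fun h => ?_⟩
    exact absurd hN (not_lt.2 (div_nonpos_of_nonpos_of_nonneg h (by positivity)))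
  · obtain ⟨L, h1, h2, h3⟩ := tendsto_partition_of_lt hτ ha hJ (by linarith) hqr hv hs hs0 hvs hR ρ
    exact ⟨L, h1, fun _ => h2, h3⟩

theorem blockIntegral_lt_top {B : Type} [Fintype B] (hn : 2 ≤ n) (ha : -1 < a) {κ T : B → ℝ}
    (hκ : ∀ S, 0 ≤ κ S) (hT : ∀ S, 0 ≤ T S) {R : ℝ} (hR : 0 < R) :
    blockIntegral n n a 0 κ T R < ∞ := by
  have hn' : (2 : ℝ) ≤ n := by exact_mod_cast hn
  have hτ : (1 : ℝ) ≤ n := by linarith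
  obtain ⟨C, -, hC, hCeq⟩ := exists_blockIntegral_eq hn a
  rw [hCeq κ T R hR.le hT (Or.inl hR)]
  refine ENNReal.mul_lt_top hC ?_
  have := powerIntegral_lt_top hτ ha hR.le hT (θ₀ := ((n : ℝ) - 1) / 2) (by linarith)
    (θ := fun _ => 0) (κ := κ) (fun _ => le_rfl) (fun S => by have := hκ S; linarith)
    (fun h => by linarith) fun _ _ => rfl
  simpa using this

theorem blockIntegral_pos {B : Type} [Fintype B] (hn : 2 ≤ n) (ha : -1 < a) (κ : B → ℝ) {T : B → ℝ}
    (hT : ∀ S, 0 ≤ T S) {R : ℝ} (hR : 0 < R) : 0 < blockIntegral n n a 0 κ T R := by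
  have hτ : (1 : ℝ) ≤ n := by exact_mod_cast (by omega : 1 ≤ n)
  obtain ⟨C, hC0, -, hCeq⟩ := exists_blockIntegral_eq hn a
  rw [hCeq κ T R hR.le hT (Or.inl hR)]
  exact ENNReal.mul_pos hC0.ne' (powerIntegral_pos hτ ha κ hR.le hT (Or.inl hR)).ne'

theorem mixture_pos [Nonempty ι] (hn : 2 ≤ n) (ha : -1 < a) {v : ι → ℝ} (hv : ∀ j, 0 ≤ v j)
    {R : ℝ} (hR : 0 < R) : 0 < mixture ι n a v R := by
  obtain ⟨ρ, -⟩ := exists_partition_mem (Finset.univ_nonempty (α := ι))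
  refine lt_of_lt_of_le ?_ (Finset.single_le_sum (fun _ _ => zero_le) (Finset.mem_univ ρ))
  exact ENNReal.mul_pos (partitionWeight_pos ρ).ne'
    (blockIntegral_pos hn ha _ (fun S => Finset.sum_nonneg fun j _ => hv j) hR).ne'

theorem mixture_lt_top [Nonempty ι] (hn : 2 ≤ n) (ha : -1 < a) {v : ι → ℝ} (hv : ∀ j, 0 ≤ v j)
    {R : ℝ} (hR : 0 < R) : mixture ι n a v R < ∞ :=
  ENNReal.sum_lt_top.2 fun ρ _ => ENNReal.mul_lt_top (partitionWeight_lt_top ρ)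
    (blockIntegral_lt_top hn ha (fun _ => by positivity)
      (fun S => Finset.sum_nonneg fun j _ => hv j) hR)

end

/-! ### Growth of the explained sums of squares -/

theorem exists_growth_bounds {x : ℕ → ℝ} (hx : (fun N => x N ^ 2) =Θ[atTop] fun N : ℕ => (N : ℝ))
    (e : ℝ) {d : ℝ} (hd : 0 < d) :
    ∃ c C : ℝ, 0 < c ∧ 0 < C ∧ ∀ᶠ N : ℕ in atTop,
      c * N ≤ d * (x N + e) ^ 2 ∧ d * (x N + e) ^ 2 ≤ C * N := by
  obtain ⟨C, hC, hC'⟩ := hx.1.exists_pos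
  obtain ⟨c, hc, hc'⟩ := hx.2.exists_pos
  -- From x² ≤ 2(x+e)² + 2e² and (x+e)² ≤ 2x² + 2e²; the terms in e² are absorbed once N exceeds e²
  -- and 4ce².
  refine ⟨d * (1 / (4 * c)), d * (2 * C + 2), by positivity, by positivity, ?_⟩
  have hlarge := tendsto_natCast_atTop_atTop.eventually_ge_atTop (max (e ^ 2) (4 * c * e ^ 2) : ℝ)
  filter_upwards [hC'.bound, hc'.bound, hlarge] with N h1 h2 h3
  simp only [Real.norm_of_nonneg (sq_nonneg _), Real.norm_natCast] at h1 h2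
  have h4 := (le_max_left _ _).trans h3
  have h5 := (le_max_right _ _).trans h3
  constructor
  · rw [mul_assoc]
    refine mul_le_mul_of_nonneg_left ?_ hd.le
    rw [div_mul_eq_mul_div, one_mul, div_le_iff₀ (by positivity)]
    nlinarith [sq_nonneg (x N + 2 * e), mul_nonneg hc.le (sq_nonneg (x N + 2 * e))]
  · rw [mul_assoc]
    refine mul_le_mul_of_nonneg_left ?_ hd.le
    nlinarith [sq_nonneg (x N - e)]

theorem tendsto_growth {x : ℕ → ℝ} {c : ℝ}
    (hx : Tendsto (fun N : ℕ => x N ^ 2 / (N : ℝ)) atTop (𝓝 c)) (e d : ℝ) :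
    Tendsto (fun N : ℕ => d * (x N + e) ^ 2 / (N : ℝ)) atTop (𝓝 (d * c)) := by
  have hinv : Tendsto (fun N : ℕ => ((N : ℝ))⁻¹) atTop (𝓝 0) :=
    tendsto_inv_atTop_zero.comp tendsto_natCast_atTop_atTop
  have h0 : Tendsto (fun N : ℕ => x N / (N : ℝ)) atTop (𝓝 0) := by
    have h1 := (hx.mul hinv).sqrt
    rw [mul_zero, Real.sqrt_zero] at h1
    rw [tendsto_zero_iff_abs_tendsto_zero]
    refine h1.congr fun N => ?_
    rw [Function.comp_apply, ← Real.sqrt_sq_eq_abs]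
    congr 1
    rw [div_pow, div_eq_mul_inv, div_eq_mul_inv, sq (N : ℝ), mul_inv, mul_assoc]
  have h2 := ((hx.add (h0.const_mul (2 * e))).add (hinv.const_mul (e ^ 2))).const_mul d
  simp only [mul_zero, add_zero] at h2
  refine h2.congr fun N => ?_
  rw [div_eq_mul_inv, div_eq_mul_inv, div_eq_mul_inv]
  ring

/-! ### The design matrices -/

section
variable {n p : ℕ} {X : Matrix (Fin n) (Fin p) ℝ}

/-- The rank of X is that of its diagonal Gram matrix, which counts the nonzero columns. -/
theorem isOrthoDesign_of_rank (hp : 0 < p) (hrank : X.rank = p) (hcentered : ∀ j, ∑ i, X i j = 0)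
    (horth : (Xᵀ * X).IsDiag) : IsOrthoDesign X := by
  have hdiag : Xᵀ * X = Matrix.diagonal (colSq X) := by
    ext j k
    by_cases h : j = k
    · subst h
      simp only [Matrix.mul_apply, Matrix.transpose_apply, Matrix.diagonal_apply_eq]
      exact Finset.sum_congr rfl fun i _ => by ring
    · rw [Matrix.diagonal_apply_ne _ h]
      exact horth h
  have hne : ∀ j, colSq X j ≠ 0 := by
    have h1 := Matrix.rank_transpose_mul_self X
    rw [hdiag, Matrix.rank_diagonal, hrank] at h1
    intro j hj
    have h2 : Fintype.card {i // colSq X i ≠ 0} < Fintype.card (Fin p) :=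
      Fintype.card_subtype_lt (x := j) (by simpa using hj)
    rw [h1, Fintype.card_fin] at h2
    exact lt_irrefl _ h2
  have hpos : ∀ j, 0 < colSq X j := fun j =>
    lt_of_le_of_ne (Finset.sum_nonneg fun _ _ => sq_nonneg _) (hne j).symm
  refine ⟨hcentered, fun j k hjk => ?_, hpos, ?_⟩
  · have := horth hjk
    simpa [Matrix.mul_apply] using this
  · rcases Nat.eq_zero_or_pos n with rfl | h
    · exact absurd (by simp [colSq]) (hne ⟨0, hp⟩)
    · exact h

theorem IsOrthoDesign.cols (hX : IsOrthoDesign X) (γ : Finset (Fin p)) :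
    IsOrthoDesign (BlockG.cols X γ) :=
  ⟨fun j => hX.centered j.1, fun j k h => hX.orth j.1 k.1 fun h' => h (Subtype.ext h'),
    fun j => hX.colSq_pos j.1, hX.size_pos⟩

theorem cols_mulVec (X : Matrix (Fin n) (Fin p) ℝ) (γ : Finset (Fin p)) (β : {j // j ∈ γ} → ℝ) :
    BlockG.cols X γ *ᵥ β = X *ᵥ fun j => if h : j ∈ γ then β ⟨j, h⟩ else 0 := by
  funext i
  simp only [Matrix.mulVec, dotProduct, BlockG.cols, Matrix.submatrix_apply, id]
  rw [← Finset.sum_subset (Finset.subset_univ γ) (fun j _ hj => by simp [hj]),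
    ← Finset.sum_coe_sort γ]
  exact Finset.sum_congr rfl fun j _ => by simp

theorem FitsExactly.of_cols {γ : Finset (Fin p)} {v : Fin n → ℝ}
    (h : FitsExactly (BlockG.cols X γ) v) : FitsExactly X v := by
  obtain ⟨c, β, rfl⟩ := h
  exact ⟨c, _, by rw [cols_mulVec]⟩

theorem FitsExactly.sub {u v : Fin n → ℝ} (hu : FitsExactly X u) (hv : FitsExactly X v) :
    FitsExactly X (u - v) := by
  obtain ⟨c, β, rfl⟩ := hu
  obtain ⟨c', β', rfl⟩ := hv
  refine ⟨c - c', β - β', ?_⟩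
  rw [Matrix.mulVec_sub]
  funext i
  simp only [Pi.add_apply, Pi.sub_apply]
  ring

/-- The map (c, β) ↦ 1c + Xβ is injective on a space of dimension p+1 and misses v. -/
theorem IsOrthoDesign.card_add_two_le (hX : IsOrthoDesign X) {v : Fin n → ℝ}
    (hv : ¬ FitsExactly X v) : p + 2 ≤ n := by
  let Φ : (ℝ × (Fin p → ℝ)) →ₗ[ℝ] (Fin n → ℝ) :=
    (LinearMap.toSpanSingleton ℝ (Fin n → ℝ) fun _ => 1).coprod X.mulVecLin
  have hΦ : ∀ c β, Φ (c, β) = (fun _ => c) + X *ᵥ β := fun c β => by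
    funext i
    simp [Φ]
  have hinj : Function.Injective Φ := by
    rw [← LinearMap.ker_eq_bot, LinearMap.ker_eq_bot']
    rintro ⟨c, β⟩ h
    rw [hΦ] at h
    have hn : (n : ℝ) ≠ 0 := by have := hX.size_pos; positivity
    have h1 := hX.mean_add c β 0
    have h2 : ∀ j, lsCoef X ((fun _ => c) + X *ᵥ β + 0) j = _ := hX.lsCoef_add c β 0
    rw [h] at h1 h2
    simp only [mean, lsCoef, add_zero, Pi.zero_apply, Finset.sum_const_zero, zero_div,
      mul_zero] at h1 h2
    ext j
    · exact h1.symm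
    · exact (h2 j).symm
  have hfin : Module.finrank ℝ (ℝ × (Fin p → ℝ)) = p + 1 := by simp [add_comm]
  have hle := LinearMap.finrank_le_finrank_of_injective hinj
  rw [hfin, Module.finrank_fin_fun] at hle
  by_contra hlt
  have heq : Module.finrank ℝ (ℝ × (Fin p → ℝ)) = Module.finrank ℝ (Fin n → ℝ) := by
    rw [hfin, Module.finrank_fin_fun]
    omega
  obtain ⟨⟨c, β⟩, h⟩ := (LinearMap.injective_iff_surjective_of_finrank_eq_finrank heq).1 hinj v
  exact hv ⟨c, β, by rw [← hΦ, h]⟩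

end

end BlockG
end

/-! ### Common growth scale and the limit of the Bayes factor -/

namespace BlockG

theorem exists_uniform_growth {κ : Type} [Fintype κ] [Nonempty κ] {v : ℕ → κ → ℝ}
    (h : ∀ j, ∃ c C : ℝ, 0 < c ∧ 0 < C ∧ ∀ᶠ N : ℕ in atTop, c * N ≤ v N j ∧ v N j ≤ C * N) :
    Tendsto (fun N => ∑ j, v N j) atTop atTop ∧
      ∃ c : ℝ, 0 < c ∧ ∀ᶠ N in atTop, ∀ j, c * ∑ i, v N i ≤ v N j := by
  choose c C hc hC hcC using h
  have hall : ∀ᶠ N : ℕ in atTop, ∀ j, c j * N ≤ v N j ∧ v N j ≤ C j * N := eventually_all.2 hcC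
  obtain ⟨j₀, hj₀⟩ := Finite.exists_min c
  have hCsum : 0 < ∑ j, C j := Finset.sum_pos (fun j _ => hC j) Finset.univ_nonempty
  constructor
  · refine tendsto_atTop_mono' _ ?_ (tendsto_natCast_atTop_atTop.const_mul_atTop (hc j₀))
    filter_upwards [hall] with N hN
    refine (hN j₀).1.trans (Finset.single_le_sum (f := fun j => v N j) (fun j _ => ?_)
      (Finset.mem_univ j₀))
    exact (mul_nonneg (hc j).le (by positivity)).trans (hN j).1
  · refine ⟨c j₀ / ∑ j, C j, div_pos (hc j₀) hCsum, ?_⟩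
    filter_upwards [hall] with N hN j
    have h1 : ∑ i, v N i ≤ (∑ i, C i) * N := by
      rw [Finset.sum_mul]
      exact Finset.sum_le_sum fun i _ => (hN i).2
    calc c j₀ / (∑ j, C j) * ∑ i, v N i ≤ c j₀ / (∑ j, C j) * ((∑ i, C i) * N) :=
          mul_le_mul_of_nonneg_left h1 (div_pos (hc j₀) hCsum).le
      _ = c j₀ * N := by field_simp
      _ ≤ c j * N := mul_le_mul_of_nonneg_right (hj₀ j) (by positivity)
      _ ≤ v N j := (hN j).1

theorem exists_tendsto_div {F G φ : ℕ → ℝ≥0∞} (hφ : ∀ᶠ N in atTop, φ N ≠ 0 ∧ φ N ≠ ∞)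
    (hF : ∃ L : ℝ≥0∞, 0 < L ∧ L < ∞ ∧ Tendsto (fun N => φ N * F N) atTop (𝓝 L))
    (hG : ∃ L : ℝ≥0∞, 0 < L ∧ L < ∞ ∧ Tendsto (fun N => φ N * G N) atTop (𝓝 L)) :
    (∀ᶠ N in atTop, F N < ∞) ∧
      ∃ L : ℝ≥0∞, 0 < L ∧ L < ∞ ∧ Tendsto (fun N => F N / G N) atTop (𝓝 L) := by
  obtain ⟨L, hL0, hL, hFL⟩ := hF
  obtain ⟨L', hL0', hL', hGL⟩ := hG
  constructor
  · filter_upwards [hφ, hFL.eventually (gt_mem_nhds hL)] with N hN h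
    by_contra htop
    rw [not_lt, top_le_iff] at htop
    rw [htop, ENNReal.mul_top hN.1] at h
    exact lt_irrefl _ h
  · refine ⟨L / L', ENNReal.div_pos hL0.ne' hL'.ne, ENNReal.div_lt_top hL.ne hL0'.ne', ?_⟩
    refine (ENNReal.Tendsto.div hFL (Or.inr hL0'.ne') hGL (Or.inr hL.ne)).congr' ?_
    filter_upwards [hφ] with N hN
    exact ENNReal.mul_div_mul_left _ _ hN.1 hN.2

end BlockG

theorem mainTheorem4
    {n p : ℕ} (X : Matrix (Fin n) (Fin p) ℝ)
    (hrank : X.rank = p)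
    (hcentered : ∀ j, ∑ i, X i j = 0)
    (horth : (Xᵀ * X).IsDiag)
    (I₁ I₂ : Finset (Fin p))
    (hI₁ : I₁.Nonempty) (hI₂ : I₂.Nonempty)
    (hdisj : Disjoint I₁ I₂) (hunion : I₁ ∪ I₂ = Finset.univ)
    (a : ℝ) (ha : -1 / 2 ≤ a) (ha' : a ≤ 0)
    (β₀ : ℝ) (β₂ : {j // j ∈ I₂} → ℝ) (ε : Fin n → ℝ)
    (β₁ : ℕ → {j // j ∈ I₁} → ℝ)
    (hβ₁ : ∀ j, (fun N : ℕ => β₁ N j ^ 2) =Θ[atTop] (fun N : ℕ => (N : ℝ)))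
    (y : ℕ → Fin n → ℝ)
    (hy : ∀ N, y N = (fun _ => β₀) + BlockG.cols X I₁ *ᵥ β₁ N + BlockG.cols X I₂ *ᵥ β₂ + ε)
    (hfit : ¬ BlockG.FitsExactly (BlockG.cols X I₁) (BlockG.cols X I₂ *ᵥ β₂ + ε)) :
    (∀ N, 0 < BlockG.marginalLikelihood (n : ℝ) a 0 (BlockG.cols X I₁) (y N) ∧
      BlockG.marginalLikelihood (n : ℝ) a 0 (BlockG.cols X I₁) (y N) < ∞) ∧
    0 < liminf (fun N => BlockG.bayesFactor (n : ℝ) a 0 X (I₁ ∪ I₂) I₁ (y N)) atTop ∧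
    ((¬ BlockG.FitsExactly X ε ∨
        (n = p + 1 ∧
          (∀ j ∈ I₂, ∑ i, X i j * (BlockG.cols X I₂ *ᵥ β₂ + ε) i ≠ 0) ∧
          (∀ j, ∃ c : ℝ, Tendsto (fun N : ℕ => β₁ N j ^ 2 / (N : ℝ)) atTop (𝓝 c)))) →
      (∀ᶠ N in atTop, BlockG.marginalLikelihood (n : ℝ) a 0 (BlockG.cols X (I₁ ∪ I₂)) (y N) < ∞) ∧
      ∃ L : ℝ≥0∞, 0 < L ∧ L < ∞ ∧
        Tendsto (fun N => BlockG.bayesFactor (n : ℝ) a 0 X (I₁ ∪ I₂) I₁ (y N)) atTop (𝓝 L)) := by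
  classical
  have hI₁p : I₁.card + I₂.card = p := by
    rw [← Finset.card_union_of_disjoint hdisj, hunion, Finset.card_univ, Fintype.card_fin]
  have hc₁ := hI₁.card_pos
  have hc₂ := hI₂.card_pos
  have ha1 : -1 < a := by linarith
  have hX := BlockG.isOrthoDesign_of_rank (by omega) hrank hcentered horth
  have hn2 : 2 ≤ n := by
    have := X.rank_le_height
    omega
  have hτ : (1 : ℝ) ≤ n := by exact_mod_cast (by omega : 1 ≤ n)
  have hXa := hX.cols (I₁ ∪ I₂)
  have hX1 := hX.cols I₁
  have : Nonempty {j // j ∈ I₁} := hI₁.to_subtype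
  have : Nonempty {j // j ∈ I₁ ∪ I₂} := (hI₁.mono Finset.subset_union_left).to_subtype
  set u : Fin n → ℝ := BlockG.cols X I₂ *ᵥ β₂ + ε with hu
  set v : ℕ → Fin p → ℝ := fun N j => BlockG.fitSq X (y N) j with hvdef
  have hv : ∀ N j, 0 ≤ v N j := fun N j => BlockG.fitSq_nonneg X (y N) j
  set t : Fin p → ℝ := fun j => BlockG.colSq X j * BlockG.lsCoef X u j ^ 2 with htdef
  have hy1 : ∀ N, y N = (fun _ => β₀) + BlockG.cols X I₁ *ᵥ β₁ N + u := fun N => by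
    rw [hy, hu]; simp only [add_assoc]
  have hls : ∀ N j, BlockG.lsCoef X (y N) j =
      (if h : j ∈ I₁ then β₁ N ⟨j, h⟩ else 0) + BlockG.lsCoef X u j := fun N j => by
    rw [hy1, BlockG.cols_mulVec, hX.lsCoef_add]
  have hv1 : ∀ N (j : {j // j ∈ I₁}),
      v N j = BlockG.colSq X j * (β₁ N j + BlockG.lsCoef X u j) ^ 2 := fun N j => by
    simp only [hvdef, BlockG.fitSq]
    rw [hls, dif_pos j.2]
  have hv2 : ∀ N, ∀ j ∉ I₁, v N j = t j := fun N j hj => by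
    simp only [hvdef, BlockG.fitSq, htdef]
    rw [hls, dif_neg hj, zero_add]
  set R₀ := BlockG.rss (BlockG.cols X I₁) u with hR₀
  have hR₀pos : 0 < R₀ := hX1.rss_pos hfit
  have hrss1 : ∀ N, BlockG.rss (BlockG.cols X I₁) (y N) = R₀ := fun N => by
    rw [hy1, hX1.rss_add]
  -- By orthogonality the large model removes exactly the sums of squares of the columns in I₂, and
  -- these do not depend on N.
  have hrssa : ∀ N, BlockG.rss (BlockG.cols X (I₁ ∪ I₂)) (y N) = R₀ - ∑ j ∈ I₂, t j := fun N => by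
    have e1 : ∑ j : {j // j ∈ I₁ ∪ I₂}, BlockG.fitSq (BlockG.cols X (I₁ ∪ I₂)) (y N) j =
        ∑ j ∈ I₁, v N j + ∑ j ∈ I₂, v N j := by
      rw [← Finset.sum_union hdisj, ← Finset.sum_coe_sort (I₁ ∪ I₂)]
      rfl
    have e2 : ∑ j : {j // j ∈ I₁}, BlockG.fitSq (BlockG.cols X I₁) (y N) j =
        ∑ j ∈ I₁, v N j := by
      rw [← Finset.sum_coe_sort I₁]
      rfl
    have e3 : ∑ j ∈ I₂, v N j = ∑ j ∈ I₂, t j := Finset.sum_congr rfl fun j hj =>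
      hv2 N j (Finset.disjoint_right.1 hdisj hj)
    rw [← hrss1 N, BlockG.rss, BlockG.rss, e1, e2, e3]
    ring
  set Ra := R₀ - ∑ j ∈ I₂, t j with hRa
  have hRa0 : 0 ≤ Ra := by rw [← hrssa 0]; exact hXa.rss_nonneg _
  have hf := fun g => BlockG.shrinkagePDF_nonneg hτ ha1 g
  have hm1 : ∀ N, BlockG.marginalLikelihood (n : ℝ) a 0 (BlockG.cols X I₁) (y N) =
      BlockG.mixture {j // j ∈ I₁} n a (fun j => v N j) R₀ := fun N => by
    rw [hX1.marginalLikelihood_eq hf, hrss1]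
    rfl
  have hma : ∀ N, BlockG.marginalLikelihood (n : ℝ) a 0 (BlockG.cols X (I₁ ∪ I₂)) (y N) =
      BlockG.mixture {j // j ∈ I₁ ∪ I₂} n a (fun j => v N j) Ra := fun N => by
    rw [hXa.marginalLikelihood_eq hf, hrssa]
    rfl
  have hfin : ∀ N, 0 < BlockG.marginalLikelihood (n : ℝ) a 0 (BlockG.cols X I₁) (y N) ∧
      BlockG.marginalLikelihood (n : ℝ) a 0 (BlockG.cols X I₁) (y N) < ∞ := fun N => by
    rw [hm1]
    exact ⟨BlockG.mixture_pos (v := fun j : {j // j ∈ I₁} => v N j) hn2 ha1 (fun j => hv N j) hR₀pos,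
      BlockG.mixture_lt_top (v := fun j : {j // j ∈ I₁} => v N j) hn2 ha1 (fun j => hv N j) hR₀pos⟩
  set J : Finset {j // j ∈ I₁ ∪ I₂} := I₁.subtype (· ∈ I₁ ∪ I₂) with hJ
  set K : Finset {j // j ∈ I₁ ∪ I₂} := I₂.subtype (· ∈ I₁ ∪ I₂) with hK
  have hsumJ : ∀ g : Fin p → ℝ, ∑ j ∈ J, g j = ∑ j ∈ I₁, g j := fun g =>
    Finset.sum_subtype_of_mem g fun j hj => Finset.mem_union_left _ hj
  have hsumK : ∀ g : Fin p → ℝ, ∑ j ∈ K, g j = ∑ j ∈ I₂, g j := fun g =>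
    Finset.sum_subtype_of_mem g fun j hj => Finset.mem_union_right _ hj
  have hJcard : J.card = I₁.card := by
    have := hsumJ fun _ => 1
    simpa using this
  have hmemJ : ∀ {j : {j // j ∈ I₁ ∪ I₂}}, j ∈ J ↔ j.1 ∈ I₁ := Finset.mem_subtype
  have hmemK : ∀ {j : {j // j ∈ I₁ ∪ I₂}}, j ∈ K ↔ j.1 ∈ I₂ := Finset.mem_subtype
  have hnotJ : ∀ {j : {j // j ∈ I₁ ∪ I₂}}, j ∉ J ↔ j.1 ∈ I₂ := fun {j} => by
    rw [hmemJ]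
    exact ⟨fun h => (Finset.mem_union.1 j.2).resolve_left h, fun h => Finset.disjoint_right.1 hdisj h⟩
  have hJne : J.Nonempty := Finset.card_pos.1 (by omega)
  have hlower : ∃ c : ℝ≥0∞, 0 < c ∧ ∀ N,
      c ≤ BlockG.bayesFactor (n : ℝ) a 0 X (I₁ ∪ I₂) I₁ (y N) := by
    obtain ⟨j₂, hj₂⟩ := hI₂
    obtain ⟨C, hC, hle⟩ := BlockG.exists_sum_blockIntegral_le (n := n) hτ ha1
      (⟨fun j => ⟨j.1, Finset.mem_union_left _ j.2⟩, fun i j h => Subtype.ext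
        (congrArg (fun k : {j // j ∈ I₁ ∪ I₂} => k.1) h)⟩ :
        {j // j ∈ I₁} ↪ {j // j ∈ I₁ ∪ I₂}) K ⟨⟨j₂, Finset.mem_union_right _ hj₂⟩, hmemK.2 hj₂⟩
      (fun j => by
        rw [hmemK, ← hnotJ, hmemJ, not_iff_not]
        constructor
        · exact fun h => ⟨⟨j.1, h⟩, rfl⟩
        · rintro ⟨i, rfl⟩
          exact i.2)
    refine ⟨C⁻¹, ENNReal.inv_pos.2 hC.ne, fun N => ?_⟩
    have h := hle (fun j => v N j) Ra fun j => hv N j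
    have hKN : Ra + ∑ j ∈ K, v N j = R₀ := by
      rw [hsumK (v N), Finset.sum_congr rfl fun j hj => hv2 N j (Finset.disjoint_right.1 hdisj hj),
        hRa]
      ring
    rw [hKN] at h
    rw [BlockG.bayesFactor, ENNReal.le_div_iff_mul_le (Or.inl (hfin N).1.ne')
      (Or.inl (hfin N).2.ne), hm1, hma]
    calc _ ≤ C⁻¹ * (C * BlockG.mixture {j // j ∈ I₁ ∪ I₂} n a (fun j => v N j) Ra) :=
          mul_le_mul_right h _
      _ ≤ _ := by
          rw [← mul_assoc]
          exact mul_le_of_le_one_left zero_le (ENNReal.inv_mul_le_one _)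
  obtain ⟨c₀, hc₀, hc₀le⟩ := hlower
  refine ⟨hfin, hc₀.trans_le (le_liminf_of_le (by isBoundedDefault)
    (Eventually.of_forall hc₀le)), fun hcase => ?_⟩
  -- A normalization common to both models cancels in the quotient.
  suffices hmain : ∃ φ : ℕ → ℝ≥0∞, (∀ᶠ N in atTop, φ N ≠ 0 ∧ φ N ≠ ∞) ∧
      (∃ L : ℝ≥0∞, 0 < L ∧ L < ∞ ∧ Tendsto (fun N => φ N *
        BlockG.mixture {j // j ∈ I₁ ∪ I₂} n a (fun j => v N j) Ra) atTop (𝓝 L)) ∧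
      ∃ L : ℝ≥0∞, 0 < L ∧ L < ∞ ∧ Tendsto (fun N => φ N *
        BlockG.mixture {j // j ∈ I₁} n a (fun j => v N j) R₀) atTop (𝓝 L) by
    obtain ⟨φ, h1, h2, h3⟩ := hmain
    simp only [BlockG.bayesFactor, hm1, hma]
    exact BlockG.exists_tendsto_div h1 h2 h3
  have hgrow := BlockG.exists_uniform_growth (v := fun N (j : {j // j ∈ I₁}) => v N j) fun j => by
    simp only [hv1]
    exact BlockG.exists_growth_bounds (hβ₁ j) _ (hX.colSq_pos j)
  obtain ⟨hU, c, hc, hcU⟩ := hgrow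
  have hUJ : ∀ N, ∑ j ∈ J, v N j = ∑ j : {j // j ∈ I₁}, v N j := fun N => by
    rw [hsumJ (v N), Finset.sum_coe_sort I₁]
  have hpR : (p : ℝ) = I₁.card + I₂.card := by exact_mod_cast hI₁p.symm
  have hc₂R : (1 : ℝ) ≤ I₂.card := by exact_mod_cast hc₂
  have hcarda : (Fintype.card {j // j ∈ I₁ ∪ I₂} : ℝ) = p := by
    rw [Fintype.card_coe, hunion, Finset.card_univ, Fintype.card_fin]
  have hcond : 0 < Ra ∨ (∀ j : {j // j ∈ I₁ ∪ I₂}, j ∉ J → 0 < t j) ∧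
      ((n : ℝ) - 1) / 2 ≤ (Fintype.card {j // j ∈ I₁ ∪ I₂} : ℝ) / 2 := by
    rcases hcase with hε | ⟨hn, hne, -⟩
    · left
      rw [← hrssa 0]
      refine hXa.rss_pos fun h => hε ?_
      have h1 : BlockG.FitsExactly X ((fun _ => β₀) + BlockG.cols X I₁ *ᵥ β₁ 0) :=
        BlockG.FitsExactly.of_cols ⟨β₀, β₁ 0, rfl⟩
      have h2 : BlockG.FitsExactly X (BlockG.cols X I₂ *ᵥ β₂) :=
        BlockG.FitsExactly.of_cols ⟨0, β₂, by funext; simp⟩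
      have h3 := (h.of_cols.sub h1).sub h2
      have e : y 0 - ((fun _ => β₀) + BlockG.cols X I₁ *ᵥ β₁ 0) - BlockG.cols X I₂ *ᵥ β₂ = ε := by
        rw [hy]
        abel
      rwa [e] at h3
    · right
      refine ⟨fun j hj => ?_, ?_⟩
      · have h1 := hne j (hnotJ.1 hj)
        have h2 := hX.colSq_pos j
        have h3 : BlockG.lsCoef X u j ≠ 0 := div_ne_zero h1 h2.ne'
        simp only [htdef]
        positivity
      · rw [hcarda, hn]
        push_cast
        linarith
  -- Is the capacity of the block I₁ at most r, so that this block decides the order, or does it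
  -- exceed r, so that every partition has order N^(-r)?
  rcases le_or_gt (a + 1 + (I₁.card : ℝ) / 2) (((n : ℝ) - 1) / 2) with hqr | hqr
  · obtain ⟨ψ, l, hψ⟩ := BlockG.exists_isScale (κ := (I₁.card : ℝ)) hτ ha1 (by positivity) hqr
    refine ⟨fun N => ENNReal.ofReal (ψ (∑ j : {j // j ∈ I₁}, v N j)), ?_, ?_, ?_⟩
    · filter_upwards [hU.eventually_gt_atTop 1] with N hN
      exact ⟨(ENNReal.ofReal_pos.2 (hψ.pos _ hN)).ne', ENNReal.ofReal_ne_top⟩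
    · rw [← hJcard] at hψ hqr
      refine hψ.tendsto_mixture hn2 ha1 hJne hqr (v := fun N j => v N j) (fun N j => hv N j)
        (t := fun j => t j) (fun N j hj => hv2 N j ?_) hUJ hU hc ?_ hRa0 hcond
      · rwa [hmemJ] at hj
      · filter_upwards [hcU] with N hN j hj
        exact hN ⟨j.1, hmemJ.1 hj⟩
    · have hcard : (Finset.univ : Finset {j // j ∈ I₁}).card = I₁.card := by simp
      -- The small model is the case where J is the whole index set, with the same size and hence
      -- the same ψ.
      rw [← hcard] at hψ hqr
      refine hψ.tendsto_mixture hn2 ha1 Finset.univ_nonempty hqr (v := fun N j => v N j)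
        (fun N j => hv N j) (t := fun _ => 0) (fun N j hj => absurd (Finset.mem_univ j) hj)
        (fun _ => rfl) hU hc ?_ hR₀pos.le (Or.inl hR₀pos)
      filter_upwards [hcU] with N hN j _ using hN j
  · rcases hcase with hε | ⟨hn, -, hconv⟩
    -- Here n ≥ p+2, |I₂| ≥ 1 and a ≤ 0 give r ≥ 1 + |I₁|/2 ≥ a + 1 + |I₁|/2.
    · exfalso
      have h1 : ((p + 2 : ℕ) : ℝ) ≤ n := by exact_mod_cast hX.card_add_two_le hε
      push_cast at h1
      linarith
    have hn2R : (2 : ℝ) ≤ n := by exact_mod_cast hn2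
    choose s hs using hconv
    -- The lower bound in the exact order N keeps the limit of β_j²/N away from zero.
    have hspos : ∀ j, 0 < BlockG.colSq X j.1 * s j := fun j => by
      refine mul_pos (hX.colSq_pos j) ?_
      obtain ⟨c', C', hc', -, hcC⟩ := BlockG.exists_growth_bounds (hβ₁ j) 0 one_pos
      refine hc'.trans_le (ge_of_tendsto (hs j) ?_)
      filter_upwards [hcC, eventually_gt_atTop 0] with N hN hN0
      have : (0 : ℝ) < N := by exact_mod_cast hN0
      rw [le_div_iff₀ this]
      simpa using hN.1
    have hlim : ∀ j : {j // j ∈ I₁}, Tendsto (fun N : ℕ => v N j / N) atTop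
        (𝓝 (BlockG.colSq X j.1 * s j)) := fun j => by
      simp only [hv1]
      exact BlockG.tendsto_growth (hs j) _ _
    refine ⟨fun N => ENNReal.ofReal ((N : ℝ) ^ (((n : ℝ) - 1) / 2)), ?_, ?_, ?_⟩
    · filter_upwards [eventually_gt_atTop 0] with N hN
      have : (0 : ℝ) < N := by exact_mod_cast hN
      exact ⟨(ENNReal.ofReal_pos.2 (by positivity)).ne', ENNReal.ofReal_ne_top⟩
    · rw [← hJcard] at hqr
      refine BlockG.tendsto_mixture_of_lt hn2 ha1 hJne hqr (v := fun N j => v N j)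
        (s := fun j => if h : j.1 ∈ I₁ then BlockG.colSq X j.1 * s ⟨j.1, h⟩ else 0)
        (fun N j => hv N j) (fun j hj => ?_) (fun j hj => ?_) (fun j => ?_) hRa0
      · rw [hmemJ] at hj
        simp only [dif_pos hj]
        exact hspos ⟨j.1, hj⟩
      · rw [hmemJ] at hj
        simp only [dif_neg hj]
      · by_cases hj : j.1 ∈ I₁
        · simp only [dif_pos hj]
          exact hlim ⟨j.1, hj⟩
        · simp only [dif_neg hj, hv2 _ _ hj]
          exact tendsto_const_nhds.div_atTop tendsto_natCast_atTop_atTop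
    · have hcard : (Finset.univ : Finset {j // j ∈ I₁}).card = I₁.card := by simp
      rw [← hcard] at hqr
      exact BlockG.tendsto_mixture_of_lt hn2 ha1 Finset.univ_nonempty hqr
        (v := fun N j => v N j) (fun N j => hv N j) (fun j _ => hspos j)
        (fun j hj => absurd (Finset.mem_univ j) hj) hlim hR₀pos.le
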